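/- **Theorem (Execution Liveness of the Isos protocol).** Let $f\ge 0$ and consider the leaderless BFT state-machine replication protocol Isos with $N=3f+1$ replicas, of which at most $f$ are Byzantine, with delay bound $\Delta>0$, execution window of $k\ge 1$ slots per coordinator, an arbitrary deterministic application, an arbitrary number of clients, of which arbitrarily many may be faulty, unforgeable signatures and collision-free hashes (without checkpointing and garbage collection). The protocol. Requests conflict if they stem from the same client or do not commute (the conflict predicate may be larger). *Fast path:* a coordinator puts a client request in its next slot and broadcasts a DepPropose with its compact dependency set (per coordinator the latest conflicting slot known, earlier ones being implicit) and a quorum $F$ of $2f$ followers. A follower accepts the first valid DepPropose of a slot once it knows that agreement was started (DepPropose accepted, $f+1$ DepVerifys or $f+1$ ViewChanges) for the preceding slot and all listed dependencies; members of $F$ then broadcast a DepVerify with their own dependencies. If each additional dependency is reported by at least $f+1$ members of $F$, replicas send DepCommits, and $2f+1$ matching ones commit the slot. *Reconciliation path:* otherwise $2f+1$ matching Prepares, then $2f+1$ matching Commits are needed. *View change:* an expired commit timer ($9\Delta$; $3\Delta$ after a view change) starts a per-slot view change with rotating coordinator, which selects the reconciliation-path certificate of the highest view, else a fast-path certificate,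 else a no-op, and continues with the reconciliation path; $f+1$ ViewChanges make a replica join, and a new view not installed within $3\Delta$ after $2f+1$ ViewChanges is aborted. A DepPropose for which $2f$ DepVerifys are not collected within $2\Delta$ (or before a view change) is forwarded; a replica whose view change does not start within $4\Delta$ queries the others and adopts a result reported by $f+1$ replicas. A request replaced by a no-op is proposed again by its coordinator with the next quorum in a cyclic enumeration of all $2f$-subsets of followers. *Execution:* each replica executes strongly connected components of the dependency graph of committed, not yet executed slots in inverse topological order (sorted by slot number inside a component), provided that the graph lies within the windows of the $k$ slots following the oldest unexecuted slot of each coordinator; if nothing can be executed in this way and the oldest unexecuted slot of a coordinator is blocked only by slots beyond the windows, dependencies on the latter are ignored and the first component is executed. No-ops and requests whose timestamp is not larger than the last executed one of the same client are skipped; for every other executed request a reply is sent to the client. A correct client issues requests with increasing timestamps, each only after it has results for its earlier ones; it sends a request to some replica and, after a timeout without result, to all replicas. It has a result for a request once it has received matching replies from $f+1$ different replicas. Consider any infinite run in which time is unbounded, correct parties act without delay, messages between correct replicas and between correct replicas and correct clients are eventually delivered, and, from some time $T$ on, the network is synchronous: each message sent between correct replicas at a time $t\ge T$ arrives before $t+\Delta$.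 Then for every request issued by a correct client, the client eventually receives a result. -/

import Mathlib

namespace Isos

/-! ### Basic objects -/

/-- The `N = 3f + 1` replicas. -/
abbrev Replica (f : ℕ) := Fin (3 * f + 1)

/-- An agreement slot: the coordinator it belongs to and the coordinator-local counter. -/
structure Slot (f : ℕ) where
  co : Replica f
  sc : ℕ
deriving DecidableEq

/-- The sequence-number order in which the requests of one component are executed. -/
def Slot.Before {f : ℕ} (a b : Slot f) : Prop := a.sc < b.sc ∨ (a.sc = b.sc ∧ a.co < b.co)

/-- A client request: client, client-local timestamp, operation. -/
structure Req (Client Op : Type*) where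
  client : Client
  t : ℕ
  op : Op

/-- Compact dependency sets: `D c = 0` means that there is no dependency on slots of `c`, and
`D c = n + 1` that `⟨c, n⟩` is the latest slot of `c` in the set; the earlier slots of `c` are
implicit dependencies. -/
abbrev Deps (f : ℕ) := Replica f → ℕ

/-- The slot `s` is an explicit or implicit member of the compact dependency set `D`. -/
def Covers {f : ℕ} (D : Deps f) (s : Slot f) : Prop := s.sc < D s.co

/-- The replicated deterministic application with its conflict predicate: requests that do not
conflict commute, both in their effect and in their outcomes, and requests of the same client
always conflict. -/
structure App (Client Op Res State : Type*) where
  start : State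
  apply : State → Op → State × Res
  Conflict : Req Client Op → Req Client Op → Prop
  conflict_symm : ∀ a b, Conflict a b → Conflict b a
  conflict_same_client : ∀ a b, a.client = b.client → Conflict a b
  commute : ∀ a b, ¬ Conflict a b → ∀ s,
    (apply (apply s a.op).1 b.op).1 = (apply (apply s b.op).1 a.op).1 ∧
    (apply (apply s a.op).1 b.op).2 = (apply s b.op).2 ∧
    (apply (apply s b.op).1 a.op).2 = (apply s a.op).2

/-- A system: the protocol parameters and the choice of the faulty parties. -/
structure System (f : ℕ) (Client Op Res State : Type*) where
  app : App Client Op Res State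
  /-- the bound on the one-way network delay in synchronous phases -/
  Δ : ℝ
  Δ_pos : 0 < Δ
  /-- the size of the execution window per coordinator -/
  k : ℕ
  k_pos : 0 < k
  /-- the time after which a client without result sends its request to all replicas -/
  clientTimeout : ℝ
  /-- all fast-path quorums (`2f` followers) a coordinator can select, in the order in which it
  tries them, for instance by increasing communication delay -/
  quorums : Replica f → List (Finset (Replica f))
  mem_quorums : ∀ r F, F ∈ quorums r ↔ F.card = 2 * f ∧ r ∉ F
  /-- the faulty replicas -/
  byz : Finset (Replica f)
  byz_card : byz.card ≤ f
  /-- the correct clients; there may be any number of faulty ones -/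
  goodClient : Set Client

/-- The fast-path quorum used for the `a`-th proposal of a request: after each replacement of the
request by a no-op the coordinator moves on to the next quorum, cyclically. -/
def System.quorum {f : ℕ} {Client Op Res State : Type*} (S : System f Client Op Res State)
    (r : Replica f) (a : ℕ) : Finset (Replica f) :=
  (S.quorums r).getD (a % (S.quorums r).length) ∅

/-! ### Messages

Hashes are collision free, so the hash of an object is represented by the object itself.
Views are shifted by one: the initial view `-1` of a slot is `0` here, view `v` is `v + 1`. -/

/-- The (signed) header of a DepPropose: slot, (hash of) request, dependencies, quorum. -/
structure Header (f : ℕ) (Client Op : Type*) where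
  slot : Slot f
  req : Req Client Op
  D : Deps f
  F : Finset (Replica f)

/-- What is agreed on for a slot: `none` is the no-op, `some (h, g)` a DepPropose together with
the DepVerifys for it, follower `i ∈ h.F` having reported the dependency set `g i`. -/
abbrev Val (f : ℕ) (Client Op : Type*) := Option (Header f Client Op × (Replica f → Deps f))

/-- View-change certificates: none, fast-path certificate, or reconciliation-path certificate (of a
view, with the senders of the Prepares). -/
inductive Cert (f : ℕ) (Client Op : Type*)
  | empty
  | fpc (h : Header f Client Op) (g : Replica f → Deps f)
  | rpc (view : ℕ) (val : Val f Client Op) (P : Finset (Replica f))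

/-- The result of the agreement on a slot: request (`none` for a no-op) and dependencies. -/
abbrev Decision (f : ℕ) (Client Op : Type*) := Option (Req Client Op) × Deps f

inductive Msg (f : ℕ) (Client Op Res : Type*)
  /-- a client request -/
  | request (r : Req Client Op)
  /-- DepPropose with the full request -/
  | propose (h : Header f Client Op)
  /-- forwarded DepPropose without the request -/
  | fwd (h : Header f Client Op)
  /-- DepVerify of follower `i` for the DepPropose `h` -/
  | verify (i : Replica f) (h : Header f Client Op) (D : Deps f)
  | depCommit (s : Slot f) (i : Replica f) (val : Val f Client Op)
  | prepare (w : ℕ) (s : Slot f) (i : Replica f) (val : Val f Client Op)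
  | commit (w : ℕ) (s : Slot f) (i : Replica f) (val : Val f Client Op)
  | viewChange (w : ℕ) (s : Slot f) (i : Replica f) (c : Cert f Client Op)
  | newView (w : ℕ) (s : Slot f) (i : Replica f) (val : Val f Client Op)
      (vcs : Replica f → Option (Cert f Client Op))
  | queryExec (s : Slot f) (i : Replica f)
  | exec (s : Slot f) (i : Replica f) (d : Decision f Client Op)
  | reply (i : Replica f) (c : Client) (t : ℕ) (u : Res)

/-- `p` holds for at least `n` different replicas. -/
def AtLeast {f : ℕ} (n : ℕ) (p : Replica f → Prop) : Prop :=
  ∃ Q : Finset (Replica f), n ≤ Q.card ∧ ∀ i ∈ Q, p i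

/-- The coordinator of view `w` of a slot: `(s.co + max(0, v)) mod N` with `v = w - 1`. -/
def coord {f : ℕ} (s : Slot f) (w : ℕ) : Replica f :=
  ⟨(s.co.val + (w - 1)) % (3 * f + 1), Nat.mod_lt _ (Nat.succ_pos _)⟩

section Validity

variable {f : ℕ} {Client Op : Type*}

def ValidQuorum (h : Header f Client Op) : Prop := h.F.card = 2 * f ∧ h.slot.co ∉ h.F

/-- The fast-path condition: every dependency reported by a follower is already in the DepPropose
or is reported by at least `f + 1` followers. -/
def FpCond (h : Header f Client Op) (g : Replica f → Deps f) : Prop :=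
  ∀ d : Slot f, (∃ i ∈ h.F, Covers (g i) d) →
    Covers h.D d ∨ AtLeast (f + 1) fun i => i ∈ h.F ∧ Covers (g i) d

def ValidVal (s : Slot f) : Val f Client Op → Prop
  | none => True
  | some (h, g) => h.slot = s ∧ ValidQuorum h ∧ ∀ i, i ∉ h.F → g i = 0

/-- Well-formed certificate in a ViewChange for view `w` of slot `s`; signatures are checked by
`Genuine` below. -/
def ValidCert (s : Slot f) (w : ℕ) : Cert f Client Op → Prop
  | .empty => True
  | .fpc h g => ValidVal s (some (h, g)) ∧ FpCond h g
  | .rpc v val P => v < w ∧ 2 * f + 1 ≤ P.card ∧ ValidVal s val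

/-- `2f + 1` valid ViewChanges for view `w` of slot `s`. -/
def ValidVcs (s : Slot f) (w : ℕ) (vcs : Replica f → Option (Cert f Client Op)) : Prop :=
  (Finset.univ.filter fun i => (vcs i).isSome).card = 2 * f + 1 ∧
    ∀ i c, vcs i = some c → ValidCert s w c

/-- The result of a view change: the reconciliation-path certificate of the highest view, else a
fast-path certificate, else the no-op. -/
def Selected (vcs : Replica f → Option (Cert f Client Op)) (val : Val f Client Op) : Prop :=
  (∃ i v P, vcs i = some (.rpc v val P) ∧
    ∀ j v' val' P', vcs j = some (.rpc v' val' P') → v' ≤ v) ∨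
  ((∀ j v' val' P', vcs j ≠ some (.rpc v' val' P')) ∧
    ∃ i h g, vcs i = some (.fpc h g) ∧ val = some (h, g)) ∨
  ((∀ j c, vcs j = some c → c = .empty) ∧ val = none)

/-- The committed request, with the union of the dependency sets of the DepPropose and the
DepVerifys; a no-op has no dependencies. -/
def outcome : Val f Client Op → Decision f Client Op
  | none => (none, 0)
  | some (h, g) => (some h.req, fun c => max (h.D c) (h.F.sup fun i => g i c))

end Validity

/-! ### Local state of a correct replica -/

inductive Step
  | init | proposed | fpVerified | fpCommitted | rpVerified | rpPrepared | rpCommitted | viewChange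

structure Local {f : ℕ} {Client Op Res State : Type*} (S : System f Client Op Res State) where
  /-- received messages, including the own ones -/
  rcv : Set (Msg f Client Op Res)
  /-- sent messages; all of them are broadcast -/
  sent : Set (Msg f Client Op Res)
  /-- the own proposals, by slot counter: request, and number of its earlier proposals -/
  mine : List (Req Client Op × ℕ)
  /-- the accepted DepPropose of a slot -/
  hdr : Slot f → Option (Header f Client Op)
  /-- whether the request of the accepted DepPropose is known -/
  pr : Slot f → Bool
  /-- the accepted DepVerifys of a slot -/
  v : Slot f → Replica f → Option (Deps f)
  step : Slot f → Step
  view : Slot f → ℕ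
  val : Slot f → Val f Client Op
  cert : Slot f → Cert f Client Op
  /-- expiry times of the timers: propose (per DepPropose), commit, view change, query -/
  propT : Header f Client Op → Option ℝ
  comT : Slot f → Option ℝ
  vcT : Slot f → Option ℝ
  queryT : Slot f → Option ℝ
  /-- the committed slots with their results -/
  dec : Slot f → Option (Decision f Client Op)
  /-- the executed slots -/
  done : Set (Slot f)
  app : State
  /-- the timestamp of the last executed request of each client -/
  last : Client → WithBot ℕ

section LocalDefs

variable {f : ℕ} {Client Op Res State : Type*} {S : System f Client Op Res State}

def Local.start (S : System f Client Op Res State) : Local S where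
  rcv := ∅
  sent := ∅
  mine := []
  hdr _ := none
  pr _ := false
  v _ _ := none
  step _ := .init
  view _ := 0
  val _ := none
  cert _ := .empty
  propT _ := none
  comT _ := none
  vcT _ := none
  queryT _ := none
  dec _ := none
  done := ∅
  app := S.app.start
  last _ := ⊥

/-- Broadcast a set of messages; a replica receives its own messages at once. -/
def Local.send (L : Local S) (M : Set (Msg f Client Op Res)) : Local S :=
  { L with sent := L.sent ∪ M, rcv := L.rcv ∪ M }

def Local.setStep (L : Local S) (s : Slot f) (x : Step) : Local S :=
  { L with step := Function.update L.step s x }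

/-- The compact set of all slots with a known request that conflicts with `r`. -/
noncomputable def Local.conflicts (L : Local S) (r : Req Client Op) : Deps f := fun c =>
  sInf {n | ∀ s h, s.co = c → L.hdr s = some h → L.pr s = true → S.app.Conflict h.req r → s.sc < n}

/-- The replica knows that the consensus process of slot `d` was initiated. -/
def Local.Accepts (L : Local S) (d : Slot f) : Prop :=
  L.hdr d ≠ none ∨
  (AtLeast (f + 1) fun i => ∃ h D, h.slot = d ∧ Msg.verify i h D ∈ L.rcv) ∨
  (AtLeast (f + 1) fun i => ∃ w c, Msg.viewChange w d i c ∈ L.rcv)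

/-- `wait` does not block on the dependency set `D`: its explicit members are accepted. -/
def Local.WaitOK (L : Local S) (D : Deps f) : Prop := ∀ c n, D c = n + 1 → L.Accepts ⟨c, n⟩

/-- The replica has accepted all `2f` DepVerifys for the DepPropose `h`. -/
def Local.Collected (L : Local S) (h : Header f Client Op) : Prop :=
  L.hdr h.slot = some h ∧ ∀ i ∈ h.F, L.v h.slot i ≠ none

/-- The dependency sets of the accepted DepVerifys. -/
def Local.vec (L : Local S) (h : Header f Client Op) : Replica f → Deps f := fun i =>
  if i ∈ h.F then (L.v h.slot i).getD 0 else 0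

/-- At least `n` replicas reported a view of slot `s` that is at least `w`. -/
def Local.ViewsReached (L : Local S) (n : ℕ) (s : Slot f) (w : ℕ) : Prop :=
  AtLeast n fun i => ∃ w' c, w ≤ w' ∧ Msg.viewChange w' s i c ∈ L.rcv

/-- Abort the current view of slot `s` and start the view change to view `w`; DepProposes whose
propose timer is active are forwarded. -/
noncomputable def Local.enterView (L : Local S) (me : Replica f) (now : ℝ) (s : Slot f) (w : ℕ) :
    Local S :=
  { L with
    view := Function.update L.view s w
    step := Function.update L.step s Step.viewChange
    comT := Function.update L.comT s none
    vcT := Function.update L.vcT s none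
    queryT := Function.update L.queryT s (some (now + 4 * S.Δ)) }.send
    ({Msg.viewChange w s me (L.cert s)} ∪
      {m | ∃ h, m = Msg.fwd h ∧ h.slot = s ∧ L.propT h ≠ none ∧ ¬ L.Collected h})

/-- Forward a result to the execution. -/
def Local.decide (L : Local S) (s : Slot f) (d : Decision f Client Op) : Local S :=
  { L with dec := Function.update L.dec s (some ((L.dec s).getD d)) }

/-! Execution -/

/-- The counter of the oldest not yet executed slot of a coordinator. -/
noncomputable def Local.root (L : Local S) (c : Replica f) : ℕ := sInf {n | (⟨c, n⟩ : Slot f) ∉ L.done}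

/-- The slot is not beyond the expansion limit. -/
def Local.InWindow (L : Local S) (s : Slot f) : Prop := s.sc < L.root s.co + S.k

/-- Edges of the dependency graph: `b` is a not yet executed dependency of the committed slot `a`.
The graph is restricted to the slots in `W`. -/
def Local.Edge (L : Local S) (W : Slot f → Prop) (a b : Slot f) : Prop :=
  b ∉ L.done ∧ W b ∧ ∃ d, L.dec a = some d ∧ Covers d.2 b

/-- Reachability in the dependency graph restricted to `W`. -/
def Local.Reach (L : Local S) (W : Slot f → Prop) : Slot f → Slot f → Prop :=
  Relation.ReflTransGen (L.Edge W)

/-- The slot `a` can be executed regularly: it and all its direct and indirect not yet executed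
dependencies are committed and lie in the window. -/
def Local.Executable (L : Local S) (a : Slot f) : Prop :=
  a ∉ L.done ∧ ∀ b, L.Reach (fun _ => True) a b → L.dec b ≠ none ∧ L.InWindow b

/-- The oldest not yet executed slot `a` of some coordinator can be executed if dependencies beyond
the window are ignored. -/
def Local.Unblockable (L : Local S) (a : Slot f) : Prop :=
  a.sc = L.root a.co ∧ ∀ b, L.Reach L.InWindow a b → L.dec b ≠ none

/-- The list `l` enumerates, by sequence number, a strongly connected component that comes first in
the inverse topological order of the dependency graph of `a`, that is a component from which no
other one is reachable. -/
def Local.FirstComponent (L : Local S) (W : Slot f → Prop) (a : Slot f) (l : List (Slot f)) :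
    Prop :=
  ∃ b, L.Reach W a b ∧ (∀ x, L.Reach W b x → L.Reach W x b) ∧
    (∀ x, x ∈ l ↔ L.Reach W b x) ∧ l.Pairwise Slot.Before

open Classical in
/-- Execute a committed slot: no-ops and duplicates are skipped, for other requests a reply is
sent. -/
noncomputable def Local.execSlot (me : Replica f) (L : Local S) (s : Slot f) : Local S :=
  match L.dec s with
  | some (some r, _) =>
    if L.last r.client < (r.t : WithBot ℕ) then
      { L with
        done := insert s L.done
        app := (S.app.apply L.app r.op).1
        last := Function.update L.last r.client (r.t : WithBot ℕ) }.send
        {Msg.reply me r.client r.t (S.app.apply L.app r.op).2}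
    else { L with done := insert s L.done }
  | _ => { L with done := insert s L.done }

/-! ### The protocol: actions of a correct replica `me` at time `now` -/

open Classical in
inductive Act (S : System f Client Op Res State) (me : Replica f) (now : ℝ) : Local S → Local S → Prop
  /-- Propose a request in the next own slot: either for the first time, having received it, or
  again after an earlier proposal was replaced by a no-op. -/
  | propose (L : Local S) (r : Req Client Op) (a : ℕ) (s : Slot f) (h : Header f Client Op)
      (hnew : (r, a) ∉ L.mine)
      (hdue : (a = 0 ∧ Msg.request r ∈ L.rcv) ∨
        ∃ b n, a = b + 1 ∧ L.mine[n]? = some (r, b) ∧ ∃ D, L.dec ⟨me, n⟩ = some (none, D))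
      (hs : s = ⟨me, L.mine.length⟩)
      (hh : h = ⟨s, r, L.conflicts r, S.quorum me a⟩) :
      Act S me now L
        ({ L with
          mine := L.mine ++ [(r, a)]
          hdr := Function.update L.hdr s (some h)
          pr := Function.update L.pr s true
          step := Function.update L.step s .proposed
          comT := Function.update L.comT s (some (now + 9 * S.Δ)) }.send {Msg.propose h})
  /-- A follower starts the propose timer on receiving a DepPropose, directly or forwarded. -/
  | startProposeTimer (L : Local S) (h : Header f Client Op)
      (hrcv : Msg.propose h ∈ L.rcv ∨ Msg.fwd h ∈ L.rcv)
      (hco : me ≠ h.slot.co) (hview : L.view h.slot = 0) (hT : L.propT h = none) :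
      Act S me now L
        { L with propT := Function.update L.propT h (some (now + 2 * S.Δ)) }
  /-- When the propose timer expires without `2f` accepted DepVerifys, the DepPropose is
  forwarded. -/
  | forward (L : Local S) (h : Header f Client Op) (τ : ℝ)
      (hT : L.propT h = some τ) (hτ : τ ≤ now) (hview : L.view h.slot = 0)
      (hcol : ¬ L.Collected h) (hnew : Msg.fwd h ∉ L.sent) :
      Act S me now L (L.send {Msg.fwd h})
  /-- Accept the first valid DepPropose of a slot, once its dependencies and the preceding slot are
  accepted; this starts the commit timer. -/
  | acceptPropose (L : Local S) (h : Header f Client Op)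
      (hrcv : Msg.propose h ∈ L.rcv ∨ Msg.fwd h ∈ L.rcv)
      (hco : me ≠ h.slot.co) (hview : L.view h.slot = 0) (hT : L.propT h ≠ none)
      (hfirst : L.hdr h.slot = none) (hF : ValidQuorum h)
      (hwait : L.WaitOK h.D) (hgap : ∀ n, h.slot.sc = n + 1 → L.Accepts ⟨h.slot.co, n⟩) :
      Act S me now L
        { L with
          hdr := Function.update L.hdr h.slot (some h)
          comT := Function.update L.comT h.slot
            (some ((L.comT h.slot).getD (now + 9 * S.Δ))) }
  /-- Having the request of the accepted DepPropose, too, process it; members of the fast-path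
  quorum broadcast a DepVerify. -/
  | acceptRequest (L : Local S) (h : Header f Client Op)
      (hhdr : L.hdr h.slot = some h) (hrcv : Msg.propose h ∈ L.rcv)
      (hview : L.view h.slot = 0) (hstep : L.step h.slot = .init) :
      Act S me now L
        ({ L with
          pr := Function.update L.pr h.slot true
          step := Function.update L.step h.slot .proposed }.send
          {m | me ∈ h.F ∧ m = Msg.verify me h (L.conflicts h.req)})
  /-- Accept the first valid DepVerify of a member of the fast-path quorum. -/
  | acceptVerify (L : Local S) (h : Header f Client Op) (i : Replica f) (D : Deps f)
      (hrcv : Msg.verify i h D ∈ L.rcv) (hhdr : L.hdr h.slot = some h) (hi : i ∈ h.F)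
      (hview : L.view h.slot = 0) (hfirst : L.v h.slot i = none) (hwait : L.WaitOK D) :
      Act S me now L
        { L with v := Function.update L.v h.slot (Function.update (L.v h.slot) i (some D)) }
  /-- `f + 1` DepVerifys for a slot start its commit timer. -/
  | startCommitTimer (L : Local S) (s : Slot f) (hview : L.view s = 0) (hT : L.comT s = none)
      (hq : AtLeast (f + 1) fun i => ∃ h D, h.slot = s ∧ Msg.verify i h D ∈ L.rcv) :
      Act S me now L { L with comT := Function.update L.comT s (some (now + 9 * S.Δ)) }
  /-- fast path -/
  | fpVerify (L : Local S) (h : Header f Client Op)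
      (hview : L.view h.slot = 0) (hstep : L.step h.slot = .proposed)
      (hcol : L.Collected h) (hc : FpCond h (L.vec h)) :
      Act S me now L
        ({ L with
          step := Function.update L.step h.slot .fpVerified
          val := Function.update L.val h.slot (some (h, L.vec h))
          cert := Function.update L.cert h.slot (.fpc h (L.vec h)) }.send
          {Msg.depCommit h.slot me (some (h, L.vec h))})
  | fpCommit (L : Local S) (s : Slot f) (hstep : L.step s = .fpVerified)
      (hq : AtLeast (2 * f + 1) fun i => Msg.depCommit s i (L.val s) ∈ L.rcv) :
      Act S me now L ((L.setStep s .fpCommitted).decide s (outcome (L.val s)))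
  /-- reconciliation path -/
  | rpVerify (L : Local S) (h : Header f Client Op)
      (hview : L.view h.slot = 0) (hstep : L.step h.slot = .proposed)
      (hcol : L.Collected h) (hc : ¬ FpCond h (L.vec h)) :
      Act S me now L
        ({ L with
          step := Function.update L.step h.slot .rpVerified
          val := Function.update L.val h.slot (some (h, L.vec h)) }.send
          {Msg.prepare 0 h.slot me (some (h, L.vec h))})
  | rpPrepare (L : Local S) (s : Slot f) (Q : Finset (Replica f))
      (hstep : L.step s = .rpVerified) (hQ : 2 * f + 1 ≤ Q.card)
      (hq : ∀ i ∈ Q, Msg.prepare (L.view s) s i (L.val s) ∈ L.rcv) :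
      Act S me now L
        ({ L with
          step := Function.update L.step s .rpPrepared
          cert := Function.update L.cert s (.rpc (L.view s) (L.val s) Q) }.send
          {Msg.commit (L.view s) s me (L.val s)})
  | rpCommit (L : Local S) (s : Slot f) (hstep : L.step s = .rpPrepared)
      (hq : AtLeast (2 * f + 1) fun i => Msg.commit (L.view s) s i (L.val s) ∈ L.rcv) :
      Act S me now L ((L.setStep s .rpCommitted).decide s (outcome (L.val s)))
  /-- view change: expired commit timer -/
  | commitTimeout (L : Local S) (s : Slot f) (τ : ℝ)
      (hT : L.comT s = some τ) (hτ : τ ≤ now) (hdec : L.dec s = none) :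
      Act S me now L (L.enterView me now s (L.view s + 1))
  /-- join: move to the `(f + 1)`-highest view received -/
  | joinView (L : Local S) (s : Slot f) (w : ℕ) (hw : L.view s < w)
      (hq : L.ViewsReached (f + 1) s w)
      (hmax : ∀ w', L.ViewsReached (f + 1) s w' → w' ≤ w) :
      Act S me now L (L.enterView me now s w)
  /-- `2f + 1` replicas having reached the view, start the view-change timer -/
  | startViewTimer (L : Local S) (s : Slot f) (hstep : L.step s = .viewChange)
      (hdec : L.dec s = none) (hT : L.vcT s = none)
      (hq : L.ViewsReached (2 * f + 1) s (L.view s)) :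
      Act S me now L { L with vcT := Function.update L.vcT s (some (now + 3 * S.Δ)) }
  | viewTimeout (L : Local S) (s : Slot f) (τ : ℝ) (hstep : L.step s = .viewChange)
      (hT : L.vcT s = some τ) (hτ : τ ≤ now) (hdec : L.dec s = none) :
      Act S me now L (L.enterView me now s (L.view s + 1))
  /-- the view-change coordinator determines the result -/
  | newView (L : Local S) (s : Slot f) (val : Val f Client Op)
      (vcs : Replica f → Option (Cert f Client Op))
      (hstep : L.step s = .viewChange) (hco : me = coord s (L.view s))
      (hrcv : ∀ i c, vcs i = some c → Msg.viewChange (L.view s) s i c ∈ L.rcv)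
      (hvcs : ValidVcs s (L.view s) vcs) (hsel : Selected vcs val)
      (hnew : ∀ val' vcs', Msg.newView (L.view s) s me val' vcs' ∉ L.sent) :
      Act S me now L (L.send {Msg.newView (L.view s) s me val vcs})
  /-- follow the coordinator into the new view and resume on the reconciliation path -/
  | acceptNewView (L : Local S) (s : Slot f) (val : Val f Client Op)
      (vcs : Replica f → Option (Cert f Client Op))
      (hstep : L.step s = .viewChange)
      (hrcv : Msg.newView (L.view s) s (coord s (L.view s)) val vcs ∈ L.rcv)
      (hvcs : ValidVcs s (L.view s) vcs) (hsel : Selected vcs val) :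
      Act S me now L
        ({ L with
          step := Function.update L.step s .rpVerified
          val := Function.update L.val s val
          comT := Function.update L.comT s (some (now + 3 * S.Δ)) }.send
          {Msg.prepare (L.view s) s me val})
  /-- the view change did not start in time: ask the others for the result -/
  | query (L : Local S) (s : Slot f) (τ : ℝ) (hstep : L.step s = .viewChange)
      (hvc : L.vcT s = none) (hT : L.queryT s = some τ) (hτ : τ ≤ now) (hdec : L.dec s = none)
      (hnew : Msg.queryExec s me ∉ L.sent) :
      Act S me now L (L.send {Msg.queryExec s me})
  /-- answer a query as soon as the result is known -/
  | answer (L : Local S) (s : Slot f) (j : Replica f) (d : Decision f Client Op)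
      (hrcv : Msg.queryExec s j ∈ L.rcv) (hdec : L.dec s = some d) (hnew : Msg.exec s me d ∉ L.sent) :
      Act S me now L (L.send {Msg.exec s me d})
  /-- `f + 1` matching answers commit the slot -/
  | execCommit (L : Local S) (s : Slot f) (d : Decision f Client Op) (hdec : L.dec s = none)
      (hq : AtLeast (f + 1) fun i => Msg.exec s i d ∈ L.rcv) :
      Act S me now L (L.decide s d)
  /-- Regular execution. One component is executed per action; the remaining components of the
  dependency graph of `a` stay executable. -/
  | execRegular (L : Local S) (a : Slot f) (l : List (Slot f)) (ha : L.Executable a)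
      (hl : L.FirstComponent (fun _ => True) a l) :
      Act S me now L (l.foldl (Local.execSlot me) L)
  /-- Unblock execution: nothing can be executed regularly, the graph of a root node is only
  blocked by slots beyond the window; only the first component is executed. -/
  | execUnblock (L : Local S) (a : Slot f) (l : List (Slot f)) (hreg : ∀ b, ¬ L.Executable b)
      (ha : L.Unblockable a) (hl : L.FirstComponent L.InWindow a l) :
      Act S me now L (l.foldl (Local.execSlot me) L)

end LocalDefs

/-! ### The system -/

/-- State of a client. -/
structure ClientState (f : ℕ) (Client Op Res : Type*) where
  /-- issued requests, the latest one first -/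
  issued : List (Req Client Op)
  /-- the replicas each request was sent to -/
  sends : Set (Req Client Op × Replica f)
  deadline : ℝ
  /-- received replies: sender, timestamp of the request, result -/
  replies : Set (Replica f × ℕ × Res)

/-- The client has the result `u` for the request `r`: `f + 1` matching replies. -/
def ClientState.HasResult {f : ℕ} {Client Op Res : Type*} (C : ClientState f Client Op Res)
    (r : Req Client Op) (u : Res) : Prop :=
  AtLeast (f + 1) fun i => (i, r.t, u) ∈ C.replies

section SystemDefs

variable {f : ℕ} {Client Op Res State : Type*} {S : System f Client Op Res State}

structure Global (S : System f Client Op Res State) where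
  now : ℝ
  /-- states of the replicas (without meaning for faulty ones) -/
  loc : Replica f → Local S
  /-- states of the clients (without meaning for faulty ones) -/
  cl : Client → ClientState f Client Op Res

def Global.start (S : System f Client Op Res State) : Global S where
  now := 0
  loc _ := Local.start S
  cl _ := ⟨[], ∅, 0, ∅⟩

/-! Signatures: faulty parties can sign anything, and send it to whom they like; a statement of a
correct party exists only after this party has made it. -/

/-- The statement `m` carries a signature of replica `i`. -/
def Global.Signed (G : Global S) (i : Replica f) (m : Msg f Client Op Res) : Prop :=
  i ∈ S.byz ∨ m ∈ (G.loc i).sent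

def Global.SignedReq (G : Global S) (r : Req Client Op) : Prop :=
  r.client ∉ S.goodClient ∨ r ∈ (G.cl r.client).issued

def Global.SignedHeader (G : Global S) (h : Header f Client Op) : Prop :=
  G.Signed h.slot.co (Msg.propose h)

def Global.GenuineVal (G : Global S) : Val f Client Op → Prop
  | none => True
  | some (h, g) => G.SignedHeader h ∧ G.SignedReq h.req ∧
      ∀ i ∈ h.F, G.Signed i (Msg.verify i h (g i))

def Global.GenuineCert (G : Global S) (s : Slot f) : Cert f Client Op → Prop
  | .empty => True
  | .fpc h g => G.GenuineVal (some (h, g))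
  | .rpc v val P => G.GenuineVal val ∧ ∀ i ∈ P, G.Signed i (Msg.prepare v s i val)

def Global.GenuineVC (G : Global S) (w : ℕ) (s : Slot f) (i : Replica f)
    (c : Cert f Client Op) : Prop :=
  (i ∈ S.byz ∧ G.GenuineCert s c) ∨ Msg.viewChange w s i c ∈ (G.loc i).sent

/-- All signatures in the message are genuine; other messages are discarded by the recipients. -/
def Global.Genuine (G : Global S) : Msg f Client Op Res → Prop
  | .request r => G.SignedReq r
  | .propose h => G.SignedHeader h ∧ G.SignedReq h.req
  | .fwd h => G.SignedHeader h
  | .verify i h D => G.Signed i (Msg.verify i h D)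
  | .depCommit s i val => G.Signed i (Msg.depCommit s i val)
  | .prepare w s i val => G.Signed i (Msg.prepare w s i val)
  | .commit w s i val => G.Signed i (Msg.commit w s i val)
  | .viewChange w s i c => G.GenuineVC w s i c
  | .newView w s i val vcs =>
      (i ∈ S.byz ∧ ∀ j c, vcs j = some c → G.GenuineVC w s j c) ∨
        Msg.newView w s i val vcs ∈ (G.loc i).sent
  | .queryExec s i => G.Signed i (Msg.queryExec s i)
  | .exec s i d => G.Signed i (Msg.exec s i d)
  | .reply i c t u => G.Signed i (Msg.reply i c t u)

/-- The latest request `r` of client `c` has no result at time `u`, its deadline has passed, and it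
was not yet sent to all replicas. -/
def Global.MustResend (G : Global S) (c : Client) (r : Req Client Op) (u : ℝ) : Prop :=
  (G.cl c).issued.head? = some r ∧ (∀ x, ¬ (G.cl c).HasResult r x) ∧ (G.cl c).deadline ≤ u ∧
    ∃ j, (r, j) ∉ (G.cl c).sends

open Classical in
/-- The steps of the system. Actions of correct parties take no time and are not delayed: time
passes only while no such action is enabled. -/
inductive Global.Next : Global S → Global S → Prop
  | act (G : Global S) (i : Replica f) (L : Local S) (hi : i ∉ S.byz)
      (h : Act S i G.now (G.loc i) L) :
      Global.Next G { G with loc := Function.update G.loc i L }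
  | deliver (G : Global S) (j : Replica f) (m : Msg f Client Op Res) (hj : j ∉ S.byz)
      (h : G.Genuine m) :
      Global.Next G
        { G with
          loc := Function.update G.loc j
            { G.loc j with rcv := insert m (G.loc j).rcv } }
  /-- A correct client issues a request, with a new timestamp, after having received the results of
  its earlier ones, and sends it to some replica. -/
  | issue (G : Global S) (r : Req Client Op) (j : Replica f) (hc : r.client ∈ S.goodClient)
      (h : ∀ r' ∈ (G.cl r.client).issued, r'.t < r.t ∧ ∃ u, (G.cl r.client).HasResult r' u) :
      Global.Next G
        { G with
          cl := Function.update G.cl r.client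
            { G.cl r.client with
              issued := r :: (G.cl r.client).issued
              sends := insert (r, j) (G.cl r.client).sends
              deadline := G.now + S.clientTimeout } }
  /-- A correct client sends its request to all replicas after a timeout. -/
  | resend (G : Global S) (c : Client) (r : Req Client Op) (hc : c ∈ S.goodClient)
      (h : G.MustResend c r G.now) :
      Global.Next G
        { G with
          cl := Function.update G.cl c
            { G.cl c with sends := (G.cl c).sends ∪ {x | x.1 = r} } }
  | reply (G : Global S) (c : Client) (i : Replica f) (t : ℕ) (u : Res) (hc : c ∈ S.goodClient)
      (h : G.Genuine (Msg.reply i c t u)) :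
      Global.Next G
        { G with
          cl := Function.update G.cl c
            { G.cl c with replies := insert (i, t, u) (G.cl c).replies } }
  | tick (G : Global S) (t' : ℝ) (ht : G.now < t')
      (hact : ∀ i ∉ S.byz, ∀ u, G.now ≤ u → u < t' → ∀ L, ¬ Act S i u (G.loc i) L)
      (hcl : ∀ c ∈ S.goodClient, ∀ u, G.now ≤ u → u < t' → ∀ r, ¬ G.MustResend c r u) :
      Global.Next G { G with now := t' }

/-- An infinite run of the system, in which time grows beyond all bounds. -/
structure IsRun (G : ℕ → Global S) : Prop where
  start : G 0 = Global.start S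
  next : ∀ n, (G n).Next (G (n + 1))
  unbounded : ∀ t : ℝ, ∃ n, t < (G n).now

/-- Messages between correct parties are delivered eventually. -/
structure Reliable (G : ℕ → Global S) : Prop where
  replicas : ∀ i ∉ S.byz, ∀ j ∉ S.byz, ∀ n, ∀ m ∈ ((G n).loc i).sent,
    ∃ n', m ∈ ((G n').loc j).rcv
  requests : ∀ c ∈ S.goodClient, ∀ j ∉ S.byz, ∀ n r, (r, j) ∈ ((G n).cl c).sends →
    ∃ n', Msg.request r ∈ ((G n').loc j).rcv
  replies : ∀ i ∉ S.byz, ∀ c ∈ S.goodClient, ∀ n t u, Msg.reply i c t u ∈ ((G n).loc i).sent →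
    ∃ n', (i, t, u) ∈ ((G n').cl c).replies

/-- From time `T` on the network is synchronous: a message between correct replicas that is sent at
a time `t ≥ T` arrives before `t + Δ`. -/
def SynchronousFrom (G : ℕ → Global S) (T : ℝ) : Prop :=
  ∀ i ∉ S.byz, ∀ j ∉ S.byz, ∀ n m, m ∉ ((G n).loc i).sent → m ∈ ((G (n + 1)).loc i).sent →
    T ≤ (G (n + 1)).now →
      ∃ n', (G n').now < (G (n + 1)).now + S.Δ ∧ m ∈ ((G n').loc j).rcv

end SystemDefs

end Isos

namespace Isos

/-! ### Quorums -/

section Quorums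

variable {f : ℕ} {Client Op Res State : Type*} (S : System f Client Op Res State)

/-! Three facts combine: a request received by a correct replica is decided in a slot of that
replica (`IsRun.request_decided`), every slot whose agreement was started is executed by all correct
replicas (`IsRun.executed`), and the replies of correct replicas to the same timestamp of a client
coincide (`IsRun.reply_unique`). A client that never got a result would have sent its request to all
replicas, and the replies of the at least `2f + 1` correct ones would give it one.

Safety rests on quorum intersection: two sets of `2f + 1` replicas share a correct one. A
coordinator and its `2f` followers form such a set, so even a faulty coordinator cannot get two
headers of a slot agreed on. Decisions survive view changes by the usual locking argument
(`IsRun.eq_of_slowChosen`, `IsRun.outcome_of_fastChosen`); fast-path certificates may differ,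
because faulty followers may equivocate, but the fast-path condition forces equal outcomes
(`IsRun.outcome_eq`). For two conflicting decided requests, a correct replica in both quorums
handled one of them knowing the other, so one slot depends on the other
(`IsRun.covers_of_conflict`). Hence distinct components that are ready for execution contain no
conflicting requests and commute, which makes execution confluent (`Exec.Move.confluent`).

Liveness of a single slot: once a correct replica has accepted a DepPropose, all take part within
`3Δ` after synchronization, however long the chain of dependencies is (`IsRun.before_started`). If
every view is eventually reached by `f + 1` correct replicas, then a late view with a correct
coordinator decides (`IsRun.decided_of_view`). Otherwise all views become constant; an undecided
replica is then stuck in a view change and has queried the others. Either `f + 1` correct replicas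
have decided and their answers suffice, or `f + 1` correct ones are undecided, and the one with the
lowest final view would see `2f + 1` replicas at its view and start a timer, a contradiction
(`IsRun.decided`).

A request replaced by no-ops is proposed again until, after synchronization, a quorum of correct
followers has its turn; that proposal is decided within `8Δ`, before any commit timer of `9Δ`
expires (`IsRun.decided_of_propose`). Execution cannot stall: only finitely many slots lie in the
windows that a stalled replica ends up with, all known ones among them get decided, and then one of
the two execution rules applies.

Timed arguments use states in which no correct replica can act: since time passes only in such
states, whatever is enabled has already been done. -/

theorem System.compl_card : 2 * f + 1 ≤ (Finset.univ \ S.byz).card := by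
  have h1 := S.byz_card
  rw [Finset.card_sdiff_of_subset (Finset.subset_univ _), Finset.card_univ, Fintype.card_fin]
  omega

theorem AtLeast.mono {f n m : ℕ} {p q : Replica f → Prop} (h : AtLeast n p) (hm : m ≤ n)
    (hpq : ∀ i, p i → q i) : AtLeast m q := by
  obtain ⟨Q, hQ, hp⟩ := h
  exact ⟨Q, hm.trans hQ, fun i hi => hpq i (hp i hi)⟩

/-- Among `f + 1` replicas there is a correct one. -/
theorem AtLeast.exists_correct {p : Replica f → Prop} (h : AtLeast (f + 1) p) :
    ∃ i, i ∉ S.byz ∧ p i := by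
  obtain ⟨Q, hQ, hp⟩ := h
  by_contra! hc
  have : Q ⊆ S.byz := fun i hi => by
    by_contra hb
    exact hc i hb (hp i hi)
  have := Finset.card_le_card this
  have := S.byz_card
  omega

/-- Two quorums of `2f + 1` replicas have a correct replica in common. -/
theorem AtLeast.inter {p q : Replica f → Prop} (hp : AtLeast (2 * f + 1) p)
    (hq : AtLeast (2 * f + 1) q) : ∃ i, i ∉ S.byz ∧ p i ∧ q i := by
  obtain ⟨Q, hQ, hp⟩ := hp
  obtain ⟨Q', hQ', hq⟩ := hq
  have h1 := Finset.card_union_add_card_inter Q Q'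
  have h2 : (Q ∪ Q').card ≤ 3 * f + 1 := by
    simpa using Finset.card_le_univ (Q ∪ Q')
  refine AtLeast.exists_correct S ⟨Q ∩ Q', by omega, fun i hi => ?_⟩
  rw [Finset.mem_inter] at hi
  exact ⟨hp i hi.1, hq i hi.2⟩

/-- Among `2f + 1` replicas there are `f + 1` correct ones. -/
theorem AtLeast.correct {p : Replica f → Prop} (h : AtLeast (2 * f + 1) p) :
    AtLeast (f + 1) fun i => i ∉ S.byz ∧ p i := by
  obtain ⟨Q, hQ, hp⟩ := h
  refine ⟨Q \ S.byz, ?_, fun i hi => ?_⟩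
  · have := Finset.le_card_sdiff S.byz Q
    have := S.byz_card
    omega
  · rw [Finset.mem_sdiff] at hi
    exact ⟨hi.2, hp i hi.1⟩

theorem atLeast_of_correct {p : Replica f → Prop} (h : ∀ i ∉ S.byz, p i) :
    AtLeast (2 * f + 1) p :=
  ⟨Finset.univ \ S.byz, S.compl_card, fun i hi => h i (Finset.mem_sdiff.1 hi).2⟩

/-- The coordinator of a slot together with a valid fast-path quorum form a quorum of `2f + 1`. -/
theorem ValidQuorum.atLeast {h : Header f Client Op} (hF : ValidQuorum h) :
    AtLeast (2 * f + 1) fun i => i = h.slot.co ∨ i ∈ h.F :=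
  ⟨insert h.slot.co h.F, by rw [Finset.card_insert_of_notMem hF.2, hF.1], fun i hi => by
    simpa using hi⟩

theorem System.quorums_ne_nil (r : Replica f) : S.quorums r ≠ [] := by
  have h1 : 2 * f ≤ (Finset.univ.erase r : Finset (Replica f)).card := by
    rw [Finset.card_erase_of_mem (Finset.mem_univ r), Finset.card_univ, Fintype.card_fin]
    omega
  obtain ⟨F, hF, hc⟩ := Finset.exists_subset_card_eq h1
  have : F ∈ S.quorums r := (S.mem_quorums r F).2 ⟨hc, fun hr => by simpa using hF hr⟩
  exact List.ne_nil_of_mem this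

theorem System.quorum_mem (r : Replica f) (a : ℕ) : S.quorum r a ∈ S.quorums r := by
  have h : 0 < (S.quorums r).length := List.length_pos_iff.2 (S.quorums_ne_nil r)
  unfold System.quorum
  rw [List.getD_eq_getElem _ _ (Nat.mod_lt _ h)]
  exact List.getElem_mem _

/-- A fast-path quorum of correct followers is tried again and again. -/
theorem System.exists_correct_quorum (r : Replica f) (hr : r ∉ S.byz) (m : ℕ) :
    ∃ a, m ≤ a ∧ ∀ i ∈ S.quorum r a, i ∉ S.byz := by
  have h1 : 2 * f ≤ ((Finset.univ \ S.byz).erase r).card := by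
    rw [Finset.card_erase_of_mem (by simp [hr])]
    have := S.compl_card
    omega
  obtain ⟨F, hF, hc⟩ := Finset.exists_subset_card_eq h1
  have hm : F ∈ S.quorums r := (S.mem_quorums r F).2 ⟨hc, fun h => by simpa using hF h⟩
  obtain ⟨j, hj, rfl⟩ := List.getElem_of_mem hm
  -- Going `m` times round the cycle before position `j` makes the index at least `m`.
  refine ⟨j + (S.quorums r).length * m, ?_, fun i hi => ?_⟩
  · have : 1 ≤ (S.quorums r).length := by omega
    nlinarith
  · have h2 : S.quorum r (j + (S.quorums r).length * m) = (S.quorums r)[j] := by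
      unfold System.quorum
      rw [Nat.add_mul_mod_self_left, Nat.mod_eq_of_lt hj, List.getD_eq_getElem _ _ hj]
    rw [h2] at hi
    simpa using Finset.mem_of_mem_erase (hF hi)

end Quorums

/-! ### Effect of the actions on the local state -/

section LocalLemmas

variable {f : ℕ} {Client Op Res State : Type*} {S : System f Client Op Res State}
  {me : Replica f} {now : ℝ} {L L' : Local S}

/-- Execution changes the application state and sends replies only. -/
theorem foldl_execSlot (me : Replica f) (l : List (Slot f)) (L : Local S) :
    ∃ A T R, R.Finite ∧ (∀ m ∈ R, ∃ c t u, m = Msg.reply me c t u) ∧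
      l.foldl (Local.execSlot me) L =
        { L with
          done := L.done ∪ {x | x ∈ l}
          app := A
          last := T
          sent := L.sent ∪ R
          rcv := L.rcv ∪ R } := by
  induction l generalizing L with
  | nil => exact ⟨L.app, L.last, ∅, Set.finite_empty, by simp, by simp⟩
  | cons s l ih =>
    have h1 : ∃ A T R, R.Finite ∧ (∀ m ∈ R, ∃ c t u, m = Msg.reply me c t u) ∧
        Local.execSlot me L s =
          { L with
            done := insert s L.done
            app := A
            last := T
            sent := L.sent ∪ R
            rcv := L.rcv ∪ R } := by
      unfold Local.execSlot
      split
      · split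
        · exact ⟨_, _, _, Set.finite_singleton _, by simp, rfl⟩
        · exact ⟨L.app, L.last, ∅, Set.finite_empty, by simp, by simp⟩
      · exact ⟨L.app, L.last, ∅, Set.finite_empty, by simp, by simp⟩
    obtain ⟨A, T, R, hR, hm, he⟩ := h1
    obtain ⟨A', T', R', hR', hm', he'⟩ := ih (Local.execSlot me L s)
    refine ⟨A', T', R ∪ R', hR.union hR', ?_, ?_⟩
    · rintro m (h | h)
      exacts [hm m h, hm' m h]
    · rw [List.foldl_cons, he', he]
      simp only [Set.union_assoc, Local.mk.injEq, true_and, and_true]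
      ext x
      simp
      tauto

/-- The component-wise growth of the local state. -/
structure Local.Le (L L' : Local S) : Prop where
  rcv : L.rcv ⊆ L'.rcv
  sent : L.sent ⊆ L'.sent
  mine : L.mine <+: L'.mine
  hdr : ∀ s h, L.hdr s = some h → L'.hdr s = some h
  pr : ∀ s, L.pr s = true → L'.pr s = true
  v : ∀ s i D, L.v s i = some D → L'.v s i = some D
  view : ∀ s, L.view s ≤ L'.view s
  propT : ∀ h τ, L.propT h = some τ → L'.propT h = some τ
  dec : ∀ s d, L.dec s = some d → L'.dec s = some d
  done : L.done ⊆ L'.done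

theorem Local.Le.refl (L : Local S) : L.Le L :=
  ⟨subset_rfl, subset_rfl, List.prefix_rfl, fun _ _ => id, fun _ => id, fun _ _ _ => id,
    fun _ => le_rfl, fun _ _ => id, fun _ _ => id, subset_rfl⟩

theorem Local.Le.trans {L₁ L₂ L₃ : Local S} (a : L₁.Le L₂) (b : L₂.Le L₃) : L₁.Le L₃ :=
  ⟨a.rcv.trans b.rcv, a.sent.trans b.sent, a.mine.trans b.mine,
    fun s h x => b.hdr s h (a.hdr s h x), fun s x => b.pr s (a.pr s x),
    fun s i D x => b.v s i D (a.v s i D x), fun s => (a.view s).trans (b.view s),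
    fun h τ x => b.propT h τ (a.propT h τ x), fun s d x => b.dec s d (a.dec s d x),
    a.done.trans b.done⟩

theorem Local.Le.accepts (h : L.Le L') {d : Slot f} (ha : L.Accepts d) : L'.Accepts d := by
  rcases ha with ha | ha | ha
  · left
    obtain ⟨x, hx⟩ := Option.ne_none_iff_exists'.1 ha
    rw [h.hdr _ _ hx]
    simp
  · exact Or.inr (Or.inl (ha.mono le_rfl fun i ⟨x, D, h1, h2⟩ => ⟨x, D, h1, h.rcv h2⟩))
  · exact Or.inr (Or.inr (ha.mono le_rfl fun i ⟨w, c, h1⟩ => ⟨w, c, h.rcv h1⟩))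

theorem Local.Le.waitOK (h : L.Le L') {D : Deps f} (ha : L.WaitOK D) : L'.WaitOK D :=
  fun c n hn => h.accepts (ha c n hn)

theorem Local.Le.collected (h : L.Le L') {x : Header f Client Op} (ha : L.Collected x) :
    L'.Collected x ∧ L'.vec x = L.vec x := by
  have key : ∀ i ∈ x.F, ∃ D, L.v x.slot i = some D ∧ L'.v x.slot i = some D := fun i hi => by
    obtain ⟨D, hD⟩ := Option.ne_none_iff_exists'.1 (ha.2 i hi)
    exact ⟨D, hD, h.v _ _ _ hD⟩
  refine ⟨⟨h.hdr _ _ ha.1, fun i hi => ?_⟩, ?_⟩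
  · obtain ⟨D, -, hD⟩ := key i hi
    simp [hD]
  · funext i
    unfold Local.vec
    split
    · next hi =>
      obtain ⟨D, h1, h2⟩ := key i hi
      simp [h1, h2]
    · rfl

/-- A slot counter that the replica has not yet used for a proposal is free. -/
def Local.FreshOwn (me : Replica f) (L : Local S) : Prop :=
  ∀ n, L.mine.length ≤ n → L.hdr ⟨me, n⟩ = none ∧ L.pr ⟨me, n⟩ = false

/-- Headers, DepVerifys and propose timers are written only into empty places, and `Local.decide`
keeps an earlier result. The exception is `Act.propose`, which writes unconditionally into the next
own slot; hence the freshness hypothesis. -/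
theorem Act.le (h : Act S me now L L') (hf : L.FreshOwn me) : L.Le L' := by
  cases h with
  | execRegular a l ha hl =>
    obtain ⟨A, T, R, -, -, he⟩ := foldl_execSlot me l L
    rw [he]
    constructor <;> simp
  | execUnblock a l hreg ha hl =>
    obtain ⟨A, T, R, -, -, he⟩ := foldl_execSlot me l L
    rw [he]
    constructor <;> simp
  | _ =>
    constructor <;> intros <;>
    simp only [Local.send, Local.enterView, Local.setStep, Local.decide, Function.update_apply] <;> try grind [Local.FreshOwn]

end LocalLemmas
-- Inversion of actions: headers, proposals, timers and views
section LocalInvariants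

variable {f : ℕ} {Client Op Res State : Type*} {S : System f Client Op Res State}
  {me : Replica f} {now : ℝ} {L L' : Local S}

theorem Act.sent_rcv (h : Act S me now L L') (i : L.sent ⊆ L.rcv) : L'.sent ⊆ L'.rcv := by
  cases h with
  | execRegular a l _ _ | execUnblock a l _ _ _ =>
    obtain ⟨A, T, R, -, hR, he⟩ := foldl_execSlot me l L
    rw [he]
    exact Set.union_subset_union_left _ i
  | _ =>
    simp only [Local.send, Local.enterView, Local.setStep, Local.decide]
    first | exact i | exact Set.union_subset_union_left _ i

/-- Finiteness later provides one moment by which everything sent before synchronization has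
arrived. The propose timers are included because entering a view may forward the DepProposes of all
of them that belong to the slot. -/
theorem Act.finite_sent (h : Act S me now L L')
    (i : L.sent.Finite ∧ {x | L.propT x ≠ none}.Finite) :
    L'.sent.Finite ∧ {x | L'.propT x ≠ none}.Finite := by
  cases h with
  | execRegular a l _ _ | execUnblock a l _ _ _ =>
    obtain ⟨A, T, R, hf, hR, he⟩ := foldl_execSlot me l L
    rw [he]
    exact ⟨i.1.union hf, i.2⟩
  | startProposeTimer x =>
    refine ⟨i.1, (i.2.union (Set.finite_singleton x)).subset ?_⟩
    intro y hy
    simp only [Function.update_apply] at hy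
    grind
  | acceptRequest x =>
    exact ⟨i.1.union ((Set.finite_singleton (Msg.verify me x (L.conflicts x.req))).subset
      (by grind)), i.2⟩
  | commitTimeout s | joinView s | viewTimeout s =>
    refine ⟨i.1.union ((Set.finite_singleton _).union ((i.2.image Msg.fwd).subset ?_)), i.2⟩
    rintro m ⟨h, rfl, _, h2, _⟩
    exact ⟨h, h2, rfl⟩
  | _ =>
    simp only [Local.send, Local.setStep, Local.decide]
    first | exact i | exact ⟨i.1.union (Set.finite_singleton _), i.2⟩

theorem Act.fresh (h : Act S me now L L') (i : L.FreshOwn me) : L'.FreshOwn me := by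
  unfold Local.FreshOwn at *
  cases h with
  | execRegular a l _ _ | execUnblock a l _ _ _ =>
    obtain ⟨A, T, R, -, hR, he⟩ := foldl_execSlot me l L
    rw [he]
    exact i
  | _ =>
    simp only [Local.send, Local.enterView, Local.setStep, Local.decide, Function.update_apply]
    first | exact i | grind

/-- How a header is stored. -/
theorem Act.hdr_cases (h : Act S me now L L') {s : Slot f} {x : Header f Client Op}
    (hx : L'.hdr s = some x) : L.hdr s = some x ∨
    (L.hdr s = none ∨ s.co = me) ∧ x.slot = s ∧ ((∃ r a, s = ⟨me, L.mine.length⟩ ∧ L'.mine = L.mine ++ [(r, a)] ∧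
        x = ⟨s, r, L.conflicts r, S.quorum me a⟩ ∧ L'.pr s = true ∧ Msg.propose x ∈ L'.sent) ∨
      (s.co ≠ me ∧ (Msg.propose x ∈ L.rcv ∨ Msg.fwd x ∈ L.rcv) ∧ L.propT x ≠ none ∧ 
        L'.mine = L.mine ∧ L'.sent = L.sent ∧
        ValidQuorum x ∧ L.WaitOK x.D ∧ ∀ n, s.sc = n + 1 → L.Accepts ⟨s.co, n⟩)) := by
  cases h with
  | execRegular a l _ _ | execUnblock a l _ _ _ =>
    obtain ⟨A, T, R, -, hR, he⟩ := foldl_execSlot me l L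
    rw [he] at hx
    exact Or.inl hx
  | _ =>
    simp only [Local.send, Local.enterView, Local.setStep, Local.decide, Function.update_apply] at *
    first | exact Or.inl hx | grind

theorem Act.propT_cases (h : Act S me now L L') {x : Header f Client Op}
    (hx : L'.propT x ≠ none) : L.propT x ≠ none ∨
      L'.propT x = some (now + 2 * S.Δ) ∧ L.view x.slot = 0 ∧ me ≠ x.slot.co ∧ L'.view = L.view ∧ (Msg.propose x ∈ L.rcv ∨ Msg.fwd x ∈ L.rcv) := by
  cases h with
  | execRegular a l _ _ | execUnblock a l _ _ _ =>
    obtain ⟨A, T, R, -, hR, he⟩ := foldl_execSlot me l L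
    rw [he] at hx
    exact Or.inl hx
  | _ =>
    simp only [Local.send, Local.enterView, Local.setStep, Local.decide, Function.update_apply] at *
    first | exact Or.inl hx | grind

theorem Act.pr_cases (h : Act S me now L L') {s : Slot f} (hx : L'.pr s = true) :
    L.pr s = true ∨ (∃ x, L'.hdr s = some x ∧ (Msg.propose x ∈ L.rcv ∨ Msg.propose x ∈ L'.sent)
     ∧ x.slot = s ∧ L'.step s = .proposed ∧ L'.view = L.view) := by
  cases h with
  | execRegular a l _ _ | execUnblock a l _ _ _ =>
    obtain ⟨A, T, R, -, hR, he⟩ := foldl_execSlot me l L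
    rw [he] at hx
    exact Or.inl hx
  | _ =>
    simp only [Local.send, Local.enterView, Local.setStep, Local.decide, Function.update_apply] at *
    first | exact Or.inl hx | grind

theorem Act.mine_cases (h : Act S me now L L') : L'.mine = L.mine ∨
    ∃ r a, (r, a) ∉ L.mine ∧ L'.mine = L.mine ++ [(r, a)] ∧ ((a = 0 ∧ Msg.request r ∈ L.rcv) ∨
        ∃ b n, a = b + 1 ∧ L.mine[n]? = some (r, b) ∧ ∃ D, L.dec ⟨me, n⟩ = some (none, D)) ∧
      L'.hdr ⟨me, L.mine.length⟩ = some ⟨⟨me, L.mine.length⟩, r, L.conflicts r, S.quorum me a⟩ := by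
  cases h with
  | execRegular a l _ _ | execUnblock a l _ _ _ =>
    obtain ⟨A, T, R, -, hR, he⟩ := foldl_execSlot me l L
    rw [he]
    exact Or.inl rfl
  | _ =>
    simp only [Local.send, Local.enterView, Local.setStep, Local.decide, Function.update_apply] at *
    first | exact Or.inl rfl | grind

theorem Act.propose_cases (h : Act S me now L L') {x : Header f Client Op}
    (hx : Msg.propose x ∈ L'.sent) : Msg.propose x ∈ L.sent ∨
    (∃ r a, x = ⟨⟨me, L.mine.length⟩, r, L.conflicts r, S.quorum me a⟩ ∧
      L'.mine = L.mine ++ [(r, a)] ∧ L'.hdr x.slot = some x ∧ L'.pr x.slot = true) := by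
  cases h with
  | execRegular a l _ _ | execUnblock a l _ _ _ =>
    obtain ⟨A, T, R, -, hR, he⟩ := foldl_execSlot me l L
    rw [he] at hx
    grind
  | _ =>
    simp only [Local.send, Local.enterView, Local.setStep, Local.decide, Function.update_apply] at *
    first | exact Or.inl hx | grind

theorem Act.fwd_cases (h : Act S me now L L') {x : Header f Client Op}
    (hx : Msg.fwd x ∈ L'.sent) : Msg.fwd x ∈ L.sent ∨ L.propT x ≠ none := by
  cases h with
  | execRegular a l _ _ | execUnblock a l _ _ _ =>
    obtain ⟨A, T, R, -, hR, he⟩ := foldl_execSlot me l L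
    rw [he] at hx
    grind
  | _ =>
    simp only [Local.send, Local.enterView, Local.setStep, Local.decide, Function.update_apply] at *
    first | exact Or.inl hx | grind

theorem Act.view_cases (h : Act S me now L L') (s : Slot f) : L'.view s = L.view s ∨
    L.view s < L'.view s ∧ L' = L.enterView me now s (L'.view s) ∧
      (L'.view s = L.view s + 1 ∧ (∃ τ ≤ now, L.dec s = none ∧ (L.comT s = some τ ∨ L.step s = .viewChange ∧ L.vcT s = some τ)) ∨ 
       L.ViewsReached (f + 1) s (L'.view s)) := by
  cases h with
  | execRegular a l _ _ | execUnblock a l _ _ _ =>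
    obtain ⟨A, T, R, -, hR, he⟩ := foldl_execSlot me l L
    rw [he]
    exact Or.inl rfl
  | commitTimeout s' τ hT hτ hdec =>
    by_cases e : s = s'
    · subst e
      right
      have : (L.enterView me now s (L.view s + 1)).view s = L.view s + 1 := by
        simp [Local.enterView, Local.send]
      rw [this]
      exact ⟨by omega, rfl, Or.inl ⟨rfl, τ, hτ, hdec, Or.inl hT⟩⟩
    · left
      simp [Local.enterView, Local.send, e]
  | joinView s' w hw hq hm =>
    by_cases e : s = s'
    · subst e
      right
      have : (L.enterView me now s w).view s = w := by
        simp [Local.enterView, Local.send]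
      rw [this]
      exact ⟨by omega, rfl, Or.inr hq⟩
    · left
      simp [Local.enterView, Local.send, e]
  | viewTimeout s' τ hs hT hτ hdec =>
    by_cases e : s = s'
    · subst e
      right
      have : (L.enterView me now s (L.view s + 1)).view s = L.view s + 1 := by
        simp [Local.enterView, Local.send]
      rw [this]
      exact ⟨by omega, rfl, Or.inl ⟨rfl, τ, hτ, hdec, Or.inr ⟨hs, hT⟩⟩⟩
    · left
      simp [Local.enterView, Local.send, e]
  | _ => exact Or.inl rfl

end LocalInvariants
-- Inversion of actions: votes, view changes and decisions
section LocalInvariants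

variable {f : ℕ} {Client Op Res State : Type*} {S : System f Client Op Res State}
  {me : Replica f} {now : ℝ} {L L' : Local S}

theorem Act.v_cases (h : Act S me now L L') {s : Slot f} {i : Replica f} {D : Deps f}
    (hx : L'.v s i = some D) : L.v s i = some D ∨
    ∃ x, L.hdr s = some x ∧ x.slot = s ∧ i ∈ x.F ∧ Msg.verify i x D ∈ L.rcv ∧ L.WaitOK D := by
  cases h with
  | execRegular a l _ _ | execUnblock a l _ _ _ =>
    obtain ⟨A, T, R, -, hR, he⟩ := foldl_execSlot me l L
    rw [he] at hx
    exact Or.inl hx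
  | _ =>
    simp only [Local.send, Local.enterView, Local.setStep, Local.decide, Function.update_apply] at *
    first | exact Or.inl hx | grind

theorem Act.verify_cases (h : Act S me now L L') {i : Replica f} {x : Header f Client Op}
    {D : Deps f} (hx : Msg.verify i x D ∈ L'.sent) : Msg.verify i x D ∈ L.sent ∨
    (i = me ∧ me ∈ x.F ∧ D = L.conflicts x.req ∧ L.hdr x.slot = some x ∧ L.view x.slot = 0 ∧
      L.step x.slot = .init ∧ L'.pr x.slot = true ∧ L'.step x.slot = .proposed) := by
  cases h with
  | execRegular a l _ _ | execUnblock a l _ _ _ =>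
    obtain ⟨A, T, R, -, hR, he⟩ := foldl_execSlot me l L
    rw [he] at hx
    grind
  | _ =>
    simp only [Local.send, Local.enterView, Local.setStep, Local.decide, Function.update_apply] at *
    first | exact Or.inl hx | grind

theorem Act.depCommit_cases (h : Act S me now L L') {i : Replica f} {s : Slot f}
    {val : Val f Client Op} (hx : Msg.depCommit s i val ∈ L'.sent) :
    Msg.depCommit s i val ∈ L.sent ∨
    (i = me ∧ ∃ x, x.slot = s ∧ val = some (x, L.vec x) ∧ L.Collected x ∧ FpCond x (L.vec x) ∧
      L.view s = 0 ∧ L'.view s = 0 ∧ L'.cert s = .fpc x (L.vec x) ∧ L.step s = .proposed) := by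
  cases h with
  | execRegular a l _ _ | execUnblock a l _ _ _ =>
    obtain ⟨A, T, R, -, hR, he⟩ := foldl_execSlot me l L
    rw [he] at hx
    grind
  | _ =>
    simp only [Local.send, Local.enterView, Local.setStep, Local.decide, Function.update_apply] at *
    first | exact Or.inl hx | grind

theorem Act.prepare_cases (h : Act S me now L L') {i : Replica f} {s : Slot f} {w : ℕ}
    {val : Val f Client Op} (hx : Msg.prepare w s i val ∈ L'.sent) :
    Msg.prepare w s i val ∈ L.sent ∨
    (i = me ∧ w = L.view s ∧ L'.view s = L.view s ∧ L'.step s = .rpVerified ∧ L'.val s = val ∧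
      ((w = 0 ∧ L.step s = .proposed ∧ ∃ x, x.slot = s ∧ val = some (x, L.vec x) ∧ L.Collected x ∧ ¬ FpCond x (L.vec x)) ∨
       (L.step s = .viewChange ∧ ∃ vcs, Msg.newView w s (coord s w) val vcs ∈ L.rcv ∧ ValidVcs s w vcs ∧
        Selected vcs val))) := by
  cases h with
  | execRegular a l _ _ | execUnblock a l _ _ _ =>
    obtain ⟨A, T, R, -, hR, he⟩ := foldl_execSlot me l L
    rw [he] at hx
    grind
  | _ =>
    simp only [Local.send, Local.enterView, Local.setStep, Local.decide, Function.update_apply] at *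
    first | exact Or.inl hx | grind

theorem Act.commit_cases (h : Act S me now L L') {i : Replica f} {s : Slot f} {w : ℕ}
    {val : Val f Client Op} (hx : Msg.commit w s i val ∈ L'.sent) :
    Msg.commit w s i val ∈ L.sent ∨
    (i = me ∧ w = L.view s ∧ L'.view s = L.view s ∧ val = L.val s ∧ L.step s = .rpVerified ∧
      ∃ Q : Finset (Replica f), 2 * f + 1 ≤ Q.card ∧ (∀ j ∈ Q, Msg.prepare w s j val ∈ L.rcv) ∧
        L'.cert s = .rpc w val Q) := by
  cases h with
  | execRegular a l _ _ | execUnblock a l _ _ _ =>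
    obtain ⟨A, T, R, -, hR, he⟩ := foldl_execSlot me l L
    rw [he] at hx
    grind
  | _ =>
    simp only [Local.send, Local.enterView, Local.setStep, Local.decide, Function.update_apply] at *
    first | exact Or.inl hx | grind

theorem Act.viewChange_cases (h : Act S me now L L') {i : Replica f} {s : Slot f} {w : ℕ}
    {c : Cert f Client Op} (hx : Msg.viewChange w s i c ∈ L'.sent) :
    Msg.viewChange w s i c ∈ L.sent ∨
    (i = me ∧ w = L'.view s ∧ L.view s < w ∧ c = L.cert s ∧ L'.cert s = L.cert s) := by
  cases h with
  | execRegular a l _ _ | execUnblock a l _ _ _ =>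
    obtain ⟨A, T, R, -, hR, he⟩ := foldl_execSlot me l L
    rw [he] at hx
    grind
  | _ =>
    simp only [Local.send, Local.enterView, Local.setStep, Local.decide, Function.update_apply] at *
    first | exact Or.inl hx | grind

theorem Act.newView_cases (h : Act S me now L L') {i : Replica f} {s : Slot f} {w : ℕ}
    {val : Val f Client Op} {vcs : Replica f → Option (Cert f Client Op)}
    (hx : Msg.newView w s i val vcs ∈ L'.sent) :
    Msg.newView w s i val vcs ∈ L.sent ∨
    (i = me ∧ (∀ j c, vcs j = some c → Msg.viewChange w s j c ∈ L.rcv) ∧ ValidVcs s w vcs ∧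
      Selected vcs val ∧ (∀ val' vcs', Msg.newView w s me val' vcs' ∉ L.sent) ∧
      ∀ val' vcs', Msg.newView w s me val' vcs' ∈ L'.sent → val' = val ∧ vcs' = vcs) := by
  cases h with
  | execRegular a l _ _ | execUnblock a l _ _ _ =>
    obtain ⟨A, T, R, -, hR, he⟩ := foldl_execSlot me l L
    rw [he] at hx
    grind
  | _ =>
    simp only [Local.send, Local.enterView, Local.setStep, Local.decide, Function.update_apply] at *
    first | exact Or.inl hx | grind

theorem Act.exec_cases (h : Act S me now L L') {i : Replica f} {s : Slot f}
    {d : Decision f Client Op} (hx : Msg.exec s i d ∈ L'.sent) :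
    Msg.exec s i d ∈ L.sent ∨ (i = me ∧ L.dec s = some d) := by
  cases h with
  | execRegular a l _ _ | execUnblock a l _ _ _ =>
    obtain ⟨A, T, R, -, hR, he⟩ := foldl_execSlot me l L
    rw [he] at hx
    grind
  | _ =>
    simp only [Local.send, Local.enterView, Local.setStep, Local.decide, Function.update_apply] at *
    first | exact Or.inl hx | grind

theorem Act.dec_cases (h : Act S me now L L') {s : Slot f} {d : Decision f Client Op}
    (hx : L'.dec s = some d) : L.dec s = some d ∨
    (∃ val, d = outcome val ∧ ((AtLeast (2 * f + 1) fun i => Msg.depCommit s i val ∈ L.rcv) ∨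
      ∃ w, AtLeast (2 * f + 1) fun i => Msg.commit w s i val ∈ L.rcv)) ∨
    AtLeast (f + 1) fun i => Msg.exec s i d ∈ L.rcv := by
  cases h with
  | execRegular a l _ _ | execUnblock a l _ _ _ =>
    obtain ⟨A, T, R, -, hR, he⟩ := foldl_execSlot me l L
    rw [he] at hx
    exact Or.inl hx
  | fpCommit s' hstep hq =>
    simp only [Local.setStep, Local.decide, Function.update_apply] at *
    split at hx
    · next e =>
      subst e
      cases hd : L.dec s with
      | some d' => simp [hd] at hx; left; rw [hx]
      | none => simp [hd] at hx; exact Or.inr (Or.inl ⟨L.val s, hx.symm, Or.inl hq⟩)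
    · exact Or.inl hx
  | rpCommit s' hstep hq =>
    simp only [Local.setStep, Local.decide, Function.update_apply] at *
    split at hx
    · next e =>
      subst e
      cases hd : L.dec s with
      | some d' => simp [hd] at hx; left; rw [hx]
      | none => simp [hd] at hx; exact Or.inr (Or.inl ⟨L.val s, hx.symm, Or.inr ⟨_, hq⟩⟩)
    · exact Or.inl hx
  | execCommit s' d' hd hq =>
    simp only [Local.decide, Function.update_apply] at *
    split at hx
    · next e =>
      subst e
      simp [hd] at hx
      subst hx
      exact Or.inr (Or.inr hq)
    · exact Or.inl hx
  | _ => exact Or.inl hx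

/-- The sender named in a message. -/
def Msg.sender : Msg f Client Op Res → Option (Replica f)
  | .verify i _ _ => i
  | .depCommit _ i _ => i
  | .prepare _ _ i _ => i
  | .commit _ _ i _ => i
  | .viewChange _ _ i _ => i
  | .newView _ _ i _ _ => i
  | .queryExec _ i => i
  | .exec _ i _ => i
  | .reply i _ _ _ => i
  | _ => none

theorem Act.sender_cases (h : Act S me now L L') {m : Msg f Client Op Res} (hx : m ∈ L'.sent) :
    m ∈ L.sent ∨ (m.sender = some me ∨ (∃ x, m = .propose x) ∨ ∃ x, m = .fwd x) := by
  cases h with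
  | execRegular a l _ _ | execUnblock a l _ _ _ =>
    obtain ⟨A, T, R, -, hR, he⟩ := foldl_execSlot me l L
    rw [he] at hx
    rcases hx with hx | hx
    · exact Or.inl hx
    · obtain ⟨c, t, u, rfl⟩ := hR m hx
      exact Or.inr (Or.inl rfl)
  | _ =>
    simp only [Local.send, Local.enterView, Local.setStep, Local.decide] at *
    first | exact Or.inl hx | grind [Msg.sender]

/-- The changes of step, value, certificate and view of a slot. -/
theorem Act.core_cases (h : Act S me now L L') (s : Slot f) :
    (L'.step s = L.step s ∧ L'.val s = L.val s ∧ L'.cert s = L.cert s ∧ L'.view s = L.view s) ∨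
    (L'.step s = .proposed ∧ L'.val s = L.val s ∧ L'.cert s = L.cert s ∧ L'.view s = L.view s ∧
      (∃ x, L'.hdr s = some x ∧ x.slot = s ∧ (me ∈ x.F → s = ⟨me, L.mine.length⟩ ∨ ∃ D, Msg.verify me x D ∈ L'.sent)) ∧ L'.pr s = true ∧
      (s = ⟨me, L.mine.length⟩ ∨ L.view s = 0 ∧ L.step s = .init)) ∨
    (L'.step s = .fpVerified ∧ L.view s = 0 ∧ L'.view s = 0 ∧ L.step s = .proposed ∧ ∃ x, x.slot = s ∧
      L.Collected x ∧ FpCond x (L.vec x) ∧ L'.val s = some (x, L.vec x) ∧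
      L'.cert s = .fpc x (L.vec x) ∧ Msg.depCommit s me (some (x, L.vec x)) ∈ L'.sent) ∨
    (L'.step s = .fpCommitted ∧ L.step s = .fpVerified ∧ L'.val s = L.val s ∧
      L'.cert s = L.cert s ∧ L'.view s = L.view s ∧ L'.dec s ≠ none) ∨
    (L'.step s = .rpVerified ∧ L.view s = 0 ∧ L'.view s = 0 ∧ L.step s = .proposed ∧ L'.cert s = L.cert s ∧
      ∃ x, x.slot = s ∧
      L.Collected x ∧ ¬ FpCond x (L.vec x) ∧ L'.val s = some (x, L.vec x) ∧
      Msg.prepare 0 s me (some (x, L.vec x)) ∈ L'.sent) ∨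
    (L'.step s = .rpPrepared ∧ L.step s = .rpVerified ∧ L'.val s = L.val s ∧ L'.view s = L.view s ∧
      Msg.commit (L.view s) s me (L.val s) ∈ L'.sent ∧ ∃ Q : Finset (Replica f), 2 * f + 1 ≤ Q.card ∧
        (∀ i ∈ Q, Msg.prepare (L.view s) s i (L.val s) ∈ L.rcv) ∧
        L'.cert s = .rpc (L.view s) (L.val s) Q) ∨
    (L'.step s = .rpCommitted ∧ L.step s = .rpPrepared ∧ L'.val s = L.val s ∧
      L'.cert s = L.cert s ∧ L'.view s = L.view s ∧ L'.dec s ≠ none) ∨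
    (L'.step s = .viewChange ∧ L.view s < L'.view s ∧ L'.val s = L.val s ∧ L'.cert s = L.cert s ∧
      Msg.viewChange (L'.view s) s me (L.cert s) ∈ L'.sent ∧ L'.comT s = none ∧ L'.vcT s = none ∧ L'.queryT s ≠ none) ∨
    (L'.step s = .rpVerified ∧ L.step s = .viewChange ∧ L'.view s = L.view s ∧
      L'.cert s = L.cert s ∧ L'.comT s = some (now + 3 * S.Δ) ∧
      Msg.prepare (L.view s) s me (L'.val s) ∈ L'.sent ∧
      ∃ vcs, Msg.newView (L.view s) s (coord s (L.view s)) (L'.val s) vcs ∈ L.rcv ∧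
        ValidVcs s (L.view s) vcs ∧ Selected vcs (L'.val s)) := by
  cases h with
  | execRegular a l _ _ | execUnblock a l _ _ _ =>
    obtain ⟨A, T, R, -, hR, he⟩ := foldl_execSlot me l L
    rw [he]
    exact Or.inl ⟨rfl, rfl, rfl, rfl⟩
  | propose r a s' x hnew hdue hs hh =>
    by_cases e : s = s'
    · subst e
      refine Or.inr (Or.inl ?_)
      simp only [Local.send, Function.update_self, true_and]
      exact ⟨⟨x, rfl, by rw [hh], fun _ => Or.inl hs⟩, Or.inl hs⟩
    · exact Or.inl (by simp [Local.send, e])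
  | acceptRequest x hhdr hrcv hview hstep =>
    by_cases e : s = x.slot
    · subst e
      refine Or.inr (Or.inl ?_)
      simp only [Local.send, Function.update_self, true_and]
      exact ⟨⟨x, hhdr, rfl, fun h => Or.inr ⟨_, Or.inr ⟨h, rfl⟩⟩⟩, Or.inr ⟨hview, hstep⟩⟩
    · exact Or.inl (by simp [Local.send, e])
  | fpVerify x hview hstep hcol hc =>
    by_cases e : s = x.slot
    · subst e
      refine Or.inr (Or.inr (Or.inl ?_))
      simp only [Local.send, Function.update_self, true_and]
      exact ⟨hview, hview, hstep, x, rfl, hcol, hc, rfl, rfl, by simp⟩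
    · exact Or.inl (by simp [Local.send, e])
  | fpCommit s' hstep hq =>
    by_cases e : s = s'
    · subst e
      refine Or.inr (Or.inr (Or.inr (Or.inl ?_)))
      simp [Local.decide, Local.setStep, hstep]
    · exact Or.inl (by simp [Local.decide, Local.setStep, e])
  | rpVerify x hview hstep hcol hc =>
    by_cases e : s = x.slot
    · subst e
      refine Or.inr (Or.inr (Or.inr (Or.inr (Or.inl ?_))))
      simp only [Local.send, Function.update_self, true_and]
      exact ⟨hview, hview, hstep, x, rfl, hcol, hc, rfl, by simp⟩
    · exact Or.inl (by simp [Local.send, e])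
  | rpPrepare s' Q hstep hQ hq =>
    by_cases e : s = s'
    · subst e
      refine Or.inr (Or.inr (Or.inr (Or.inr (Or.inr (Or.inl ?_)))))
      simp only [Local.send, Function.update_self, true_and]
      exact ⟨hstep, by simp, Q, hQ, hq, rfl⟩
    · exact Or.inl (by simp [Local.send, e])
  | rpCommit s' hstep hq =>
    by_cases e : s = s'
    · subst e
      refine Or.inr (Or.inr (Or.inr (Or.inr (Or.inr (Or.inr (Or.inl ?_))))))
      simp [Local.decide, Local.setStep, hstep]
    · exact Or.inl (by simp [Local.decide, Local.setStep, e])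
  | commitTimeout s' | joinView s' | viewTimeout s' =>
    by_cases e : s = s'
    · subst e
      refine Or.inr (Or.inr (Or.inr (Or.inr (Or.inr (Or.inr (Or.inr (Or.inl ?_)))))))
      simp [Local.enterView, Local.send, *]
    · exact Or.inl (by simp [Local.enterView, Local.send, e])
  | acceptNewView s' val vcs hstep hrcv hvcs hsel =>
    by_cases e : s = s'
    · subst e
      refine Or.inr (Or.inr (Or.inr (Or.inr (Or.inr (Or.inr (Or.inr (Or.inr ?_)))))))
      simp only [Local.send, Function.update_self, true_and]
      exact ⟨hstep, by simp, vcs, hrcv, hvcs, hsel⟩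
    · exact Or.inl (by simp [Local.send, e])
  | _ => exact Or.inl ⟨rfl, rfl, rfl, rfl⟩

end LocalInvariants
-- Timers, computed dependency sets and the header invariant
section LocalInvariants

variable {f : ℕ} {Client Op Res State : Type*} {S : System f Client Op Res State}
  {me : Replica f} {now : ℝ} {L L' : Local S}

/-- The alternative with the next own slot stands for `Act.propose`, which starts the timer without
looking at the view. That the view of an unused own slot is `0` is a fact about the whole run, see
`IsRun.view_fresh`. -/
theorem Act.comT_cases (h : Act S me now L L') {s : Slot f} {τ : ℝ} (hx : L'.comT s = some τ) :
    L'.view s = L.view s ∧ (L.comT s = some τ ∨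
      (τ = now + 9 * S.Δ ∧ (L.view s = 0 ∨ s = ⟨me, L.mine.length⟩) ∧ (L'.hdr s ≠ none ∨
        L.view s = 0 ∧ AtLeast (f + 1) fun i => ∃ h D, h.slot = s ∧ Msg.verify i h D ∈ L.rcv)) ∨
      (τ = now + 3 * S.Δ ∧ L.step s = .viewChange ∧ L'.step s ≠ .viewChange ∧
        ∃ val vcs, Msg.newView (L.view s) s (coord s (L.view s)) val vcs ∈ L.rcv ∧
          ValidVcs s (L.view s) vcs)) := by
  cases h with
  | execRegular a l _ _ | execUnblock a l _ _ _ =>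
    obtain ⟨A, T, R, -, hR, he⟩ := foldl_execSlot me l L
    rw [he] at hx ⊢
    exact ⟨rfl, Or.inl hx⟩
  | acceptPropose x =>
    simp only [Function.update_apply] at hx ⊢
    split at hx
    · next e =>
      subst e
      cases hT : L.comT x.slot <;> simp_all
    · exact ⟨trivial, Or.inl hx⟩
  | _ =>
    simp only [Local.send, Local.enterView, Local.setStep, Local.decide, Function.update_apply] at *
    first | exact ⟨rfl, Or.inl hx⟩ | grind

theorem Act.comT_of_hdr (h : Act S me now L L') {s : Slot f} (hx : L'.hdr s ≠ none) :
    L.hdr s ≠ none ∨ L'.comT s ≠ none := by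
  cases h with
  | execRegular a l _ _ | execUnblock a l _ _ _ =>
    obtain ⟨A, T, R, -, hR, he⟩ := foldl_execSlot me l L
    rw [he] at hx
    exact Or.inl hx
  | _ =>
    simp only [Local.send, Local.enterView, Local.setStep, Local.decide, Function.update_apply] at *
    first | exact Or.inl hx | grind

theorem Act.vcT_cases (h : Act S me now L L') {s : Slot f} {τ : ℝ} (hx : L'.vcT s = some τ) :
    L'.view s = L.view s ∧ (L.vcT s = some τ ∨
      τ = now + 3 * S.Δ ∧ L.ViewsReached (2 * f + 1) s (L.view s)) := by
  cases h with
  | execRegular a l _ _ | execUnblock a l _ _ _ =>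
    obtain ⟨A, T, R, -, hR, he⟩ := foldl_execSlot me l L
    rw [he] at hx ⊢
    exact ⟨rfl, Or.inl hx⟩
  | _ =>
    simp only [Local.send, Local.enterView, Local.setStep, Local.decide, Function.update_apply] at *
    first | exact ⟨rfl, Or.inl hx⟩ | grind

/-- Timers persist as long as the view does. -/
theorem Act.timers (h : Act S me now L L') {s : Slot f} (hv : L'.view s = L.view s) :
    (∀ τ, L.vcT s = some τ → L'.vcT s = some τ) ∧ (∀ τ, L.queryT s = some τ → L'.queryT s = some τ) ∧
    (L'.step s = .viewChange → L.step s = .viewChange) ∧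
    (s ≠ ⟨me, L.mine.length⟩ → L.step s ≠ .viewChange → ∀ τ, L.comT s = some τ → L'.comT s = some τ) := by
  have hs : L'.step s = .viewChange → L.step s = .viewChange := fun e => by
    rcases h.core_cases s with h | h | h | h | h | h | h | h | h <;> simp_all
  refine ⟨?_, ?_, hs, ?_⟩ <;> clear hs <;> cases h with
  | execRegular a l _ _ | execUnblock a l _ _ _ =>
    obtain ⟨A, T, R, -, hR, he⟩ := foldl_execSlot me l L
    rw [he]
    simp
  | acceptPropose x =>
    simp only [Function.update_apply] at *
    first
      | exact fun _ => id
      | intro _ _ τ hτ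
        split
        · next e => simp [← e, hτ]
        · exact hτ
  | _ =>
    simp only [Local.send, Local.enterView, Local.setStep, Local.decide, Function.update_apply] at *
    grind

/-- A replica knows the request of every slot that it proposed or verified. -/
theorem Act.step_init_cases (h : Act S me now L L') {s : Slot f} (hx : L'.step s = .init) :
    L.step s = .init := by
  rcases h.core_cases s with h | h | h | h | h | h | h | h | h <;> simp_all

theorem Act.hdr_bound (h : Act S me now L L') (i : ∃ n, ∀ s, L.hdr s ≠ none → s.sc < n) :
    ∃ n, ∀ s, L'.hdr s ≠ none → s.sc < n := by
  obtain ⟨n, hn⟩ := i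
  cases h with
  | execRegular a l _ _ | execUnblock a l _ _ _ =>
    obtain ⟨A, T, R, -, hR, he⟩ := foldl_execSlot me l L
    rw [he]
    exact ⟨n, hn⟩
  | propose r a s' =>
    refine ⟨max n (s'.sc + 1), fun s hs => ?_⟩
    simp only [Local.send, Function.update_apply] at hs
    grind
  | acceptPropose x =>
    refine ⟨max n (x.slot.sc + 1), fun s hs => ?_⟩
    simp only [Function.update_apply] at hs
    grind
  | _ => exact ⟨n, hn⟩

/-- The bound on the known counters makes the infimum in `Local.conflicts` one over a nonempty set,
so it is attained. Without it the value would be the default `sInf ∅ = 0`, which covers nothing. -/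
theorem conflicts_covers (hb : ∃ n, ∀ s, L.hdr s ≠ none → s.sc < n) {s : Slot f}
    {x : Header f Client Op} (hs : L.hdr s = some x) (hp : L.pr s = true) {r : Req Client Op}
    (hr : S.app.Conflict x.req r) : Covers (L.conflicts r) s := by
  obtain ⟨n, hn⟩ := hb
  have hmem := Nat.sInf_mem (s := {n | ∀ s' h, s'.co = s.co → L.hdr s' = some h → L.pr s' = true →
    S.app.Conflict h.req r → s'.sc < n}) ⟨n, fun s' h _ h2 _ _ => hn s' (by simp [h2])⟩
  exact hmem s x rfl hs hp hr

/-- The explicit members of a computed dependency set are slots with a known header. -/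
theorem waitOK_conflicts (r : Req Client Op) : L.WaitOK (L.conflicts r) := by
  intro c n hn
  by_contra hA
  have h : L.hdr ⟨c, n⟩ = none := by
    by_contra hh
    exact hA (Or.inl hh)
  -- As slot `⟨c, n⟩` has no header, the bound `n + 1` could be lowered to `n`, against its
  -- minimality.
  have hmem : n ∈ {n | ∀ s h, s.co = c → L.hdr s = some h → L.pr s = true →
      S.app.Conflict h.req r → s.sc < n} := by
    -- The set is nonempty because its infimum is `n + 1` and not the default `0`.
    have h1 := Nat.sInf_mem (s := {n | ∀ s h, s.co = c → L.hdr s = some h → L.pr s = true →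
      S.app.Conflict h.req r → s.sc < n}) (by
        by_contra he
        rw [Set.not_nonempty_iff_eq_empty] at he
        unfold Local.conflicts at hn
        rw [he] at hn
        simp at hn)
    change L.conflicts r c ∈ _ at h1
    rw [hn] at h1
    intro s x h2 h3 h4 h5
    have h6 := h1 s x h2 h3 h4 h5
    rcases Nat.lt_succ_iff_lt_or_eq.1 h6 with h7 | h7
    · exact h7
    · obtain ⟨co, sc⟩ := s
      simp only at h2 h7
      subst h2 h7
      rw [h] at h3
      cases h3
  have := Nat.sInf_le hmem
  change L.conflicts r c ≤ n at this
  omega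

/-- Where headers, proposals and propose timers come from. -/
structure Local.HeaderInv (me : Replica f) (L : Local S) : Prop where
  sent_rcv : L.sent ⊆ L.rcv
  finite_sent : L.sent.Finite ∧ {x | L.propT x ≠ none}.Finite
  fresh : L.FreshOwn me
  hdr_slot : ∀ s x, L.hdr s = some x → x.slot = s ∧ ValidQuorum x ∧ L.WaitOK x.D
  hdr_own : ∀ s x, L.hdr s = some x → s.co = me → Msg.propose x ∈ L.sent
  hdr_other : ∀ s x, L.hdr s = some x → s.co ≠ me → L.propT x ≠ none
  hdr_gap : ∀ c n, L.hdr ⟨c, n + 1⟩ ≠ none → L.Accepts ⟨c, n⟩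
  hdr_bound : ∃ n, ∀ s, L.hdr s ≠ none → s.sc < n
  pr_hdr : ∀ s, L.pr s = true → ∃ x, L.hdr s = some x ∧ Msg.propose x ∈ L.rcv
  sent_propose : ∀ x, Msg.propose x ∈ L.sent → x.slot.co = me ∧ L.hdr x.slot = some x ∧
    L.pr x.slot = true ∧ ∃ a, L.mine[x.slot.sc]? = some (x.req, a) ∧ x.F = S.quorum me a
  mine_hdr : ∀ n, n < L.mine.length → L.hdr ⟨me, n⟩ ≠ none
  propT_rcv : ∀ x, L.propT x ≠ none → x.slot.co ≠ me ∧ (Msg.propose x ∈ L.rcv ∨ Msg.fwd x ∈ L.rcv)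
  sent_fwd : ∀ x, Msg.fwd x ∈ L.sent → L.propT x ≠ none
  propT_leave : ∀ x, L.propT x ≠ none → L.view x.slot ≠ 0 → Msg.fwd x ∈ L.sent ∨ L.Collected x
  sender : ∀ m ∈ L.sent, m.sender = some me ∨ (∃ x, m = .propose x) ∨ ∃ x, m = .fwd x

/-- The clause to watch is `propT_leave`: `Local.enterView` forwards exactly the DepProposes of the
slot that have a propose timer and are not yet collected, so none is left unannounced when the
initial view ends. This is what spreads a DepPropose of a faulty coordinator in
`IsRun.before_started`. -/
theorem Local.HeaderInv.act (I : L.HeaderInv me) (h : Act S me now L L') : L'.HeaderInv me := by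
  have hle := h.le I.fresh
  have hw : ∀ s x, L'.hdr s = some x → x.slot = s ∧ ValidQuorum x ∧ L'.WaitOK x.D := by
    intro s x hx
    rcases h.hdr_cases hx with h1 | ⟨h1, h2, ⟨r, a, h3, -, h5, -⟩ | h3⟩
    · exact ⟨(I.hdr_slot s x h1).1, (I.hdr_slot s x h1).2.1, hle.waitOK (I.hdr_slot s x h1).2.2⟩
    · refine ⟨h2, ?_, ?_⟩
      · subst h5 h3
        exact (S.mem_quorums me _).1 (S.quorum_mem me a)
      · subst h5
        exact hle.waitOK (waitOK_conflicts r)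
    · exact ⟨h2, h3.2.2.2.2.2.1, hle.waitOK h3.2.2.2.2.2.2.1⟩
  refine ⟨h.sent_rcv I.sent_rcv, h.finite_sent I.finite_sent, h.fresh I.fresh, hw, ?_, ?_, ?_, ?_, ?_, ?_, ?_, ?_, ?_, ?_, ?_⟩
  · intro s x hx hs
    rcases h.hdr_cases hx with h1 | ⟨h1, h2, ⟨r, a, h3, -, h5, -, h6⟩ | h3⟩
    · exact hle.sent (I.hdr_own s x h1 hs)
    · exact h6
    · exact absurd hs h3.1
  · intro s x hx hs
    rcases h.hdr_cases hx with h1 | ⟨h1, h2, ⟨r, a, h3, -⟩ | h3⟩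
    · obtain ⟨τ, hτ⟩ := Option.ne_none_iff_exists'.1 (I.hdr_other s x h1 hs)
      simp [hle.propT _ _ hτ]
    · exact absurd (by rw [h3]) hs
    · obtain ⟨τ, hτ⟩ := Option.ne_none_iff_exists'.1 h3.2.2.1
      simp [hle.propT _ _ hτ]
  · intro c n hx
    obtain ⟨x, hx⟩ := Option.ne_none_iff_exists'.1 hx
    rcases h.hdr_cases hx with h1 | ⟨h1, h2, ⟨r, a, h3, -⟩ | h3⟩
    · exact hle.accepts (I.hdr_gap c n (by simp [h1]))
    · obtain ⟨rfl, h3⟩ := Slot.mk.injEq .. ▸ h3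
      exact hle.accepts (Or.inl (I.mine_hdr n (by omega)))
    · exact hle.accepts (h3.2.2.2.2.2.2.2 n rfl)
  · exact h.hdr_bound I.hdr_bound
  · intro s hs
    rcases h.pr_cases hs with h1 | ⟨x, h1, h2, -⟩
    · obtain ⟨x, h2, h3⟩ := I.pr_hdr s h1
      exact ⟨x, hle.hdr _ _ h2, hle.rcv h3⟩
    · exact ⟨x, h1, h2.elim (fun h => hle.rcv h) fun h3 => h.sent_rcv I.sent_rcv h3⟩
  · intro x hx
    rcases h.propose_cases hx with h1 | ⟨r, a, h1, h2, h3, h4⟩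
    · obtain ⟨h2, h3, h4, a, h5, h6⟩ := I.sent_propose x h1
      refine ⟨h2, hle.hdr _ _ h3, hle.pr _ h4, a, ?_, h6⟩
      obtain ⟨t, ht⟩ := hle.mine
      rw [← ht, List.getElem?_append_left, h5]
      exact (List.getElem?_eq_some_iff.1 h5).1
    · refine ⟨by rw [h1], h3, h4, a, ?_, by rw [h1]⟩
      rw [h2, h1]
      simp
  · intro n hn
    rcases h.mine_cases with h1 | ⟨r, a, -, h1, -, h2⟩
    · obtain ⟨x, hx⟩ := Option.ne_none_iff_exists'.1 (I.mine_hdr n (by rwa [h1] at hn))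
      simp [hle.hdr _ _ hx]
    · rw [h1, List.length_append, List.length_singleton] at hn
      rcases Nat.lt_succ_iff_lt_or_eq.1 hn with h3 | rfl
      · obtain ⟨x, hx⟩ := Option.ne_none_iff_exists'.1 (I.mine_hdr n h3)
        simp [hle.hdr _ _ hx]
      · simp [h2]
  · intro x hx
    rcases h.propT_cases hx with h1 | ⟨-, -, h1, -, h2⟩
    · exact ⟨(I.propT_rcv x h1).1, (I.propT_rcv x h1).2.imp (fun h => hle.rcv h) fun h => hle.rcv h⟩
    · exact ⟨fun e => h1 e.symm, h2.imp (fun h => hle.rcv h) fun h => hle.rcv h⟩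
  · intro x hx
    have h1 : L.propT x ≠ none := (h.fwd_cases hx).elim (I.sent_fwd x) id
    obtain ⟨τ, hτ⟩ := Option.ne_none_iff_exists'.1 h1
    simp [hle.propT _ _ hτ]
  · intro x hx hv
    rcases h.propT_cases hx with h1 | ⟨-, h2, -, h1, -⟩
    · rcases h.view_cases x.slot with h2 | ⟨h2, h3, -⟩
      · exact (I.propT_leave x h1 (h2 ▸ hv)).imp (fun h => hle.sent h) fun h => (hle.collected h).1
      · by_cases hc : L.Collected x
        · exact Or.inr (hle.collected hc).1
        · left
          rw [h3]
          exact Or.inr (Or.inr ⟨x, rfl, rfl, h1, hc⟩)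
    · exact absurd (by rw [h1, h2]) hv
  · intro m hm
    exact (h.sender_cases hm).elim (I.sender m) id

end LocalInvariants
-- Runs: monotonicity and genuine messages
section Runs

variable {f : ℕ} {Client Op Res State : Type*} {S : System f Client Op Res State}

theorem Local.le_insert_rcv (L : Local S) (m : Msg f Client Op Res) :
    L.Le { L with rcv := insert m L.rcv } :=
  { Local.Le.refl L with rcv := Set.subset_insert _ _ }

theorem Local.HeaderInv.insert_rcv {me : Replica f} {L : Local S} (I : L.HeaderInv me)
    (m : Msg f Client Op Res) : Local.HeaderInv (S := S) me { L with rcv := insert m L.rcv } := by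
  have hle := L.le_insert_rcv m
  obtain ⟨i1, i2, i3, i4, i5, i6, i7, i8, i9, i10, i11, i12, i13, i14, i15⟩ := I
  refine ⟨fun x hx => hle.rcv (i1 hx), i2, i3, ?_, i5, i6, ?_, i8, ?_, i10, i11, ?_, i13, ?_, i15⟩
  · exact fun s x hx => ⟨(i4 s x hx).1, (i4 s x hx).2.1, hle.waitOK (i4 s x hx).2.2⟩
  · exact fun c n hn => hle.accepts (i7 c n hn)
  · intro s hs
    obtain ⟨x, h1, h2⟩ := i9 s hs
    exact ⟨x, h1, hle.rcv h2⟩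
  · exact fun x hx => ⟨(i12 x hx).1, (i12 x hx).2.imp (fun h => hle.rcv h) fun h => hle.rcv h⟩
  · exact fun x hx hv => (i14 x hx hv).imp id fun h => (hle.collected h).1

theorem Local.HeaderInv.start (me : Replica f) : (Local.start S).HeaderInv me := by
  constructor <;> simp [Local.start, Local.FreshOwn]

theorem Act.rcv_cases {me : Replica f} {now : ℝ} {L L' : Local S} (h : Act S me now L L')
    {m : Msg f Client Op Res} (hm : m ∈ L'.rcv) : m ∈ L.rcv ∨ m ∈ L'.sent := by
  cases h with
  | execRegular a l _ _ | execUnblock a l _ _ _ =>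
    obtain ⟨A, T, R, -, hR, he⟩ := foldl_execSlot me l L
    rw [he] at hm ⊢
    exact hm.imp id Or.inr
  | _ =>
    simp only [Local.send, Local.enterView, Local.setStep, Local.decide] at *
    first | exact Or.inl hm | exact hm.imp id Or.inr

/-- Growth of the global state, as far as correct parties are concerned. -/
structure Global.Le (G G' : Global S) : Prop where
  loc : ∀ i, (G.loc i).Le (G'.loc i)
  issued : ∀ c ∈ S.goodClient, ∀ r ∈ (G.cl c).issued, r ∈ (G'.cl c).issued
  replies : ∀ c ∈ S.goodClient, (G.cl c).replies ⊆ (G'.cl c).replies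
  sends : ∀ c ∈ S.goodClient, (G.cl c).sends ⊆ (G'.cl c).sends
  now : G.now ≤ G'.now

theorem Global.Le.refl (G : Global S) : G.Le G :=
  ⟨fun _ => Local.Le.refl _, fun _ _ _ => id, fun _ _ => subset_rfl, fun _ _ => subset_rfl, le_rfl⟩

theorem Global.Le.trans {G₁ G₂ G₃ : Global S} (a : G₁.Le G₂) (b : G₂.Le G₃) : G₁.Le G₃ :=
  ⟨fun i => (a.loc i).trans (b.loc i), fun c hc r hr => b.issued c hc r (a.issued c hc r hr),
    fun c hc => (a.replies c hc).trans (b.replies c hc),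
    fun c hc => (a.sends c hc).trans (b.sends c hc), a.now.trans b.now⟩

section Mono

variable {G G' : Global S} (hle : G.Le G')
include hle

theorem Global.Le.signed {i : Replica f} {m : Msg f Client Op Res} (h : G.Signed i m) :
    G'.Signed i m :=
  h.imp id fun h => (hle.loc i).sent h

theorem Global.Le.signedReq {r : Req Client Op} (h : G.SignedReq r) : G'.SignedReq r := by
  by_cases hi : r.client ∈ S.goodClient
  · exact h.imp id fun h => hle.issued _ hi _ h
  · exact Or.inl hi

theorem Global.Le.genuineVal {val : Val f Client Op} (h : G.GenuineVal val) :
    G'.GenuineVal val := by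
  match val, h with
  | none, _ => trivial
  | some (x, g), h => exact ⟨hle.signed h.1, hle.signedReq h.2.1, fun i hi => hle.signed (h.2.2 i hi)⟩

theorem Global.Le.genuineCert {s : Slot f} {c : Cert f Client Op} (h : G.GenuineCert s c) :
    G'.GenuineCert s c := by
  match c, h with
  | .empty, _ => trivial
  | .fpc x g, h => exact hle.genuineVal (val := some (x, g)) h
  | .rpc v val P, h => exact ⟨hle.genuineVal h.1, fun i hi => hle.signed (h.2 i hi)⟩

theorem Global.Le.genuineVC {w : ℕ} {s : Slot f} {i : Replica f} {c : Cert f Client Op}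
    (h : G.GenuineVC w s i c) : G'.GenuineVC w s i c :=
  h.imp (fun h => ⟨h.1, hle.genuineCert h.2⟩) fun h => (hle.loc i).sent h

theorem Global.Le.genuine {m : Msg f Client Op Res} (h : G.Genuine m) : G'.Genuine m := by
  cases m with
  | request r => exact hle.signedReq h
  | propose x => exact ⟨hle.signed h.1, hle.signedReq h.2⟩
  | newView w s i val vcs =>
    exact h.imp (fun h => ⟨h.1, fun j c hc => hle.genuineVC (h.2 j c hc)⟩)
      fun h => (hle.loc i).sent h
  | viewChange w s i c => exact hle.genuineVC h
  | _ => exact hle.signed h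

end Mono

variable {G : ℕ → Global S}

/-- The steps of a replica in a run. -/
theorem IsRun.loc_step (hrun : IsRun G) (n : ℕ) (i : Replica f) :
    (G (n + 1)).loc i = (G n).loc i ∨
    (i ∉ S.byz ∧ (G (n + 1)).now = (G n).now ∧
      Act S i (G n).now ((G n).loc i) ((G (n + 1)).loc i)) ∨
    (i ∉ S.byz ∧ (G (n + 1)).now = (G n).now ∧ ∃ m, (G n).Genuine m ∧
      (G (n + 1)).loc i = { (G n).loc i with rcv := insert m ((G n).loc i).rcv }) := by
  have h := hrun.next n
  generalize G (n + 1) = G' at h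
  cases h with
  | act j L hj h =>
    by_cases e : i = j
    · subst e
      exact Or.inr (Or.inl ⟨hj, rfl, by simpa using h⟩)
    · exact Or.inl (Function.update_of_ne e _ _)
  | deliver j m hj h =>
    by_cases e : i = j
    · subst e
      exact Or.inr (Or.inr ⟨hj, rfl, m, h, by simp⟩)
    · exact Or.inl (Function.update_of_ne e _ _)
  | _ => exact Or.inl rfl

theorem IsRun.headerInv (hrun : IsRun G) (n : ℕ) (i : Replica f) :
    ((G n).loc i).HeaderInv i := by
  induction n with
  | zero =>
    rw [hrun.start]
    exact Local.HeaderInv.start i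
  | succ n ih =>
    rcases hrun.loc_step n i with h | ⟨-, -, h⟩ | ⟨-, -, m, -, h⟩
    · rwa [h]
    · exact ih.act h
    · rw [h]
      exact ih.insert_rcv m

theorem IsRun.le_succ (hrun : IsRun G) (n : ℕ) : (G n).Le (G (n + 1)) := by
  have hl : ∀ i, ((G n).loc i).Le ((G (n + 1)).loc i) := fun i => by
    rcases hrun.loc_step n i with h | ⟨-, -, h⟩ | ⟨-, -, m, -, h⟩
    · rw [h]
      exact Local.Le.refl _
    · exact h.le (hrun.headerInv n i).fresh
    · rw [h]
      exact Local.le_insert_rcv _ m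
  have h := hrun.next n
  generalize G (n + 1) = G' at h hl
  cases h <;> refine ⟨hl, ?_, ?_, ?_, ?_⟩ <;>
    first
    | exact fun _ _ _ => id
    | exact fun _ _ => subset_rfl
    | exact le_rfl
    | exact le_of_lt ‹_›
    | (intro c hc; simp only [Function.update_apply]; grind)

theorem IsRun.le (hrun : IsRun G) {n m : ℕ} (h : n ≤ m) : (G n).Le (G m) := by
  induction m, h using Nat.le_induction with
  | base => exact Global.Le.refl _
  | succ m _ ih => exact ih.trans (hrun.le_succ m)

/-- A fact that holds at some point of a run but not initially has come into being in some step. -/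
theorem exists_step {p : ℕ → Prop} {n : ℕ} (h0 : ¬ p 0) (hn : p n) :
    ∃ m, m < n ∧ ¬ p m ∧ p (m + 1) := by
  induction n with
  | zero => exact absurd hn h0
  | succ n ih =>
    by_cases h : p n
    · obtain ⟨m, h1, h2⟩ := ih h
      exact ⟨m, by omega, h2⟩
    · exact ⟨n, by omega, h, hn⟩

theorem genuine_of_sender {G : Global S} {i : Replica f} {m : Msg f Client Op Res}
    (hs : m.sender = some i) (hm : m ∈ (G.loc i).sent) : G.Genuine m := by
  cases m <;> simp only [Msg.sender, Option.some.injEq, reduceCtorEq] at hs <;> subst hs <;>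
    exact Or.inr hm

/-- Replicas know genuine messages only. -/
theorem IsRun.genuine (hrun : IsRun G) (n : ℕ) (i : Replica f) :
    (∀ m ∈ ((G n).loc i).rcv, (G n).Genuine m) ∧
      ∀ x ∈ ((G n).loc i).mine, (G n).SignedReq x.1 := by
  induction n with
  | zero =>
    rw [hrun.start]
    simp [Global.start, Local.start]
  | succ n ih =>
    have hle := hrun.le_succ n
    rcases hrun.loc_step n i with h | ⟨hi, -, h⟩ | ⟨-, -, m, hm, h⟩
    · rw [h]
      exact ⟨fun m hm => hle.genuine (ih.1 m hm), fun x hx => hle.signedReq (ih.2 x hx)⟩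
    · have I := hrun.headerInv n i
      have I' := hrun.headerInv (n + 1) i
      -- The list of own proposals takes part in the induction because a repeated proposal draws its
      -- request from there and not from a received message.
      have hmine : ∀ x ∈ ((G (n + 1)).loc i).mine, (G (n + 1)).SignedReq x.1 := by
        intro x hx
        rcases h.mine_cases with h1 | ⟨r, a, -, h1, h2, -⟩
        · exact hle.signedReq (ih.2 x (h1 ▸ hx))
        · rw [h1] at hx
          rcases List.mem_append.1 hx with hx | hx
          · exact hle.signedReq (ih.2 x hx)
          · obtain rfl := List.mem_singleton.1 hx
            rcases h2 with h2 | ⟨b, k, -, h2, -⟩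
            · exact hle.signedReq (ih.1 _ h2.2)
            · exact hle.signedReq (ih.2 (r, b) (List.mem_of_getElem? h2))
      refine ⟨fun m hm => ?_, hmine⟩
      rcases h.rcv_cases hm with h1 | h1
      · exact hle.genuine (ih.1 m h1)
      · rcases I'.sender m h1 with h2 | ⟨x, rfl⟩ | ⟨x, rfl⟩
        · exact genuine_of_sender h2 h1
        · obtain ⟨h2, -, -, a, h3, -⟩ := I'.sent_propose x h1
          exact ⟨Or.inr (by rw [h2]; exact h1), hmine _ (List.mem_of_getElem? h3)⟩
        · have h2 : ((G n).loc i).propT x ≠ none := (h.fwd_cases h1).elim (I.sent_fwd x) id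
          rcases (I.propT_rcv x h2).2 with h3 | h3
          · exact hle.signed (ih.1 _ h3).1
          · exact hle.signed (ih.1 _ h3)
    · rw [h]
      refine ⟨fun x hx => ?_, fun x hx => hle.signedReq (ih.2 x hx)⟩
      rcases hx with rfl | hx
      · exact hle.genuine hm
      · exact hle.genuine (ih.1 x hx)

theorem Global.Signed.sent {G : Global S} {i : Replica f} {m : Msg f Client Op Res}
    (h : G.Signed i m) (hi : i ∉ S.byz) : m ∈ (G.loc i).sent :=
  h.resolve_left hi

theorem IsRun.signedHeader (hrun : IsRun G) {n : ℕ} {i : Replica f} {s : Slot f}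
    {x : Header f Client Op} (h : ((G n).loc i).hdr s = some x) :
    (G n).SignedHeader x := by
  have I := hrun.headerInv n i
  by_cases e : s.co = i
  · have := I.hdr_own s x h e
    refine Or.inr ?_
    rwa [(I.hdr_slot s x h).1, e]
  · rcases (I.propT_rcv x (I.hdr_other s x h e)).2 with h1 | h1
    · exact ((hrun.genuine n i).1 _ h1).1
    · exact (hrun.genuine n i).1 _ h1

end Runs
-- Reported dependencies: the verification invariant
section LocalInvariants

variable {f : ℕ} {Client Op Res State : Type*} {S : System f Client Op Res State}
  {me : Replica f} {now : ℝ} {L L' : Local S}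

theorem Act.verify_of_pr (h : Act S me now L L') {s : Slot f} (hx : L'.pr s = true)
    (hs : s.co ≠ me) : L.pr s = true ∨
    ∃ x, L'.hdr s = some x ∧ (me ∈ x.F → ∃ D, Msg.verify me x D ∈ L'.sent) := by
  cases h with
  | execRegular a l _ _ | execUnblock a l _ _ _ =>
    obtain ⟨A, T, R, -, hR, he⟩ := foldl_execSlot me l L
    rw [he] at hx
    exact Or.inl hx
  | acceptRequest x hhdr =>
    by_cases e : s = x.slot
    · subst e
      exact Or.inr ⟨x, hhdr, fun hm => ⟨_, Or.inr ⟨hm, rfl⟩⟩⟩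
    · left
      simpa [Local.send, e] using hx
  | _ =>
    simp only [Local.send, Local.enterView, Local.setStep, Local.decide, Function.update_apply] at *
    first | exact Or.inl hx | grind

/-- The dependencies a replica has reported for a proposal, as its coordinator or as a follower. -/
def Local.Reports (me : Replica f) (L : Local S) (x : Header f Client Op) (D : Deps f) : Prop :=
  Msg.propose x ∈ L.sent ∧ D = x.D ∨ Msg.verify me x D ∈ L.sent

/-- The clause `reports` is the local source of the execution order: of two conflicting proposals
that a replica reported on, one was known when the dependencies of the other were computed. The
uniqueness clauses say that a correct replica does not equivocate in DepVerifys and NewViews. -/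
structure Local.VerifyInv (me : Replica f) (L : Local S) : Prop where
  sent_verify : ∀ i x D, Msg.verify i x D ∈ L.sent → i = me ∧ me ∈ x.F ∧ L.hdr x.slot = some x ∧
    L.pr x.slot = true ∧ L.step x.slot ≠ .init ∧ L.WaitOK D
  verify_unique : ∀ x D D', Msg.verify me x D ∈ L.sent → Msg.verify me x D' ∈ L.sent → D = D'
  verify_of_pr : ∀ s x, L.hdr s = some x → L.pr s = true → me ∈ x.F →
    ∃ D, Msg.verify me x D ∈ L.sent
  reports : ∀ x D x' D', L.Reports me x D → L.Reports me x' D' → x.slot ≠ x'.slot →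
    S.app.Conflict x.req x'.req → Covers D x'.slot ∨ Covers D' x.slot
  v_some : ∀ s i D, L.v s i = some D → ∃ x, L.hdr s = some x ∧ i ∈ x.F ∧
    Msg.verify i x D ∈ L.rcv ∧ L.WaitOK D
  sent_viewChange : ∀ w s i c, Msg.viewChange w s i c ∈ L.sent → i = me ∧ w ≠ 0 ∧ w ≤ L.view s
  sent_exec : ∀ s i d, Msg.exec s i d ∈ L.sent → L.dec s = some d
  sent_newView : ∀ w s i val vcs, Msg.newView w s i val vcs ∈ L.sent →
    (∀ j c, vcs j = some c → Msg.viewChange w s j c ∈ L.rcv) ∧ ValidVcs s w vcs ∧ Selected vcs val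
  newView_unique : ∀ w s val vcs val' vcs', Msg.newView w s me val vcs ∈ L.sent →
    Msg.newView w s me val' vcs' ∈ L.sent → val = val' ∧ vcs = vcs'
  viewChange_view : ∀ s, L.step s = .viewChange → L.view s ≠ 0

theorem Act.reports_cases (h : Act S me now L L') {x : Header f Client Op} {D : Deps f}
    (hx : L'.Reports me x D) : L.Reports me x D ∨ D = L.conflicts x.req := by
  rcases hx with ⟨hx, rfl⟩ | hx
  · rcases h.propose_cases hx with h1 | ⟨r, a, h1, -⟩
    · exact Or.inl (Or.inl ⟨h1, rfl⟩)
    · exact Or.inr (by subst h1; rfl)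
  · rcases h.verify_cases hx with h1 | h1
    · exact Or.inl (Or.inr h1)
    · exact Or.inr h1.2.2.1

/-- A single action reports on a single header. Reports for two different slots therefore have an
order in time. -/
theorem Act.reports_new (h : Act S me now L L') {x x' : Header f Client Op} {D D' : Deps f}
    (hx : L'.Reports me x D) (hn : ¬ L.Reports me x D) (hx' : L'.Reports me x' D')
    (hn' : ¬ L.Reports me x' D') : x.slot = x'.slot := by
  unfold Local.Reports at *
  cases h with
  | execRegular a l _ _ | execUnblock a l _ _ _ =>
    obtain ⟨A, T, R, -, hR, he⟩ := foldl_execSlot me l L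
    rw [he] at hx
    grind
  | _ =>
    simp only [Local.send, Local.enterView, Local.setStep, Local.decide, Function.update_apply] at *
    first | exact absurd hx hn | grind

theorem Local.Reports.known (I : L.HeaderInv me) (V : L.VerifyInv me) {x : Header f Client Op}
    {D : Deps f} (h : L.Reports me x D) : L.hdr x.slot = some x ∧ L.pr x.slot = true := by
  rcases h with ⟨h, -⟩ | h
  · obtain ⟨-, h1, h2, -⟩ := I.sent_propose x h
    exact ⟨h1, h2⟩
  · obtain ⟨-, -, h1, h2, -⟩ := V.sent_verify _ x D h
    exact ⟨h1, h2⟩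

theorem Local.VerifyInv.act (I : L.HeaderInv me) (I' : L'.HeaderInv me) (V : L.VerifyInv me)
    (h : Act S me now L L') : L'.VerifyInv me := by
  have hle := h.le I.fresh
  have hsend : ∀ i x D, Msg.verify i x D ∈ L'.sent → i = me := fun i x D hm => by
    rcases I'.sender _ hm with h | ⟨_, h⟩ | ⟨_, h⟩ <;> simp_all [Msg.sender]
  constructor
  · intro i x D hx
    rcases h.verify_cases hx with h1 | ⟨rfl, h1, h2, h3, h4, h5, h6, h7⟩
    · obtain ⟨h2, h3, h4, h5, h6, h7⟩ := V.sent_verify i x D h1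
      exact ⟨h2, h3, hle.hdr _ _ h4, hle.pr _ h5, fun e => h6 (h.step_init_cases e), hle.waitOK h7⟩
    · refine ⟨rfl, h1, hle.hdr _ _ h3, h6, by simp [h7], h2 ▸ hle.waitOK (waitOK_conflicts _)⟩
  · intro x D D' hx hx'
    -- A DepVerify is sent when step `init` is left, and this step is never entered again; so an old
    -- and a new one for the same header cannot coexist.
    rcases h.verify_cases hx with h1 | h1 <;> rcases h.verify_cases hx' with h2 | h2
    · exact V.verify_unique x D D' h1 h2
    · exact absurd h2.2.2.2.2.2.1 (V.sent_verify _ _ _ h1).2.2.2.2.1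
    · exact absurd h1.2.2.2.2.2.1 (V.sent_verify _ _ _ h2).2.2.2.2.1
    · rw [h1.2.2.1, h2.2.2.1]
  · intro s x hx hp hm
    have hs : s.co ≠ me := fun e => by
      have := I'.hdr_slot s x hx
      exact this.2.1.2 (by rw [this.1, e]; exact hm)
    rcases h.verify_of_pr hp hs with h1 | ⟨y, h1, h2⟩
    · obtain ⟨y, h2, -⟩ := I.pr_hdr s h1
      have h3 := hle.hdr _ _ h2
      rw [hx] at h3
      cases h3
      obtain ⟨D, hD⟩ := V.verify_of_pr s x h2 h1 hm
      exact ⟨D, hle.sent hD⟩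
    · rw [hx] at h1
      cases h1
      exact h2 hm
  · intro x D x' D' hx hx' hne hc
    -- An old report means that its header and request are stored, so the set that is computed now
    -- for the other header covers its slot. Two new reports would concern the same slot.
    by_cases h1 : L.Reports me x D <;> by_cases h2 : L.Reports me x' D'
    · exact V.reports x D x' D' h1 h2 hne hc
    · right
      rw [(h.reports_cases hx').resolve_left h2]
      have := h1.known I V
      exact conflicts_covers I.hdr_bound this.1 this.2 hc
    · left
      rw [(h.reports_cases hx).resolve_left h1]
      have := h2.known I V
      exact conflicts_covers I.hdr_bound this.1 this.2 (S.app.conflict_symm _ _ hc)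
    · exact absurd (h.reports_new hx h1 hx' h2) hne
  · intro s i D hx
    rcases h.v_cases hx with h1 | ⟨x, h1, -, h2, h3, h4⟩
    · obtain ⟨x, h2, h3, h4, h5⟩ := V.v_some s i D h1
      exact ⟨x, hle.hdr _ _ h2, h3, hle.rcv h4, hle.waitOK h5⟩
    · exact ⟨x, hle.hdr _ _ h1, h2, hle.rcv h3, hle.waitOK h4⟩
  · intro w s i c hx
    rcases h.viewChange_cases hx with h1 | ⟨h1, h2, h3, -⟩
    · have := V.sent_viewChange w s i c h1
      exact ⟨this.1, this.2.1, this.2.2.trans (hle.view s)⟩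
    · exact ⟨h1, by omega, h2.le⟩
  · intro s i d hx
    rcases h.exec_cases hx with h1 | h1
    · exact hle.dec _ _ (V.sent_exec s i d h1)
    · exact hle.dec _ _ h1.2
  · intro w s i val vcs hx
    rcases h.newView_cases hx with h1 | h1
    · have := V.sent_newView w s i val vcs h1
      exact ⟨fun j c hc => hle.rcv (this.1 j c hc), this.2⟩
    · exact ⟨fun j c hc => hle.rcv (h1.2.1 j c hc), h1.2.2.1, h1.2.2.2.1⟩
  · intro w s val vcs val' vcs' hx hx'
    rcases h.newView_cases hx with h1 | h1
    · rcases h.newView_cases hx' with h2 | h2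
      · exact V.newView_unique w s val vcs val' vcs' h1 h2
      · exact absurd h1 (h2.2.2.2.2.1 _ _)
    · have := h1.2.2.2.2.2 _ _ hx'
      exact ⟨this.1.symm, this.2.symm⟩
  · intro s hs
    have := V.viewChange_view s
    rcases h.core_cases s with h | h | h | h | h | h | h | h | h <;> simp_all
    omega

theorem Local.VerifyInv.start (me : Replica f) : (Local.start S).VerifyInv me := by
  constructor <;> simp [Local.start, Local.Reports]

theorem Local.VerifyInv.insert_rcv (V : L.VerifyInv me) (m : Msg f Client Op Res) :
    Local.VerifyInv (S := S) me { L with rcv := insert m L.rcv } := by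
  have hle := L.le_insert_rcv m
  obtain ⟨i1, i2, i3, i4, i5, i6, i7, i8, i9, i10⟩ := V
  refine ⟨?_, i2, i3, i4, ?_, i6, i7, ?_, i9, i10⟩
  · intro i x D hx
    obtain ⟨h2, h3, h4, h5, h6, h7⟩ := i1 i x D hx
    exact ⟨h2, h3, h4, h5, h6, hle.waitOK h7⟩
  · intro s i D hx
    obtain ⟨x, h2, h3, h4, h5⟩ := i5 s i D hx
    exact ⟨x, h2, h3, hle.rcv h4, hle.waitOK h5⟩
  · intro w s i val vcs hx
    have := i8 w s i val vcs hx
    exact ⟨fun j c hc => hle.rcv (this.1 j c hc), this.2⟩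

end LocalInvariants

/-! ### Slots whose agreement was started -/

section Runs

variable {f : ℕ} {Client Op Res State : Type*} {S : System f Client Op Res State}
  {G : ℕ → Global S}

theorem IsRun.verifyInv (hrun : IsRun G) (n : ℕ) (i : Replica f) :
    ((G n).loc i).VerifyInv i := by
  induction n with
  | zero =>
    rw [hrun.start]
    exact Local.VerifyInv.start i
  | succ n ih =>
    rcases hrun.loc_step n i with h | ⟨-, -, h⟩ | ⟨-, -, m, -, h⟩
    · rwa [h]
    · exact ih.act (hrun.headerInv n i) (hrun.headerInv (n + 1) i) h
    · rw [h]
      exact ih.insert_rcv m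

/-- Some correct replica has accepted a DepPropose for the slot. -/
def Global.Known (G : Global S) (s : Slot f) : Prop := ∃ i ∉ S.byz, (G.loc i).hdr s ≠ none

theorem Global.Le.known {G G' : Global S} (h : G.Le G') {s : Slot f} (hk : G.Known s) :
    G'.Known s := by
  obtain ⟨i, hi, hx⟩ := hk
  obtain ⟨x, hx⟩ := Option.ne_none_iff_exists'.1 hx
  exact ⟨i, hi, by simp [(h.loc i).hdr _ _ hx]⟩

theorem IsRun.known_of_verify (hrun : IsRun G) {n : ℕ} {i : Replica f} {s : Slot f}
    (h : AtLeast (f + 1) fun j => ∃ x D, x.slot = s ∧ Msg.verify j x D ∈ ((G n).loc i).rcv) :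
    (G n).Known s := by
  obtain ⟨j, hj, x, D, rfl, hx⟩ := h.exists_correct S
  have h1 := Global.Signed.sent ((hrun.genuine n i).1 _ hx) hj
  exact ⟨j, hj, by simp [((hrun.verifyInv n j).sent_verify _ _ _ h1).2.2.1]⟩

theorem IsRun.viewChange_sent (hrun : IsRun G) {n : ℕ} {i j : Replica f} {s : Slot f} {w : ℕ}
    {c : Cert f Client Op} (hx : Msg.viewChange w s j c ∈ ((G n).loc i).rcv) (hj : j ∉ S.byz) :
    Msg.viewChange w s j c ∈ ((G n).loc j).sent := by
  rcases (hrun.genuine n i).1 _ hx with h | h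
  · exact absurd h.1 hj
  · exact h

theorem IsRun.view_of_viewChange (hrun : IsRun G) {n : ℕ} {i j : Replica f} {s : Slot f} {w : ℕ}
    {c : Cert f Client Op} (hx : Msg.viewChange w s j c ∈ ((G n).loc i).rcv) (hj : j ∉ S.byz) :
    w ≠ 0 ∧ w ≤ ((G n).loc j).view s :=
  ((hrun.verifyInv n j).sent_viewChange _ _ _ _ (hrun.viewChange_sent hx hj)).2

/-- Timers run and views change only for slots of which a correct replica knows a DepPropose. -/
theorem IsRun.known (hrun : IsRun G) (n : ℕ) (s : Slot f) : ∀ i ∉ S.byz,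
    (((G n).loc i).comT s ≠ none → (G n).Known s) ∧ (((G n).loc i).view s ≠ 0 → (G n).Known s) := by
  induction n with
  | zero =>
    rw [hrun.start]
    simp [Global.start, Local.start]
  | succ n ih =>
    intro i hi
    have hle := hrun.le_succ n
    rcases hrun.loc_step n i with h | ⟨-, -, h⟩ | ⟨-, -, m, -, h⟩
    · rw [h]
      exact ⟨fun h => hle.known ((ih i hi).1 h), fun h => hle.known ((ih i hi).2 h)⟩
    · constructor
      · intro hT
        obtain ⟨τ, hτ⟩ := Option.ne_none_iff_exists'.1 hT
        rcases (h.comT_cases hτ).2 with h1 | ⟨-, -, h1 | h1⟩ | ⟨-, h1, -, val, vcs, h2, h3⟩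
        · exact hle.known ((ih i hi).1 (by simp [h1]))
        · exact ⟨i, hi, h1⟩
        · exact hle.known (hrun.known_of_verify h1.2)
        · exact hle.known ((ih i hi).2 ((hrun.verifyInv n i).viewChange_view s h1))
      · intro hv
        rcases h.view_cases s with h1 | ⟨-, -, ⟨-, τ, -, -, h1⟩ | h1⟩
        · exact hle.known ((ih i hi).2 (h1 ▸ hv))
        · rcases h1 with h1 | ⟨h1, h2⟩
          · exact hle.known ((ih i hi).1 (by simp [h1]))
          · exact hle.known ((ih i hi).2 ((hrun.verifyInv n i).viewChange_view s h1))
        · obtain ⟨j, hj, w', c, h3, h4⟩ := h1.exists_correct S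
          have := hrun.view_of_viewChange h4 hj
          exact hle.known ((ih j hj).2 (by omega))
    · rw [h]
      exact ⟨fun h => hle.known ((ih i hi).1 h), fun h => hle.known ((ih i hi).2 h)⟩

theorem IsRun.known_of_accepts (hrun : IsRun G) {n : ℕ} {i : Replica f} (hi : i ∉ S.byz)
    {s : Slot f} (h : ((G n).loc i).Accepts s) : (G n).Known s := by
  rcases h with h | h | h
  · exact ⟨i, hi, h⟩
  · exact hrun.known_of_verify h
  · obtain ⟨j, hj, w', c, h4⟩ := h.exists_correct S
    exact (hrun.known n s j hj).2 (by have := hrun.view_of_viewChange h4 hj; omega)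

/-- A known slot of a correct replica has been used for a proposal. -/
theorem IsRun.lt_of_known (hrun : IsRun G) {n : ℕ} {s : Slot f} (hs : s.co ∉ S.byz)
    (h : (G n).Known s) : s.sc < ((G n).loc s.co).mine.length := by
  obtain ⟨i, hi, hx⟩ := h
  obtain ⟨x, hx⟩ := Option.ne_none_iff_exists'.1 hx
  have h1 := (hrun.headerInv n i).hdr_slot s x hx
  have h2 := hrun.signedHeader hx
  unfold Global.SignedHeader at h2
  rw [h1.1] at h2
  have h3 := (hrun.headerInv n s.co).sent_propose x (h2.sent hs)
  obtain ⟨-, -, -, a, h4, -⟩ := h3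
  rw [h1.1] at h4
  exact (List.getElem?_eq_some_iff.1 h4).1

/-- All replicas know the same header for a slot of a correct coordinator. -/
theorem IsRun.hdr_eq (hrun : IsRun G) {n m : ℕ} {i : Replica f} {s : Slot f}
    {x y : Header f Client Op} (hs : s.co ∉ S.byz) (hx : ((G n).loc i).hdr s = some x)
    (hy : ((G m).loc s.co).hdr s = some y) : x = y := by
  have h1 := (hrun.headerInv n i).hdr_slot s x hx
  have h2 := hrun.signedHeader hx
  unfold Global.SignedHeader at h2
  rw [h1.1] at h2
  have h3 := ((hrun.headerInv n s.co).sent_propose x (h2.sent hs)).2.1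
  rw [h1.1] at h3
  have h4 := ((hrun.le (le_max_left n m)).loc s.co).hdr _ _ h3
  have h5 := ((hrun.le (le_max_right n m)).loc s.co).hdr _ _ hy
  rw [h4] at h5
  exact Option.some.inj h5

end Runs
-- Per-slot agreement invariant of a single replica
section LocalInvariants

variable {f : ℕ} {Client Op Res State : Type*} {S : System f Client Op Res State}
  {me : Replica f} {now : ℝ} {L L' : Local S} {s : Slot f}

/-- The reconciliation path. -/
def Step.Slow (x : Step) : Prop := x = .rpVerified ∨ x = .rpPrepared ∨ x = .rpCommitted

/-- The replica has collected the DepVerifys that make up the value, and `c` tells whether they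
satisfy the fast-path condition. -/
def Local.Collects (L : Local S) (s : Slot f) (val : Val f Client Op) (c : Prop) : Prop :=
  ∃ x, x.slot = s ∧ val = some (x, L.vec x) ∧ L.Collected x ∧ L.pr s = true ∧
    (c ↔ FpCond x (L.vec x))

theorem Local.Le.collects (h : L.Le L') {val : Val f Client Op} {c : Prop}
    (hx : L.Collects s val c) : L'.Collects s val c := by
  obtain ⟨x, h1, h2, h3, hp, h4⟩ := hx
  have := h.collected h3
  exact ⟨x, h1, by rw [this.2, h2], this.1, h.pr s hp, by rw [this.2, h4]⟩

theorem Local.Collects.unique {val val' : Val f Client Op} {c c' : Prop} (h : L.Collects s val c)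
    (h' : L.Collects s val' c') : val = val' ∧ (c ↔ c') := by
  obtain ⟨x, h1, h2, h3, -, h4⟩ := h
  obtain ⟨y, h1', h2', h3', -, h4'⟩ := h'
  have h5 := h3.1
  have h6 := h3'.1
  rw [h1] at h5
  rw [h1', h5] at h6
  cases h6
  exact ⟨by rw [h2, h2'], by rw [h4, h4']⟩

/-- The certificate is backed by messages that the replica knows. -/
def Local.Backed (me : Replica f) (L : Local S) (s : Slot f) (w : ℕ) : Cert f Client Op → Prop
  | .empty => True
  | .fpc x g => L.Collects s (some (x, g)) True
  | .rpc v val P => v < w ∧ 2 * f + 1 ≤ P.card ∧ (∀ i ∈ P, Msg.prepare v s i val ∈ L.rcv) ∧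
      Msg.prepare v s me val ∈ L.sent

theorem Local.Le.backed (h : L.Le L') {w w' : ℕ} (hw : w ≤ w') {c : Cert f Client Op}
    (hc : L.Backed me s w c) : L'.Backed me s w' c := by
  cases c with
  | empty => trivial
  | fpc x g => exact h.collects hc
  | rpc v val P => exact ⟨hc.1.trans_le hw, hc.2.1, fun i hi => h.rcv (hc.2.2.1 i hi), h.sent hc.2.2.2⟩

/-- A certificate of a view that is at least `v`. -/
def Cert.AtLeastView (v : ℕ) (c : Cert f Client Op) : Prop :=
  ∃ v' val' P, c = .rpc v' val' P ∧ v ≤ v'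

/-- The agreement on a slot from the point of view of a single replica. -/
structure Local.CoreInv (me : Replica f) (L : Local S) (s : Slot f) : Prop where
  late : L.view s ≠ 0 → L.step s = .viewChange ∨ (L.step s).Slow
  pr : L.view s = 0 → L.step s ≠ .init → L.pr s = true
  fast : L.step s = .fpVerified ∨ L.step s = .fpCommitted →
    Msg.depCommit s me (L.val s) ∈ L.sent
  slow : (L.step s).Slow → Msg.prepare (L.view s) s me (L.val s) ∈ L.sent
  commit : L.step s = .rpPrepared ∨ L.step s = .rpCommitted →
    Msg.commit (L.view s) s me (L.val s) ∈ L.sent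
  dec : L.step s = .fpCommitted ∨ L.step s = .rpCommitted → L.dec s ≠ none
  viewChange : L.view s ≠ 0 → ∃ c, Msg.viewChange (L.view s) s me c ∈ L.sent
  cert : L.Backed me s (L.view s + 1) (L.cert s)
  sent_depCommit : ∀ val, Msg.depCommit s me val ∈ L.sent → L.Collects s val True ∧
    L.cert s ≠ .empty
  sent_prepare : ∀ w val, Msg.prepare w s me val ∈ L.sent → w ≤ L.view s ∧
    (w = L.view s → (L.step s).Slow ∧ val = L.val s) ∧
    (w = 0 → L.Collects s val False) ∧
    (w ≠ 0 → ∃ vcs, Msg.newView w s (coord s w) val vcs ∈ L.rcv ∧ ValidVcs s w vcs ∧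
      Selected vcs val)
  prepare_unique : ∀ w val val', Msg.prepare w s me val ∈ L.sent →
    Msg.prepare w s me val' ∈ L.sent → val = val'
  sent_commit : ∀ w val, Msg.commit w s me val ∈ L.sent → w ≤ L.view s ∧
    (L.cert s).AtLeastView w ∧
    ∃ Q : Finset (Replica f), 2 * f + 1 ≤ Q.card ∧ ∀ i ∈ Q, Msg.prepare w s i val ∈ L.rcv
  sent_viewChange : ∀ w c, Msg.viewChange w s me c ∈ L.sent → w ≤ L.view s ∧ w ≠ 0 ∧
    L.Backed me s w c ∧ (∀ val, Msg.depCommit s me val ∈ L.sent → c ≠ .empty) ∧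
    ∀ v val, Msg.commit v s me val ∈ L.sent → v < w → c.AtLeastView v

/-- The hypothesis `hf` on unused own slots cannot be derived locally: `Act.propose` sets the step
of its slot without checking the view, and would otherwise interfere with a running view change. -/
theorem Local.CoreInv.act (I : L.HeaderInv me) (C : L.CoreInv me s)
    (hvc : L.step s = .viewChange → L.view s ≠ 0)
    (hf : L.mine.length ≤ s.sc → s.co = me → L.view s = 0) (h : Act S me now L L') :
    L'.CoreInv me s := by
  have hle := h.le I.fresh
  have hv := hle.view s
  have hfresh : s = ⟨me, L.mine.length⟩ → L.step s = .init ∧ L.view s = 0 := by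
    rintro rfl
    have h1 := hf le_rfl rfl
    refine ⟨?_, h1⟩
    by_contra h2
    exact absurd (C.pr h1 h2) (by simp [(I.fresh _ le_rfl).2])
  have hinit : L.step s = .init ∧ L.view s = 0 → ∀ w val, Msg.prepare w s me val ∉ L.sent := by
    intro h1 w val hm
    have h2 := C.sent_prepare w val hm
    rcases (h2.2.1 (by omega)).1 with h3 | h3 | h3 <;> simp [h1.1] at h3
  have hdec := hle.dec s
  have hcore := h.core_cases s
  have hpr := hle.pr s
  constructor
  · intro h1
    have := C.late
    rcases hcore with h | h | h | h | h | h | h | h | h <;> simp_all [Step.Slow]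
  · intro h1 h2
    have := C.pr
    rcases hcore with h | h | h | h | h | h | h | h | h <;> simp_all
  · intro h1
    rcases hcore with h | h | h | h | h | h | h | h | h
    · rw [h.1] at h1
      rw [h.2.1]
      exact hle.sent (C.fast h1)
    · simp [h.1] at h1
    · obtain ⟨-, -, -, -, x, -, -, -, h2, -, h3⟩ := h
      rwa [h2]
    · rw [h.2.2.1]
      exact hle.sent (C.fast (Or.inl h.2.1))
    all_goals simp [h.1] at h1
  · intro h1
    rcases hcore with h | h | h | h | h | h | h | h | h
    · rw [h.1] at h1
      rw [h.2.1, h.2.2.2]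
      exact hle.sent (C.slow h1)
    · simp [h.1, Step.Slow] at h1
    · simp [h.1, Step.Slow] at h1
    · simp [h.1, Step.Slow] at h1
    · obtain ⟨-, -, h2, -, -, x, -, -, -, h3, h4⟩ := h
      rwa [h2, h3]
    · rw [h.2.2.1, h.2.2.2.1]
      exact hle.sent (C.slow (Or.inl h.2.1))
    · rw [h.2.2.1, h.2.2.2.2.1]
      exact hle.sent (C.slow (Or.inr (Or.inl h.2.1)))
    · simp [h.1, Step.Slow] at h1
    · rw [h.2.2.1]
      exact h.2.2.2.2.2.1
  · intro h1
    rcases hcore with h | h | h | h | h | h | h | h | h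
    · rw [h.1] at h1
      rw [h.2.1, h.2.2.2]
      exact hle.sent (C.commit h1)
    · simp [h.1] at h1
    · simp [h.1] at h1
    · simp [h.1] at h1
    · simp [h.1] at h1
    · rw [h.2.2.1, h.2.2.2.1]
      exact h.2.2.2.2.1
    · rw [h.2.2.1, h.2.2.2.2.1]
      exact hle.sent (C.commit (Or.inl h.2.1))
    · simp [h.1] at h1
    · simp [h.1] at h1
  · intro h1
    have := C.dec
    have hd : L.dec s ≠ none → L'.dec s ≠ none := fun hn => by
      obtain ⟨d, hd⟩ := Option.ne_none_iff_exists'.1 hn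
      simp [hdec d hd]
    rcases hcore with h | h | h | h | h | h | h | h | h <;> simp_all
  · intro h1
    by_cases hw : L'.view s = L.view s
    · obtain ⟨c, hc⟩ := C.viewChange (hw ▸ h1)
      exact ⟨c, by rw [hw]; exact hle.sent hc⟩
    · rcases hcore with h | h | h | h | h | h | h | h | h
      case inr.inr.inr.inr.inr.inr.inr.inl => exact ⟨_, h.2.2.2.2.1⟩
      all_goals
        exfalso
        simp_all
  · have hold : L'.Backed me s (L'.view s + 1) (L.cert s) := hle.backed (by omega) C.cert
    rcases hcore with h | h | h | h | h | h | h | h | h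
    · rwa [h.2.2.1]
    · rwa [h.2.2.1]
    · obtain ⟨-, hv0, -, hp, x, h1, h2, h3, -, h4, -⟩ := h
      rw [h4]
      exact hle.collects ⟨x, h1, rfl, h2, C.pr hv0 (by simp [hp]), by simp [h3]⟩
    · rwa [h.2.2.2.1]
    · rwa [h.2.2.2.2.1]
    · obtain ⟨-, h1, -, h2, -, Q, h3, h4, h5⟩ := h
      rw [h5, h2]
      exact ⟨by omega, h3, fun i hi => hle.rcv (h4 i hi), hle.sent (C.slow (Or.inl h1))⟩
    · rwa [h.2.2.2.1]
    · rwa [h.2.2.2.1]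
    · rwa [h.2.2.2.1]
  · intro val hx
    rcases h.depCommit_cases hx with h1 | ⟨-, x, h1, h2, h3, h4, hv0, -, h5, hp⟩
    · refine ⟨hle.collects (C.sent_depCommit val h1).1, ?_⟩
      have := (C.sent_depCommit val h1).2
      rcases hcore with h | h | h | h | h | h | h | h | h <;> grind
    · exact ⟨hle.collects ⟨x, h1, h2, h3, C.pr hv0 (by simp [hp]), by simp [h4]⟩, by simp [h5]⟩
  · intro w val hx
    rcases h.prepare_cases hx with h1 | ⟨-, h1, h2, h3, h4, h5⟩
    · obtain ⟨h2, h3, h4, h5⟩ := C.sent_prepare w val h1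
      refine ⟨by omega, fun hw => ?_, fun hw => hle.collects (h4 hw), fun hw => ?_⟩
      · have hw' : L'.view s = L.view s := by omega
        have h6 := h3 (by omega)
        have h7 : L.step s ≠ .init ∧ L.step s ≠ .proposed ∧ L.step s ≠ .fpVerified ∧
            L.step s ≠ .viewChange := by
          rcases h6.1 with h | h | h <;> simp [h]
        rcases hcore with h | h | h | h | h | h | h | h | h
        · rw [h.1, h.2.1]
          exact h6
        · rcases h.2.2.2.2.2.2 with h | h
          · exact absurd (hfresh h).1 h7.1
          · exact absurd h.2 h7.1
        · exact absurd h.2.2.2.1 h7.2.1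
        · exact absurd h.2.1 h7.2.2.1
        · exact absurd h.2.2.2.1 h7.2.1
        · rw [h.2.2.1]
          exact ⟨Or.inr (Or.inl h.1), h6.2⟩
        · rw [h.2.2.1]
          exact ⟨Or.inr (Or.inr h.1), h6.2⟩
        · omega
        · exact absurd h.2.1 h7.2.2.2
      · obtain ⟨vcs, h6, h7⟩ := h5 hw
        exact ⟨vcs, hle.rcv h6, h7⟩
    · refine ⟨by omega, fun _ => ⟨Or.inl h3, h4.symm⟩, fun hw => ?_, fun hw => ?_⟩
      · rcases h5 with ⟨-, hp, x, h5, h6, h7, h8⟩ | ⟨h5, -⟩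
        · exact hle.collects ⟨x, h5, h6, h7, C.pr (h1 ▸ hw) (by simp [hp]), by simp [h8]⟩
        · exact absurd (h1 ▸ hw) (hvc h5)
      · rcases h5 with ⟨h5, -⟩ | ⟨-, vcs, h5, h6⟩
        · exact absurd h5 hw
        · exact ⟨vcs, hle.rcv h5, h6⟩
  · intro w val val' hx hx'
    -- Prepares are sent only from these two steps, while an earlier Prepare of the same view would
    -- put the replica on the reconciliation path. Hence there is at most one Prepare per view.
    have key : L.step s = .proposed ∨ L.step s = .viewChange →
        ∀ val, Msg.prepare (L.view s) s me val ∉ L.sent := by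
      intro h1 val h2
      rcases ((C.sent_prepare _ val h2).2.1 rfl).1 with h3 | h3 | h3 <;> simp [h3] at h1
    rcases h.prepare_cases hx with h1 | ⟨-, h1, h2, h3, h4, h5⟩ <;>
      rcases h.prepare_cases hx' with h1' | ⟨-, h1', h2', h3', h4', h5'⟩
    · exact C.prepare_unique w val val' h1 h1'
    · exact absurd (h1' ▸ h1) (key (h5'.imp (fun h => h.2.1) fun h => h.1) val)
    · exact absurd (h1 ▸ h1') (key (h5.imp (fun h => h.2.1) fun h => h.1) val')
    · rw [← h4, h4']
  · intro w val hx
    rcases h.commit_cases hx with h1 | ⟨-, h1, h2, h3, h4, Q, h5, h6, h7⟩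
    · obtain ⟨h2, ⟨v', val', P, h3, h4⟩, Q, h5, h6⟩ := C.sent_commit w val h1
      refine ⟨by omega, ?_, Q, h5, fun i hi => hle.rcv (h6 i hi)⟩
      rcases hcore with h | h | h | h | h | h | h | h | h
      · exact ⟨v', val', P, h.2.2.1.trans h3, h4⟩
      · exact ⟨v', val', P, h.2.2.1.trans h3, h4⟩
      -- Here a fast-path certificate would overwrite a reconciliation-path one. The latter could
      -- only belong to view `0` and is backed by an own Prepare of that view, which contradicts
      -- step `proposed`.
      · exfalso
        have h7 := C.cert
        rw [h3] at h7
        have h8 := ((C.sent_prepare _ _ h7.2.2.2).2.1 (by have := h7.1; omega)).1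
        rcases h8 with h8 | h8 | h8 <;> simp [h.2.2.2.1] at h8
      · exact ⟨v', val', P, h.2.2.2.1.trans h3, h4⟩
      · exact ⟨v', val', P, h.2.2.2.2.1.trans h3, h4⟩
      · obtain ⟨-, -, -, -, -, Q, -, -, h9⟩ := h
        exact ⟨_, _, Q, h9, h2⟩
      · exact ⟨v', val', P, h.2.2.2.1.trans h3, h4⟩
      · exact ⟨v', val', P, h.2.2.2.1.trans h3, h4⟩
      · exact ⟨v', val', P, h.2.2.2.1.trans h3, h4⟩
    · exact ⟨by omega, ⟨_, _, Q, h7, le_rfl⟩, Q, h5, fun i hi => hle.rcv (h6 i hi)⟩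
  · intro w c hx
    rcases h.viewChange_cases hx with h1 | ⟨-, h1, h2, h3, h4⟩
    · obtain ⟨h2, h3, h4, h5, h6⟩ := C.sent_viewChange w c h1
      refine ⟨by omega, h3, hle.backed le_rfl h4, fun val hd => ?_, fun v val hd hv => ?_⟩
      · rcases h.depCommit_cases hd with h7 | ⟨-, x, -, -, -, -, h7, -⟩
        · exact h5 val h7
        · omega
      · rcases h.commit_cases hd with h7 | ⟨-, h7, -⟩
        · exact h6 v val h7 hv
        · omega
    · subst h3
      refine ⟨by omega, by omega, hle.backed (by omega) C.cert, fun val hd => ?_,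
        fun v val hd hv => ?_⟩
      · rcases h.depCommit_cases hd with h7 | ⟨-, x, -, -, -, -, h7, h8, -⟩
        · exact (C.sent_depCommit val h7).2
        · omega
      · rcases h.commit_cases hd with h7 | ⟨-, h7, h8, -⟩
        · exact (C.sent_commit v val h7).2.1
        · omega

theorem Local.CoreInv.start (me : Replica f) (s : Slot f) : (Local.start S).CoreInv me s := by
  constructor <;> simp [Local.start, Local.Backed, Step.Slow]

theorem Local.CoreInv.insert_rcv (C : L.CoreInv me s) (m : Msg f Client Op Res) :
    Local.CoreInv (S := S) me { L with rcv := insert m L.rcv } s := by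
  have hle := L.le_insert_rcv m
  obtain ⟨i1, i2, i3, i4, i5, i6, i7, i8, i9, i10, i11, i12, i13⟩ := C
  refine ⟨i1, i2, i3, i4, i5, i6, i7, hle.backed le_rfl i8,
    fun val hx => ⟨hle.collects (i9 val hx).1, (i9 val hx).2⟩, ?_, i11, ?_, ?_⟩
  · intro w val hx
    obtain ⟨h1, h2, h3, h4⟩ := i10 w val hx
    refine ⟨h1, h2, fun h => hle.collects (h3 h), fun h => ?_⟩
    obtain ⟨vcs, h5, h6⟩ := h4 h
    exact ⟨vcs, hle.rcv h5, h6⟩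
  · intro w val hx
    obtain ⟨h1, h2, Q, h3, h4⟩ := i12 w val hx
    exact ⟨h1, h2, Q, h3, fun i hi => hle.rcv (h4 i hi)⟩
  · intro w c hx
    obtain ⟨h1, h2, h3, h4⟩ := i13 w c hx
    exact ⟨h1, h2, hle.backed le_rfl h3, h4⟩

end LocalInvariants

section Runs

variable {f : ℕ} {Client Op Res State : Type*} {S : System f Client Op Res State}
  {G : ℕ → Global S}

/-- The initial view is left only for known slots, and a known slot of a correct coordinator carries
its signature, so it has been used for a proposal. -/
theorem IsRun.view_fresh (hrun : IsRun G) (n : ℕ) {i : Replica f} (hi : i ∉ S.byz) (s : Slot f)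
    (h : ((G n).loc i).mine.length ≤ s.sc) (hs : s.co = i) : ((G n).loc i).view s = 0 := by
  by_contra h1
  subst hs
  have := hrun.lt_of_known hi ((hrun.known n s _ hi).2 h1)
  omega

theorem IsRun.coreInv (hrun : IsRun G) (n : ℕ) {i : Replica f} (hi : i ∉ S.byz) (s : Slot f) :
    ((G n).loc i).CoreInv i s := by
  induction n with
  | zero =>
    rw [hrun.start]
    exact Local.CoreInv.start i s
  | succ n ih =>
    rcases hrun.loc_step n i with h | ⟨-, -, h⟩ | ⟨-, -, m, -, h⟩
    · rwa [h]
    · exact ih.act (hrun.headerInv n i) ((hrun.verifyInv n i).viewChange_view s)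
        (hrun.view_fresh n hi s) h
    · rw [h]
      exact ih.insert_rcv m

end Runs
-- Agreement: uniqueness of decisions and mutual dependencies
section Agreement

variable {f : ℕ} {Client Op Res State : Type*} {S : System f Client Op Res State}

theorem covers_outcome {x : Header f Client Op} {g : Replica f → Deps f} {d : Slot f} :
    Covers (outcome (some (x, g))).2 d ↔ Covers x.D d ∨ ∃ i ∈ x.F, Covers (g i) d := by
  simp [Covers, outcome, Finset.lt_sup_iff]

theorem Deps.ext_covers {D D' : Deps f} (h : ∀ d, Covers D d ↔ Covers D' d) : D = D' := by
  funext c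
  by_contra hne
  rcases Nat.lt_or_gt_of_ne hne with h1 | h1
  · exact lt_irrefl (D c) ((h ⟨c, D c⟩).2 h1)
  · exact lt_irrefl (D' c) ((h ⟨c, D' c⟩).1 h1)

/-- Some correct replica knows the slot `d` or a later slot of the same coordinator. -/
def Global.KnownFrom (G : Global S) (d : Slot f) : Prop :=
  ∃ n, d.sc ≤ n ∧ G.Known ⟨d.co, n⟩

/-- A value that can be agreed on: signatures are genuine and dependencies are known. -/
def Global.Sound (G : Global S) (s : Slot f) : Val f Client Op → Prop
  | none => True
  | some (x, g) => ValidVal s (some (x, g)) ∧ G.GenuineVal (some (x, g)) ∧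
      ∀ d, Covers (outcome (some (x, g))).2 d → G.KnownFrom d

/-- Enough replicas have voted for the value on the fast path. -/
def Global.FastChosen (G : Global S) (s : Slot f) (val : Val f Client Op) : Prop :=
  AtLeast (2 * f + 1) fun i => G.Signed i (Msg.depCommit s i val)

def Global.Prepared (G : Global S) (s : Slot f) (w : ℕ) (val : Val f Client Op) : Prop :=
  AtLeast (2 * f + 1) fun i => G.Signed i (Msg.prepare w s i val)

/-- Enough replicas have voted for the value on the reconciliation path of a view. -/
def Global.SlowChosen (G : Global S) (s : Slot f) (w : ℕ) (val : Val f Client Op) : Prop :=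
  AtLeast (2 * f + 1) fun i => G.Signed i (Msg.commit w s i val)

def Global.Chosen (G : Global S) (s : Slot f) (val : Val f Client Op) : Prop :=
  G.FastChosen s val ∨ ∃ w, G.SlowChosen s w val

theorem Global.Le.chosen {G G' : Global S} (hle : G.Le G') {s : Slot f} {val : Val f Client Op}
    (h : G.Chosen s val) : G'.Chosen s val :=
  h.imp (fun h => h.mono le_rfl fun _ h => hle.signed h) fun ⟨w, h⟩ =>
    ⟨w, h.mono le_rfl fun _ h => hle.signed h⟩

/-- A certificate whose contents can be relied on. -/
def Global.CertOK (G : Global S) (s : Slot f) (w : ℕ) : Cert f Client Op → Prop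
  | .empty => True
  | .fpc x g => G.Sound s (some (x, g)) ∧ FpCond x g
  | .rpc v val _ => v < w ∧ G.Prepared s v val

variable {G : ℕ → Global S} {n : ℕ} {i : Replica f} {s : Slot f} {w : ℕ} {val : Val f Client Op}

/-- Waiting concerns only the explicit member of each coordinator, whose counter is one less than
the entry of `D`. It lies at or after the covered slot `d`, whence `Global.KnownFrom` and not yet
`Global.Known`. -/
theorem IsRun.knownFrom_of_waitOK (hrun : IsRun G) (hi : i ∉ S.byz) {D : Deps f}
    (h : ((G n).loc i).WaitOK D) {d : Slot f} (hd : Covers D d) : (G n).KnownFrom d := by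
  unfold Covers at hd
  obtain ⟨m, hm⟩ := Nat.exists_eq_succ_of_ne_zero (Nat.ne_of_gt (Nat.zero_lt_of_lt hd))
  exact ⟨m, by omega, hrun.known_of_accepts hi (h d.co m hm)⟩

/-- The dependencies reported by the members of a quorum enter the outcome. -/
theorem Global.GenuineVal.reports {G : Global S} {x : Header f Client Op} {g : Replica f → Deps f}
    (h : G.GenuineVal (some (x, g))) {j : Replica f} (hj : j ∉ S.byz)
    (hx : j = x.slot.co ∨ j ∈ x.F) : ∃ D, (G.loc j).Reports j x D ∧
      ∀ d, Covers D d → Covers (outcome (some (x, g))).2 d := by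
  rcases hx with rfl | hx
  · exact ⟨x.D, Or.inl ⟨h.1.sent hj, rfl⟩, fun d hd => covers_outcome.2 (Or.inl hd)⟩
  · exact ⟨g j, Or.inr ((h.2.2 j hx).sent hj), fun d hd => covers_outcome.2 (Or.inr ⟨j, hx, hd⟩)⟩

theorem IsRun.hdr_of_genuine (hrun : IsRun G) {x : Header f Client Op} {g : Replica f → Deps f}
    (h : (G n).GenuineVal (some (x, g))) (hj : i ∉ S.byz) (hx : i = x.slot.co ∨ i ∈ x.F) :
    ((G n).loc i).hdr x.slot = some x := by
  obtain ⟨D, hD, -⟩ := h.reports hj hx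
  exact (hD.known (hrun.headerInv n i) (hrun.verifyInv n i)).1

theorem IsRun.sound_of_collects (hrun : IsRun G) (hi : i ∉ S.byz) {c : Prop}
    (h : ((G n).loc i).Collects s val c) : (G n).Sound s val := by
  obtain ⟨x, rfl, rfl, h3, h4, -⟩ := h
  have I := hrun.headerInv n i
  have h5 := I.hdr_slot _ x h3.1
  have hv : ∀ j ∈ x.F, Msg.verify j x (((G n).loc i).vec x j) ∈ ((G n).loc i).rcv ∧
      ((G n).loc i).WaitOK (((G n).loc i).vec x j) := fun j hj => by
    obtain ⟨D, hD⟩ := Option.ne_none_iff_exists'.1 (h3.2 j hj)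
    obtain ⟨y, h6, -, h7⟩ := (hrun.verifyInv n i).v_some _ _ _ hD
    rw [h3.1] at h6
    cases h6
    simpa [Local.vec, hj, hD] using h7
  refine ⟨⟨rfl, h5.2.1, fun j hj => by simp [Local.vec, hj]⟩,
    ⟨hrun.signedHeader h3.1, ?_, fun j hj => (hrun.genuine n i).1 _ (hv j hj).1⟩, fun d hd => ?_⟩
  · obtain ⟨y, h6, h7⟩ := I.pr_hdr _ h4
    rw [h3.1] at h6
    cases h6
    exact ((hrun.genuine n i).1 _ h7).2
  · rcases covers_outcome.1 hd with h6 | ⟨j, hj, h6⟩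
    · exact hrun.knownFrom_of_waitOK hi h5.2.2 h6
    · exact hrun.knownFrom_of_waitOK hi (hv j hj).2 h6

/-- A certificate from a faulty replica was not filtered by waiting, but `FpCond` makes up for it:
each dependency is either in the DepPropose, which a correct member of the quorum accepted, or was
reported by `f + 1` followers, one of them correct. So faulty followers cannot introduce
dependencies on slots that never start. -/
theorem IsRun.sound_of_fpCond (hrun : IsRun G) {x : Header f Client Op} {g : Replica f → Deps f}
    (hv : ValidVal s (some (x, g))) (hc : FpCond x g) (hg : (G n).GenuineVal (some (x, g))) :
    (G n).Sound s (some (x, g)) := by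
  refine ⟨hv, hg, fun d hd => ?_⟩
  have h1 : Covers x.D d ∨ AtLeast (f + 1) fun i => i ∈ x.F ∧ Covers (g i) d := by
    rcases covers_outcome.1 hd with h1 | h1
    · exact Or.inl h1
    · exact hc d h1
  rcases h1 with h1 | h1
  · obtain ⟨j, hj, h2, -⟩ := hv.2.1.atLeast.inter S hv.2.1.atLeast
    exact hrun.knownFrom_of_waitOK hj
      ((hrun.headerInv n j).hdr_slot _ _ (hrun.hdr_of_genuine hg hj h2)).2.2 h1
  · obtain ⟨j, hj, h2, h3⟩ := h1.exists_correct S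
    exact hrun.knownFrom_of_waitOK hj
      ((hrun.verifyInv n j).sent_verify _ _ _ ((hg.2.2 j h2).sent hj)).2.2.2.2.2 h3

theorem IsRun.loc_of_byz (hrun : IsRun G) (n : ℕ) (hi : i ∈ S.byz) :
    (G n).loc i = Local.start S := by
  induction n with
  | zero => rw [hrun.start]; rfl
  | succ n ih =>
    rcases hrun.loc_step n i with h | ⟨h, -⟩ | ⟨h, -⟩
    · rw [h, ih]
    · exact absurd hi h
    · exact absurd hi h

/-- For a faulty sender the contents follow from the signatures and the validity check; for a
correct one from the messages that it had received when it formed the certificate. -/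
theorem IsRun.certOK (hrun : IsRun G) {c : Cert f Client Op} (h : (G n).GenuineVC w s i c)
    (hv : ValidCert s w c) : (G n).CertOK s w c := by
  by_cases hi : i ∈ S.byz
  · have hg : (G n).GenuineCert s c := by
      rcases h with h | h
      · exact h.2
      · rw [hrun.loc_of_byz n hi] at h
        exact absurd h (Set.notMem_empty _)
    cases c with
    | empty => trivial
    | fpc x g => exact ⟨hrun.sound_of_fpCond hv.1 hv.2 hg, hv.2⟩
    | rpc v val P => exact ⟨hv.1, P, hv.2.1, hg.2⟩
  · have h1 := ((hrun.coreInv n hi s).sent_viewChange w c (h.resolve_left fun h => hi h.1)).2.2.1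
    cases c with
    | empty => trivial
    | fpc x g => exact ⟨hrun.sound_of_collects hi h1, hv.2⟩
    | rpc v val P => exact ⟨hv.1, P, hv.2.1, fun j hj => (hrun.genuine n i).1 _ (h1.2.2.1 j hj)⟩

/-- What a correct replica prepares in a later view has been selected by a view change. -/
theorem IsRun.exists_vcs (hrun : IsRun G) (hi : i ∉ S.byz)
    (h : Msg.prepare w s i val ∈ ((G n).loc i).sent) (hw : w ≠ 0) :
    ∃ vcs, Selected vcs val ∧ (AtLeast (2 * f + 1) fun j => ∃ c, vcs j = some c) ∧
      ∀ j c, vcs j = some c → (G n).GenuineVC w s j c ∧ (G n).CertOK s w c := by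
  obtain ⟨vcs, h1, h2, h3⟩ := ((hrun.coreInv n hi s).sent_prepare w val h).2.2.2 hw
  have h4 : ∀ j c, vcs j = some c → (G n).GenuineVC w s j c := by
    intro j c hc
    rcases (hrun.genuine n i).1 _ h1 with h4 | h4
    · exact h4.2 j c hc
    · exact (hrun.genuine n _).1 _ (((hrun.verifyInv n _).sent_newView _ _ _ _ _ h4).1 j c hc)
  refine ⟨vcs, h3, ⟨_, h2.1.ge, fun j hj => ?_⟩, fun j c hc => ⟨h4 j c hc,
    hrun.certOK (h4 j c hc) (h2.2 j c hc)⟩⟩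
  exact Option.isSome_iff_exists.1 (by simpa using hj)

/-- Descent on views: a value prepared in a later view was prepared in a smaller one, comes from a
fast-path certificate, or is the no-op. In view `0` the replica itself has collected the value. -/
theorem IsRun.sound_of_prepare (hrun : IsRun G) (hi : i ∉ S.byz)
    (h : Msg.prepare w s i val ∈ ((G n).loc i).sent) : (G n).Sound s val := by
  induction w using Nat.strong_induction_on generalizing i val with
  | _ w ih =>
    by_cases hw : w = 0
    · exact hrun.sound_of_collects hi (((hrun.coreInv n hi s).sent_prepare w val h).2.2.1 hw)
    · obtain ⟨vcs, h1, -, h2⟩ := hrun.exists_vcs hi h hw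
      rcases h1 with ⟨j, v, P, h1, -⟩ | ⟨-, j, x, g, h1, rfl⟩ | ⟨-, rfl⟩
      · obtain ⟨h3, h4⟩ := (h2 j _ h1).2
        obtain ⟨k, hk, h5, -⟩ := h4.inter S h4
        exact ih v h3 hk (h5.sent hk)
      · exact (h2 j _ h1).2.1
      · trivial

theorem IsRun.sound_of_chosen (hrun : IsRun G) (h : (G n).Chosen s val) : (G n).Sound s val := by
  rcases h with h | ⟨w, h⟩
  · obtain ⟨j, hj, h1, -⟩ := h.inter S h
    exact hrun.sound_of_collects hj ((hrun.coreInv n hj s).sent_depCommit val (h1.sent hj)).1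
  · obtain ⟨j, hj, h1, -⟩ := h.inter S h
    obtain ⟨-, -, Q, hQ, h2⟩ := (hrun.coreInv n hj s).sent_commit w val (h1.sent hj)
    have h3 : AtLeast (2 * f + 1) fun i => Msg.prepare w s i val ∈ ((G n).loc j).rcv := ⟨Q, hQ, h2⟩
    obtain ⟨k, hk, h4, -⟩ := h3.inter S h3
    exact hrun.sound_of_prepare hk (Global.Signed.sent ((hrun.genuine n j).1 _ h4) hk)

theorem IsRun.prepared_of_slowChosen (hrun : IsRun G) (h : (G n).SlowChosen s w val) :
    (G n).Prepared s w val := by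
  obtain ⟨j, hj, h1, -⟩ := h.inter S h
  obtain ⟨-, -, Q, hQ, h2⟩ := (hrun.coreInv n hj s).sent_commit w val (h1.sent hj)
  exact ⟨Q, hQ, fun i hi => (hrun.genuine n j).1 _ (h2 i hi)⟩

theorem IsRun.prepared_unique (hrun : IsRun G) {val' : Val f Client Op} (h : (G n).Prepared s w val)
    (h' : (G n).Prepared s w val') : val = val' := by
  obtain ⟨j, hj, h1, h2⟩ := h.inter S h'
  exact (hrun.coreInv n hj s).prepare_unique w _ _ (h1.sent hj) (h2.sent hj)

/-- The coordinator and its followers form a quorum of `2f + 1`, two of these share a correct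
replica, and it stores only one header per slot. Nothing is assumed about the coordinator or about
equality of the two quorums. -/
theorem IsRun.header_unique (hrun : IsRun G) {x x' : Header f Client Op}
    {g g' : Replica f → Deps f} (h : (G n).Sound s (some (x, g)))
    (h' : (G n).Sound s (some (x', g'))) : x = x' := by
  obtain ⟨j, hj, h1, h2⟩ := h.1.2.1.atLeast.inter S h'.1.2.1.atLeast
  have h3 := hrun.hdr_of_genuine h.2.1 hj h1
  have h4 := hrun.hdr_of_genuine h'.2.1 hj h2
  rw [h.1.1] at h3
  rw [h'.1.1, h3] at h4
  exact Option.some.inj h4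

/-- Fast-path certificates of a slot may differ, but have the same outcome. -/
theorem IsRun.outcome_eq (hrun : IsRun G) {x x' : Header f Client Op}
    {g g' : Replica f → Deps f} (h : (G n).Sound s (some (x, g))) (hc : FpCond x g)
    (h' : (G n).Sound s (some (x', g'))) (hc' : FpCond x' g') :
    outcome (some (x, g)) = outcome (some (x', g')) := by
  obtain rfl := hrun.header_unique h h'
  have key : ∀ g g' : Replica f → Deps f, (G n).Sound s (some (x, g)) → FpCond x g →
      (G n).Sound s (some (x, g')) → ∀ d, Covers (outcome (some (x, g))).2 d →
      Covers (outcome (some (x, g'))).2 d := by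
    intro g g' h hc h' d hd
    rw [covers_outcome] at hd ⊢
    have h1 : Covers x.D d ∨ AtLeast (f + 1) fun i => i ∈ x.F ∧ Covers (g i) d :=
      hd.elim Or.inl fun h1 => hc d h1
    refine h1.imp id fun h1 => ?_
    -- A correct follower sends only one DepVerify for a header, so it contributes the same set to
    -- both certificates.
    obtain ⟨j, hj, h2, h3⟩ := h1.exists_correct S
    refine ⟨j, h2, ?_⟩
    rwa [← (hrun.verifyInv n j).verify_unique x _ _ ((h.2.1.2.2 j h2).sent hj)
      ((h'.2.1.2.2 j h2).sent hj)]
  refine Prod.ext rfl (Deps.ext_covers fun d => ⟨key g g' h hc h' d, key g' g h' hc' h d⟩)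

/-- After a fast-path decision, later views preserve its outcome. -/
theorem IsRun.outcome_of_fastChosen (hrun : IsRun G) (h : (G n).FastChosen s val) (hi : i ∉ S.byz)
    {val' : Val f Client Op} (hp : Msg.prepare w s i val' ∈ ((G n).loc i).sent) (hw : w ≠ 0) :
    outcome val' = outcome val := by
  induction w using Nat.strong_induction_on generalizing i val' with
  | _ w ih =>
    obtain ⟨vcs, h1, hq, h2⟩ := hrun.exists_vcs hi hp hw
    -- Some correct replica sent a DepCommit and also contributed to the view change; its
    -- certificate is nonempty, which rules out the no-op.
    obtain ⟨j, hj, ⟨c, hc⟩, h3⟩ := hq.inter S h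
    have h3 := h3.sent hj
    have C := hrun.coreInv n hj s
    have hne : c ≠ .empty := (C.sent_viewChange w c
      ((h2 j c hc).1.resolve_left fun h => hj h.1)).2.2.2.1 val h3
    rcases h1 with ⟨k, v, P, h1, -⟩ | ⟨-, k, x, g, h1, rfl⟩ | ⟨h1, -⟩
    · obtain ⟨h4, h5⟩ := (h2 k _ h1).2
      -- Preparing in view `0` requires a violated fast-path condition, sending a DepCommit a
      -- satisfied one, on the same collected DepVerifys. A common correct replica makes this
      -- impossible.
      by_cases hv : v = 0
      · exfalso
        obtain ⟨l, hl, h6, h7⟩ := h5.inter S h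
        have C' := hrun.coreInv n hl s
        have h8 := (C'.sent_prepare v val' (h6.sent hl)).2.2.1 hv
        have h9 := (C'.sent_depCommit val (h7.sent hl)).1
        simpa using (h8.unique h9).2
      · obtain ⟨l, hl, h6, -⟩ := h5.inter S h5
        exact ih v h4 hl (h6.sent hl) hv
    · have h4 := (C.sent_depCommit val h3).1
      obtain ⟨h5, h6⟩ := (h2 k _ h1).2
      have h7 := hrun.sound_of_collects hj h4
      obtain ⟨y, -, rfl, -, -, h8⟩ := h4
      exact hrun.outcome_eq h5 h6 h7 (h8.1 trivial)
    · exact absurd (h1 j c hc) hne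

/-- After a decision on the reconciliation path, later views preserve its value. -/
theorem IsRun.eq_of_slowChosen (hrun : IsRun G) {v : ℕ} (h : (G n).SlowChosen s v val)
    (hi : i ∉ S.byz) {val' : Val f Client Op}
    (hp : Msg.prepare w s i val' ∈ ((G n).loc i).sent) (hw : v < w) : val' = val := by
  induction w using Nat.strong_induction_on generalizing i val' with
  | _ w ih =>
    obtain ⟨vcs, h1, hq, h2⟩ := hrun.exists_vcs hi hp (by omega)
    obtain ⟨j, hj, ⟨c, hc⟩, h3⟩ := hq.inter S h
    -- The common replica locked its Commit in a certificate of view at least `v`, so the selected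
    -- certificate has such a view too: either it is later than `v` and the induction applies, or it
    -- is `v` and Prepares of one view agree.
    obtain ⟨v', val₁, P, rfl, hv'⟩ := ((hrun.coreInv n hj s).sent_viewChange w c
      ((h2 j c hc).1.resolve_left fun h => hj h.1)).2.2.2.2 v val (h3.sent hj) hw
    rcases h1 with ⟨k, v₂, P, h1, hmax⟩ | ⟨h1, -⟩ | ⟨h1, -⟩
    · have h4 := hmax j _ _ _ hc
      obtain ⟨h5, h6⟩ := (h2 k _ h1).2
      rcases Nat.lt_or_ge v v₂ with h7 | h7
      · obtain ⟨l, hl, h8, -⟩ := h6.inter S h6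
        exact ih v₂ h5 hl (h8.sent hl) h7
      · obtain rfl : v = v₂ := by omega
        exact hrun.prepared_unique h6 (hrun.prepared_of_slowChosen h)
    · exact absurd hc (h1 j _ _ _)
    · exact absurd (h1 j _ hc) (by simp)

/-- Only the outcomes can be compared: after a fast-path decision a view change may select another
certificate in which a faulty follower reported different dependencies. -/
theorem IsRun.chosen_unique (hrun : IsRun G) {val' : Val f Client Op} (h : (G n).Chosen s val)
    (h' : (G n).Chosen s val') : outcome val = outcome val' := by
  have key : ∀ {val val' w}, (G n).FastChosen s val → (G n).SlowChosen s w val' →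
      outcome val' = outcome val := by
    intro val val' w h h'
    have hp := hrun.prepared_of_slowChosen h'
    by_cases hw : w = 0
    · exfalso
      obtain ⟨l, hl, h6, h7⟩ := hp.inter S h
      have C' := hrun.coreInv n hl s
      have h8 := (C'.sent_prepare w val' (h6.sent hl)).2.2.1 hw
      have h9 := (C'.sent_depCommit val (h7.sent hl)).1
      simpa using (h8.unique h9).2
    · obtain ⟨l, hl, h6, -⟩ := hp.inter S hp
      exact hrun.outcome_of_fastChosen h hl (h6.sent hl) hw
  have key' : ∀ {val val' w w'}, (G n).SlowChosen s w val → (G n).SlowChosen s w' val' →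
      w < w' → val' = val := by
    intro val val' w w' h h' hw
    have hp := hrun.prepared_of_slowChosen h'
    obtain ⟨l, hl, h6, -⟩ := hp.inter S hp
    exact hrun.eq_of_slowChosen h hl (h6.sent hl) hw
  rcases h with h | ⟨w, h⟩ <;> rcases h' with h' | ⟨w', h'⟩
  · obtain ⟨j, hj, h1, h2⟩ := AtLeast.inter S h h'
    have C := hrun.coreInv n hj s
    rw [((C.sent_depCommit val (h1.sent hj)).1.unique (C.sent_depCommit val' (h2.sent hj)).1).1]
  · exact (key h h').symm
  · exact key h' h
  · rcases lt_trichotomy w w' with hw | rfl | hw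
    · rw [key' h h' hw]
    · rw [hrun.prepared_unique (hrun.prepared_of_slowChosen h) (hrun.prepared_of_slowChosen h')]
    · rw [key' h' h hw]

/-- A result adopted from `f + 1` answers was decided earlier by a correct replica, so every
decision goes back to a quorum of DepCommits or Commits. -/
theorem IsRun.chosen_of_dec (hrun : IsRun G) (n : ℕ) {i : Replica f} (hi : i ∉ S.byz) (s : Slot f)
    (d : Decision f Client Op) (h : ((G n).loc i).dec s = some d) :
    ∃ val, d = outcome val ∧ (G n).Chosen s val := by
  induction n generalizing i with
  | zero =>
    rw [hrun.start] at h
    simp [Global.start, Local.start] at h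
  | succ n ih =>
    have hle := hrun.le_succ n
    have ih' : ∀ {i}, i ∉ S.byz → ((G n).loc i).dec s = some d →
        ∃ val, d = outcome val ∧ (G (n + 1)).Chosen s val := fun hi h => by
      obtain ⟨val, h1, h2⟩ := ih hi h
      exact ⟨val, h1, hle.chosen h2⟩
    rcases hrun.loc_step n i with h1 | ⟨-, -, h1⟩ | ⟨-, -, m, -, h1⟩
    · exact ih' hi (h1 ▸ h)
    · rcases h1.dec_cases h with h2 | ⟨val, h2, h3⟩ | h2
      · exact ih' hi h2
      · refine ⟨val, h2, hle.chosen (h3.imp (fun h3 => ?_) fun ⟨w, h3⟩ => ⟨w, ?_⟩)⟩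
        · exact AtLeast.mono h3 le_rfl fun j hj => (hrun.genuine n i).1 _ hj
        · exact AtLeast.mono h3 le_rfl fun j hj => (hrun.genuine n i).1 _ hj
      · obtain ⟨j, hj, h3⟩ := h2.exists_correct S
        exact ih' hj ((hrun.verifyInv n j).sent_exec _ _ _
          (Global.Signed.sent ((hrun.genuine n i).1 _ h3) hj))
    · rw [h1] at h
      exact ih' hi h

/-- Correct replicas decide the same. -/
theorem IsRun.dec_unique (hrun : IsRun G) {m : ℕ} {j : Replica f} (hi : i ∉ S.byz) (hj : j ∉ S.byz)
    {d d' : Decision f Client Op} (h : ((G n).loc i).dec s = some d)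
    (h' : ((G m).loc j).dec s = some d') : d = d' := by
  obtain ⟨val, rfl, h1⟩ := hrun.chosen_of_dec n hi s d h
  obtain ⟨val', rfl, h2⟩ := hrun.chosen_of_dec m hj s d' h'
  exact hrun.chosen_unique ((hrun.le (le_max_left n m)).chosen h1)
    ((hrun.le (le_max_right n m)).chosen h2)

theorem IsRun.sound_of_dec (hrun : IsRun G) (hi : i ∉ S.byz) {d : Decision f Client Op}
    (h : ((G n).loc i).dec s = some d) : ∃ val, d = outcome val ∧ (G n).Sound s val := by
  obtain ⟨val, h1, h2⟩ := hrun.chosen_of_dec n hi s d h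
  exact ⟨val, h1, hrun.sound_of_chosen h2⟩

theorem Global.Le.sound {G G' : Global S} (hle : G.Le G') (h : G.Sound s val) : G'.Sound s val := by
  match val, h with
  | none, _ => trivial
  | some (x, g), h =>
    refine ⟨h.1, hle.genuineVal h.2.1, fun d hd => ?_⟩
    obtain ⟨n, h1, h2⟩ := h.2.2 d hd
    exact ⟨n, h1, hle.known h2⟩

/-- Of two decided slots with conflicting requests, one depends on the other. -/
theorem IsRun.covers_of_conflict (hrun : IsRun G) {m : ℕ} {j : Replica f} {s' : Slot f}
    (hi : i ∉ S.byz) (hj : j ∉ S.byz) {r r' : Req Client Op} {D D' : Deps f}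
    (h : ((G n).loc i).dec s = some (some r, D)) (h' : ((G m).loc j).dec s' = some (some r', D'))
    (hne : s ≠ s') (hc : S.app.Conflict r r') : Covers D s' ∨ Covers D' s := by
  obtain ⟨val, h1, h2⟩ := hrun.sound_of_dec hi h
  obtain ⟨val', h1', h2'⟩ := hrun.sound_of_dec hj h'
  replace h2 := (hrun.le (le_max_left n m)).sound h2
  replace h2' := (hrun.le (le_max_right n m)).sound h2'
  match val, h1, val', h1', h2, h2' with
  | some (x, g), h1, some (x', g'), h1', h2, h2' =>
    -- A correct replica in both proposal quorums reported on both headers, and both of its reports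
    -- enter the respective outcomes.
    obtain ⟨k, hk, h3, h4⟩ := h2.1.2.1.atLeast.inter S h2'.1.2.1.atLeast
    obtain ⟨E, h5, h6⟩ := h2.2.1.reports hk h3
    obtain ⟨E', h5', h6'⟩ := h2'.2.1.reports hk h4
    have e1 := h2.1.1
    have e2 := h2'.1.1
    have h7 : r = x.req := Option.some.inj (congrArg Prod.fst h1)
    have h7' : r' = x'.req := Option.some.inj (congrArg Prod.fst h1')
    have h8 : D = (outcome (some (x, g))).2 := congrArg Prod.snd h1
    have h8' : D' = (outcome (some (x', g'))).2 := congrArg Prod.snd h1'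
    rw [h7, h7'] at hc
    rw [h8, h8']
    rw [← e1, ← e2] at hne
    rw [← e1, ← e2]
    exact ((hrun.verifyInv _ k).reports x E x' E' h5 h5' hne hc).imp (h6 _) (h6' _)

end Agreement
-- Confluence of execution
section Execution

variable {f : ℕ} {Client Op Res State : Type*}

theorem Slot.Before.asymm {a b : Slot f} (h : a.Before b) (h' : b.Before a) : False := by
  unfold Slot.Before at h h'
  simp only [Fin.lt_def] at h h'
  omega

theorem Slot.Before.ne {a b : Slot f} (h : a.Before b) : a ≠ b := by
  rintro rfl
  exact h.asymm h

/-- An increasing enumeration of a set of slots is unique. -/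
theorem Slot.list_eq {l l' : List (Slot f)} (h : l.Pairwise Slot.Before)
    (h' : l'.Pairwise Slot.Before) (he : ∀ x, x ∈ l ↔ x ∈ l') : l = l' := by
  have hp : l.Perm l' := (List.perm_ext_iff_of_nodup (h.imp fun h => h.ne) (h'.imp fun h => h.ne)).2 he
  exact List.Perm.eq_of_pairwise (fun a b _ _ h1 h2 => (h1.asymm h2).elim) h h' hp

/-- The part of the local state that execution acts on; replies are recorded without sender. -/
structure Exec (S : System f Client Op Res State) where
  done : Set (Slot f)
  app : State
  last : Client → WithBot ℕ
  replies : Set (Client × ℕ × Res)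

variable {S : System f Client Op Res State} (D : Slot f → Option (Decision f Client Op))

open Classical in
/-- Execute a slot. -/
noncomputable def Exec.step (X : Exec S) (s : Slot f) : Exec S :=
  match D s with
  | some (some r, _) =>
    if X.last r.client < (r.t : WithBot ℕ) then
      { done := insert s X.done
        app := (S.app.apply X.app r.op).1
        last := Function.update X.last r.client (r.t : WithBot ℕ)
        replies := insert (r.client, r.t, (S.app.apply X.app r.op).2) X.replies }
    else { X with done := insert s X.done }
  | _ => { X with done := insert s X.done }

/-- The counter of the oldest slot of a coordinator that is not in the set. -/
noncomputable def rootOf (done : Set (Slot f)) (c : Replica f) : ℕ := sInf {n | (⟨c, n⟩ : Slot f) ∉ done}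

/-- The slots with decisions `D` in `C` form a strongly connected component of the dependency graph
within the windows from which no other one is reachable. -/
structure IsComp (k : ℕ) (done C : Set (Slot f)) : Prop where
  finite : done.Finite
  nonempty : C.Nonempty
  undone : ∀ x ∈ C, x ∉ done
  decided : ∀ x ∈ C, D x ≠ none
  window : ∀ x ∈ C, x.sc < rootOf done x.co + k
  closed : ∀ x ∈ C, ∀ d, D x = some d → ∀ y ∉ done, y.sc < rootOf done y.co + k →
    Covers d.2 y → y ∈ C
  conn : ∀ x ∈ C, ∀ y ∈ C,
    Relation.ReflTransGen (fun a b => b ∈ C ∧ ∃ d, D a = some d ∧ Covers d.2 b) x y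

/-- Execution of a component. -/
def Exec.Move (X Y : Exec S) : Prop :=
  ∃ l : List (Slot f), l.Pairwise Slot.Before ∧ IsComp D S.k X.done {x | x ∈ l} ∧
    Y = l.foldl (Exec.step D) X

variable {D}

theorem rootOf_notMem {done : Set (Slot f)} (h : done.Finite) (c : Replica f) :
    (⟨c, rootOf done c⟩ : Slot f) ∉ done := by
  have : {n | (⟨c, n⟩ : Slot f) ∉ done}.Nonempty := by
    by_contra he
    rw [Set.not_nonempty_iff_eq_empty] at he
    have h1 : ∀ n, (⟨c, n⟩ : Slot f) ∈ done := fun n => by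
      by_contra hn
      have : n ∈ {n | (⟨c, n⟩ : Slot f) ∉ done} := hn
      rw [he] at this
      exact this
    have h2 : (Set.range fun n => (⟨c, n⟩ : Slot f)) ⊆ done := by
      rintro _ ⟨n, rfl⟩
      exact h1 n
    have h3 : Function.Injective fun n => (⟨c, n⟩ : Slot f) := fun a b h => by simpa using h
    exact Set.infinite_range_of_injective h3 (h.subset h2)
  exact Nat.sInf_mem this

theorem rootOf_le {done : Set (Slot f)} {s : Slot f} (h : s ∉ done) : rootOf done s.co ≤ s.sc :=
  Nat.sInf_le h

theorem rootOf_mono {done done' : Set (Slot f)} (h : done ⊆ done') (hf : done'.Finite)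
    (c : Replica f) : rootOf done c ≤ rootOf done' c :=
  rootOf_le (s := ⟨c, _⟩) fun hm => rootOf_notMem hf c (h hm)

theorem mem_of_lt_rootOf {done : Set (Slot f)} {s : Slot f} (h : s.sc < rootOf done s.co) :
    s ∈ done := by
  by_contra hn
  exact absurd (rootOf_le hn) (by omega)

/-- Two components are equal or disjoint. -/
theorem IsComp.eq_of_mem {k : ℕ} {done C C' : Set (Slot f)} (h : IsComp D k done C)
    (h' : IsComp D k done C') {x : Slot f} (hx : x ∈ C) (hx' : x ∈ C') : C = C' := by
  have key : ∀ {C C'}, IsComp D k done C → IsComp D k done C' → x ∈ C → x ∈ C' → C ⊆ C' := by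
    intro C C' h h' hx hx' y hy
    have hxy := h.conn x hx y hy
    clear hy
    induction hxy with
    | refl => exact hx'
    | tail _ hbc ih =>
      obtain ⟨hc, d, h1, h2⟩ := hbc
      exact h'.closed _ ih d h1 _ (h.undone _ hc) (h.window _ hc) h2
  exact Set.Subset.antisymm (key h h' hx hx') (key h' h hx' hx)

/-- A component remains one after the execution of another one. -/
theorem IsComp.union {k : ℕ} (hk : 0 < k) {done C C' : Set (Slot f)} (h : IsComp D k done C)
    (h' : IsComp D k done C') (hC : C.Finite) (hd : Disjoint C C') : IsComp D k (done ∪ C) C' := by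
  have hf := h.finite.union hC
  have hroot := rootOf_mono (Set.subset_union_left (s := done) (t := C)) hf
  rw [Set.disjoint_left] at hd
  refine ⟨hf, h'.nonempty, ?_, h'.decided, ?_, ?_, h'.conn⟩
  · rintro x hx (h1 | h1)
    · exact h'.undone x hx h1
    · exact hd h1 hx
  · intro x hx
    have := h'.window x hx
    have := hroot x.co
    omega
  · intro x hx d hxd y hy hw hc
    have hy1 : y ∉ done := fun h => hy (Or.inl h)
    by_cases hw' : y.sc < rootOf done y.co + k
    · exact h'.closed x hx d hxd y hy1 hw' hc
    -- The slot `y` entered the window only because the root of its coordinator moved. Compactness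
    -- makes the old root a dependency as well, so it belongs to `C'`; but it has just been executed
    -- as part of `C`.
    · exfalso
      have h1 : (⟨y.co, rootOf done y.co⟩ : Slot f) ∈ C' := by
        refine h'.closed x hx d hxd _ (rootOf_notMem h.finite _) (by simp [hk]) ?_
        unfold Covers at hc ⊢
        simp only
        omega
      have h2 : (⟨y.co, rootOf done y.co⟩ : Slot f) ∈ done ∪ C := by
        refine mem_of_lt_rootOf ?_
        simp only
        omega
      rcases h2 with h2 | h2
      · exact rootOf_notMem h.finite _ h2
      · exact hd h2 h1

/-- Requests that do not conflict stem from different clients, so neither affects the duplicate test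
of the other, and their operations commute in effect and results. -/
theorem Exec.step_comm {a b : Slot f} (hne : ∀ r E r' E', D a = some (some r, E) →
    D b = some (some r', E') → ¬ S.app.Conflict r r') (X : Exec S) :
    (X.step D a).step D b = (X.step D b).step D a := by
  unfold Exec.step
  rcases ha : D a with _ | ⟨_ | r, E⟩ <;> rcases hb : D b with _ | ⟨_ | r', E'⟩ <;> simp only
  case some.some.some.some =>
    have hc := hne r E r' E' ha hb
    have hcl : r.client ≠ r'.client := fun e => hc (S.app.conflict_same_client _ _ e)
    obtain ⟨h1, h2, h3⟩ := S.app.commute r r' hc X.app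
    by_cases h4 : X.last r.client < (r.t : WithBot ℕ) <;>
    by_cases h5 : X.last r'.client < (r'.t : WithBot ℕ) <;>
    simp [h4, h5, hcl, hcl.symm, h1, h2, h3, Set.insert_comm, Function.update_comm]
  all_goals
    try split
    all_goals simp [Set.insert_comm, *]

theorem Exec.foldl_comm {l l' : List (Slot f)} (h : ∀ a ∈ l, ∀ b ∈ l', ∀ X : Exec S,
    (X.step D a).step D b = (X.step D b).step D a) (X : Exec S) :
    l'.foldl (Exec.step D) (l.foldl (Exec.step D) X) =
      l.foldl (Exec.step D) (l'.foldl (Exec.step D) X) := by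
  have h1 : ∀ a, (∀ b ∈ l', ∀ X : Exec S, (X.step D a).step D b = (X.step D b).step D a) →
      ∀ X : Exec S, l'.foldl (Exec.step D) (X.step D a) = (l'.foldl (Exec.step D) X).step D a := by
    intro a
    clear h
    induction l' with
    | nil => simp
    | cons b l' ih =>
      intro h X
      rw [List.foldl_cons, List.foldl_cons, h b (by simp), ih fun b hb => h b (by simp [hb])]
  induction l generalizing X with
  | nil => rfl
  | cons a l ih =>
    rw [List.foldl_cons, List.foldl_cons, ih fun a ha => h a (by simp [ha]), h1 a (h a (by simp))]

theorem Exec.step_done (X : Exec S) (s : Slot f) : (X.step D s).done = insert s X.done := by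
  unfold Exec.step
  split
  · split <;> rfl
  · rfl

theorem Exec.foldl_done (l : List (Slot f)) (X : Exec S) :
    (l.foldl (Exec.step D) X).done = X.done ∪ {x | x ∈ l} := by
  induction l generalizing X with
  | nil => simp
  | cons s l ih =>
    rw [List.foldl_cons, ih, Exec.step_done]
    ext x
    simp
    tauto

/-- Execution orders do not matter. -/
theorem Exec.Move.confluent (hD : ∀ s s' r r' E E', D s = some (some r, E) →
    D s' = some (some r', E') → s ≠ s' → S.app.Conflict r r' → Covers E s' ∨ Covers E' s)
    {X Y Z : Exec S} (hY : Relation.ReflTransGen (Exec.Move D) X Y)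
    (hZ : Relation.ReflTransGen (Exec.Move D) X Z) :
    ∃ W, Relation.ReflTransGen (Exec.Move D) Y W ∧ Relation.ReflTransGen (Exec.Move D) Z W := by
  refine Relation.church_rosser (fun X Y Z hY hZ => ?_) hY hZ
  obtain ⟨l, hl, hc, rfl⟩ := hY
  obtain ⟨l', hl', hc', rfl⟩ := hZ
  by_cases hd : Disjoint {x | x ∈ l} {x | x ∈ l'}
  · have hd' := hd
    rw [Set.disjoint_left] at hd'
    refine ⟨l'.foldl (Exec.step D) (l.foldl (Exec.step D) X), .single ⟨l', hl', ?_, rfl⟩,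
      .single ⟨l, hl, ?_, ?_⟩⟩
    · rw [Exec.foldl_done]
      exact hc.union S.k_pos hc' l.finite_toSet hd
    · rw [Exec.foldl_done]
      exact hc'.union S.k_pos hc l'.finite_toSet hd.symm
    -- A conflict between the components would be a dependency in one direction, and closedness
    -- would put a slot into both.
    · refine Exec.foldl_comm (fun a ha b hb X' => Exec.step_comm (fun r E r' E' h1 h2 h3 => ?_) X') X
      rcases hD a b r r' E E' h1 h2 (fun e => hd' ha (e ▸ hb)) h3 with h4 | h4
      · exact hd' (hc.closed a ha _ h1 b (hc'.undone b hb) (hc'.window b hb) h4) hb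
      · exact hd' ha (hc'.closed b hb _ h2 a (hc.undone a ha) (hc.window a ha) h4)
  · obtain ⟨x, hx, hx'⟩ := Set.not_disjoint_iff.1 hd
    have h1 := hc.eq_of_mem hc' hx hx'
    obtain rfl := Slot.list_eq hl hl' fun x => Set.ext_iff.1 h1 x
    exact ⟨_, .refl, .refl⟩

variable (D) in
/-- Each timestamp of a client is answered at most once, and the last one is answered. -/
structure Exec.Inv (X : Exec S) : Prop where
  le : ∀ (c : Client) (t : ℕ) (u : Res), (c, t, u) ∈ X.replies → ((t : ℕ) : WithBot ℕ) ≤ X.last c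
  unique : ∀ c t u u', (c, t, u) ∈ X.replies → (c, t, u') ∈ X.replies → u = u'
  done : ∀ s ∈ X.done, ∀ r E, D s = some (some r, E) → (r.t : WithBot ℕ) ≤ X.last r.client
  last : ∀ (c : Client) (t : ℕ), X.last c = ((t : ℕ) : WithBot ℕ) → (∃ u, (c, t, u) ∈ X.replies) ∧
    ∃ s r E, D s = some (some r, E) ∧ r.client = c ∧ r.t = t

theorem Exec.Inv.step {X : Exec S} (I : X.Inv D) (s : Slot f) : (X.step D s).Inv D := by
  unfold Exec.step
  split
  · next r E hs =>
    split
    · next h =>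
      constructor
      · intro c t u hm
        simp only [Function.update_apply]
        rcases hm with hm | hm
        · obtain ⟨rfl, rfl, rfl⟩ := hm
          simp
        · split
          · next e =>
            subst e
            exact (I.le _ _ _ hm).trans h.le
          · exact I.le _ _ _ hm
      · intro c t u u' hm hm'
        rcases hm with hm | hm <;> rcases hm' with hm' | hm'
        · simp_all
        · obtain ⟨rfl, rfl, rfl⟩ := hm
          exact absurd h (not_lt.2 (I.le _ _ _ hm'))
        · obtain ⟨rfl, rfl, rfl⟩ := hm'
          exact absurd h (not_lt.2 (I.le _ _ _ hm))
        · exact I.unique _ _ _ _ hm hm'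
      · intro s' hs' r' E' h'
        simp only [Function.update_apply]
        split
        · next e =>
          rcases hs' with rfl | hs'
          · rw [hs] at h'
            cases h'
            exact le_rfl
          · exact ((I.done s' hs' r' E' h').trans (by rw [e])).trans h.le
        · next e =>
          rcases hs' with rfl | hs'
          · rw [hs] at h'
            cases h'
            exact absurd rfl e
          · exact I.done s' hs' r' E' h'
      · intro c t hc
        simp only [Function.update_apply] at hc
        split at hc
        · next e =>
          subst e
          obtain rfl : r.t = t := by exact_mod_cast hc
          exact ⟨⟨_, Set.mem_insert _ _⟩, s, r, E, hs, rfl, rfl⟩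
        · obtain ⟨⟨u, h1⟩, h2⟩ := I.last c t hc
          exact ⟨⟨u, Set.mem_insert_of_mem _ h1⟩, h2⟩
    · next h =>
      refine ⟨I.le, I.unique, ?_, I.last⟩
      rintro s' (rfl | hs') r' E' h'
      · rw [hs] at h'
        cases h'
        exact not_lt.1 h
      · exact I.done s' hs' r' E' h'
  · next hs =>
    refine ⟨I.le, I.unique, ?_, I.last⟩
    rintro s' (rfl | hs') r' E' h'
    · exact (hs _ _ h').elim
    · exact I.done s' hs' r' E' h'

theorem Exec.Inv.foldl {X : Exec S} (I : X.Inv D) (l : List (Slot f)) :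
    (l.foldl (Exec.step D) X).Inv D := by
  induction l generalizing X with
  | nil => exact I
  | cons s l ih => exact ih (I.step s)

theorem Exec.step_replies (X : Exec S) (s : Slot f) : X.replies ⊆ (X.step D s).replies := by
  unfold Exec.step
  split
  · split
    · exact Set.subset_insert _ _
    · exact subset_rfl
  · exact subset_rfl

theorem Exec.foldl_replies (X : Exec S) (l : List (Slot f)) :
    X.replies ⊆ (l.foldl (Exec.step D) X).replies := by
  induction l generalizing X with
  | nil => exact subset_rfl
  | cons s l ih => exact (X.step_replies s).trans (ih _)

theorem Exec.Inv.moves {X Y : Exec S} (I : X.Inv D) (h : Relation.ReflTransGen (Exec.Move D) X Y) :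
    Y.Inv D ∧ X.replies ⊆ Y.replies := by
  induction h with
  | refl => exact ⟨I, subset_rfl⟩
  | tail _ h ih =>
    obtain ⟨l, -, -, rfl⟩ := h
    exact ⟨ih.1.foldl l, ih.2.trans (Exec.foldl_replies _ _)⟩

/-! ### Execution in a run -/

/-- The execution state of a replica. -/
def Local.exec (me : Replica f) (L : Local S) : Exec S where
  done := L.done
  app := L.app
  last := L.last
  replies := {x | Msg.reply me x.1 x.2.1 x.2.2 ∈ L.sent}

theorem Local.execSlot_dec (me : Replica f) (L : Local S) (s : Slot f) :
    (Local.execSlot me L s).dec = L.dec := by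
  unfold Local.execSlot
  split
  · split <;> rfl
  · rfl

theorem Local.exec_execSlot (me : Replica f) (L : Local S) (s : Slot f) (h : L.dec s = D s) :
    (Local.execSlot me L s).exec me = (L.exec me).step D s := by
  unfold Local.execSlot Exec.step
  rw [h]
  rcases D s with _ | ⟨_ | r, E⟩
  · rfl
  · rfl
  · dsimp only
    by_cases hlt : L.last r.client < (r.t : WithBot ℕ)
    · rw [if_pos hlt, if_pos (show (L.exec me).last r.client < _ from hlt)]
      simp only [Local.exec, Local.send, Exec.mk.injEq, true_and]
      ext ⟨c, t, u⟩
      simp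
    · rw [if_neg hlt, if_neg (show ¬ (L.exec me).last r.client < _ from hlt)]
      rfl

theorem Local.exec_foldl (me : Replica f) (l : List (Slot f)) (L : Local S)
    (h : ∀ s ∈ l, L.dec s = D s) :
    (l.foldl (Local.execSlot me) L).exec me = l.foldl (Exec.step D) (L.exec me) := by
  induction l generalizing L with
  | nil => rfl
  | cons s l ih =>
    rw [List.foldl_cons, List.foldl_cons, ih, Local.exec_execSlot me L s (h s (by simp))]
    intro s' hs'
    rw [Local.execSlot_dec]
    exact h s' (by simp [hs'])

/-- The part of the dependency graph within `W` that starts at `a` can be executed. -/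
structure Local.Ready (L : Local S) (W : Slot f → Prop) (a : Slot f) : Prop where
  window : ∀ b, L.InWindow b → W b
  undone : a ∉ L.done
  reach : ∀ b, L.Reach W a b → L.dec b ≠ none ∧ L.InWindow b

theorem Local.Executable.ready {L : Local S} {a : Slot f} (h : L.Executable a) :
    L.Ready (fun _ => True) a :=
  ⟨fun _ _ => trivial, h.1, h.2⟩

theorem Local.Unblockable.ready {L : Local S} (hf : L.done.Finite) {a : Slot f}
    (h : L.Unblockable a) : L.Ready L.InWindow a := by
  have ha : a = ⟨a.co, L.root a.co⟩ := by
    rw [← h.1]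
  refine ⟨fun _ => id, ?_, fun b hb => ⟨h.2 b hb, ?_⟩⟩
  · rw [ha]
    exact rootOf_notMem hf _
  · rcases Relation.ReflTransGen.cases_tail hb with rfl | ⟨c, -, h1⟩
    · unfold Local.InWindow
      rw [h.1]
      have := S.k_pos
      omega
    · exact h1.2.1

/-- This treats both execution rules alike. In regular execution the graph is not restricted, but
everything reachable lies in the windows; so in both cases the list is a terminal component of the
graph within the windows. -/
theorem Local.Ready.isComp {L : Local S} (hf : L.done.Finite)
    (hD : ∀ s d, L.dec s = some d → D s = some d) {W : Slot f → Prop} {a : Slot f}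
    (h : L.Ready W a) {l : List (Slot f)} (hl : L.FirstComponent W a l) :
    IsComp D S.k L.done {x | x ∈ l} ∧ ∀ x ∈ l, L.dec x = D x := by
  obtain ⟨b, hab, hback, hmem, -⟩ := hl
  have hdec : ∀ x ∈ l, L.dec x ≠ none ∧ L.InWindow x := fun x hx =>
    h.reach x (hab.trans ((hmem x).1 hx))
  have hDd : ∀ x ∈ l, L.dec x = D x := fun x hx => by
    obtain ⟨d, hd⟩ := Option.ne_none_iff_exists'.1 (hdec x hx).1
    rw [hd, hD x d hd]
  have hclosed : ∀ x, L.Reach W b x → ∀ y, L.Edge W x y → y ∈ l := fun x hx y hy =>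
    (hmem y).2 (hx.tail hy)
  refine ⟨⟨hf, ⟨b, (hmem b).2 .refl⟩, ?_, ?_, fun x hx => (hdec x hx).2, ?_, ?_⟩, hDd⟩
  · intro x hx
    rcases Relation.ReflTransGen.cases_tail (hab.trans ((hmem x).1 hx)) with rfl | ⟨c, -, h1⟩
    · exact h.undone
    · exact h1.1
  · intro x hx
    rw [← hDd x hx]
    exact (hdec x hx).1
  · intro x hx d hd y hy hw hc
    rw [← hDd x hx] at hd
    exact hclosed x ((hmem x).1 hx) y ⟨hy, h.window y hw, d, hd, hc⟩
  · intro x hx y hy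
    have hxy : L.Reach W x y := (hback x ((hmem x).1 hx)).trans ((hmem y).1 hy)
    have hbx := (hmem x).1 hx
    clear hy
    induction hxy with
    | refl => exact .refl
    | tail h1 h2 ih =>
      refine ih.tail ⟨hclosed _ (hbx.trans h1) _ h2, ?_⟩
      obtain ⟨-, -, d, h3, h4⟩ := h2
      exact ⟨d, hD _ _ h3, h4⟩

/-- Actions other than execution do not change the execution state. -/
theorem Act.exec_state {me : Replica f} {now : ℝ} {L L' : Local S} (h : Act S me now L L')
    (hf : L.done.Finite) : L'.exec me = L.exec me ∨
    ∃ W a l, L.Ready W a ∧ L.FirstComponent W a l ∧ L' = l.foldl (Local.execSlot me) L := by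
  cases h with
  | execRegular a l ha hl => exact Or.inr ⟨_, a, l, ha.ready, hl, rfl⟩
  | execUnblock a l _ ha hl => exact Or.inr ⟨_, a, l, ha.ready hf, hl, rfl⟩
  | _ =>
    left
    first
      | rfl
      | simp [Local.exec, Local.send, Local.enterView]

end Execution

/-! ### Uniqueness of replies -/

section Runs

variable {f : ℕ} {Client Op Res State : Type*} {S : System f Client Op Res State}
  {G : ℕ → Global S}

open Classical in
/-- The decisions made in a run. -/
noncomputable def decisions (G : ℕ → Global S) (s : Slot f) : Option (Decision f Client Op) :=
  if h : ∃ d n i, i ∉ S.byz ∧ ((G n).loc i).dec s = some d then some h.choose else none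

theorem IsRun.decisions_eq (hrun : IsRun G) {n : ℕ} {i : Replica f} (hi : i ∉ S.byz) {s : Slot f}
    {d : Decision f Client Op} (h : ((G n).loc i).dec s = some d) : decisions G s = some d := by
  have h1 : ∃ d n i, i ∉ S.byz ∧ ((G n).loc i).dec s = some d := ⟨d, n, i, hi, h⟩
  unfold decisions
  rw [dif_pos h1]
  obtain ⟨m, j, hj, h2⟩ := h1.choose_spec
  rw [hrun.dec_unique hj hi h2 h]

theorem exists_of_decisions {s : Slot f} {d : Decision f Client Op} (h : decisions G s = some d) :
    ∃ n i, i ∉ S.byz ∧ ((G n).loc i).dec s = some d := by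
  unfold decisions at h
  split at h
  · next h1 =>
    cases h
    exact h1.choose_spec
  · cases h

theorem IsRun.decisions_conflict (hrun : IsRun G) (s s' : Slot f) (r r' : Req Client Op)
    (E E' : Deps f) (h : decisions G s = some (some r, E)) (h' : decisions G s' = some (some r', E'))
    (hne : s ≠ s') (hc : S.app.Conflict r r') : Covers E s' ∨ Covers E' s := by
  obtain ⟨n, i, hi, h1⟩ := exists_of_decisions h
  obtain ⟨m, j, hj, h2⟩ := exists_of_decisions h'
  exact hrun.covers_of_conflict hi hj h1 h2 hne hc

def Exec.start (S : System f Client Op Res State) : Exec S := ⟨∅, S.app.start, fun _ => ⊥, ∅⟩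

theorem Exec.Inv.start (D : Slot f → Option (Decision f Client Op)) : (Exec.start S).Inv D := by
  constructor <;> simp [Exec.start]

/-- The moves refer to the decisions of the whole run instead of those known to replica `i` so far.
The execution states of all replicas thus live in one confluent system with a common start. -/
theorem IsRun.exec (hrun : IsRun G) (n : ℕ) (i : Replica f) :
    ((G n).loc i).done.Finite ∧
      Relation.ReflTransGen (Exec.Move (decisions G)) (Exec.start S) (((G n).loc i).exec i) := by
  induction n with
  | zero =>
    rw [hrun.start]
    have : ((Global.start S).loc i).exec i = Exec.start S := by
      simp [Local.exec, Exec.start, Global.start, Local.start]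
    rw [this]
    exact ⟨Set.finite_empty, .refl⟩
  | succ n ih =>
    rcases hrun.loc_step n i with h | ⟨hi, -, h⟩ | ⟨-, -, m, -, h⟩
    · rwa [h]
    · rcases h.exec_state ih.1 with h1 | ⟨W, a, l, h1, h2, h3⟩
      · refine ⟨?_, h1 ▸ ih.2⟩
        have h2 : ((G (n + 1)).loc i).done = ((G n).loc i).done := congrArg Exec.done h1
        rw [h2]
        exact ih.1
      · obtain ⟨h4, h5⟩ := h1.isComp ih.1 (fun s d hd => hrun.decisions_eq hi hd) h2
        rw [h3]
        refine ⟨?_, ih.2.tail ⟨l, ?_, h4, Local.exec_foldl i l _ h5⟩⟩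
        · obtain ⟨A, T, R, -, -, he⟩ := foldl_execSlot i l ((G n).loc i)
          rw [he]
          exact ih.1.union l.finite_toSet
        · obtain ⟨b, -, -, -, h6⟩ := h2
          exact h6
    · rw [h]
      exact ih

theorem IsRun.execInv (hrun : IsRun G) (n : ℕ) (i : Replica f) :
    (((G n).loc i).exec i).Inv (decisions G) :=
  ((Exec.Inv.start _).moves (hrun.exec n i).2).1

/-- Replies of correct replicas match. -/
theorem IsRun.reply_unique (hrun : IsRun G) {n m : ℕ} {i j : Replica f} {c : Client} {t : ℕ}
    {u u' : Res} (h : Msg.reply i c t u ∈ ((G n).loc i).sent)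
    (h' : Msg.reply j c t u' ∈ ((G m).loc j).sent) : u = u' := by
  obtain ⟨W, h1, h2⟩ := Exec.Move.confluent hrun.decisions_conflict (hrun.exec n i).2
    (hrun.exec m j).2
  have h3 := (hrun.execInv n i).moves h1
  have h4 := (hrun.execInv m j).moves h2
  exact h3.1.unique c t u u' (h3.2 h) (h4.2 h')

end Runs
-- Time, states without enabled actions, and message delivery
section Time

variable {f : ℕ} {Client Op Res State : Type*} {S : System f Client Op Res State}
  {G : ℕ → Global S}

/-- No correct replica can act at time `τ`. -/
def Global.Quiet (G : Global S) (τ : ℝ) : Prop := ∀ i ∉ S.byz, ∀ L, ¬ Act S i τ (G.loc i) L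

theorem IsRun.now_nonneg (hrun : IsRun G) (n : ℕ) : 0 ≤ (G n).now := by
  have := (hrun.le (Nat.zero_le n)).now
  rwa [hrun.start] at this

/-- At every time a state is reached in which no correct party can act. -/
theorem IsRun.exists_quiet (hrun : IsRun G) {n : ℕ} {τ : ℝ} (h : (G n).now ≤ τ) :
    ∃ m ≥ n, (G m).now ≤ τ ∧ (G m).Quiet τ ∧
      ∀ c ∈ S.goodClient, ∀ r, ¬ (G m).MustResend c r τ := by
  obtain ⟨N, hN⟩ := hrun.unbounded τ
  -- This is the step in which the clock passes `τ`. It must be a tick, and its guards exclude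
  -- enabled actions at every instant up to the new time, in particular at `τ`.
  obtain ⟨k, -, h1, h2⟩ := exists_step (p := fun k => τ < (G (n + k)).now) (n := N)
    (by simpa using h) (hN.trans_le (hrun.le (Nat.le_add_left N n)).now)
  rw [not_lt] at h1
  refine ⟨n + k, by omega, h1, ?_⟩
  have h3 := hrun.next (n + k)
  rw [← add_assoc] at h2
  generalize G (n + k + 1) = G' at h2 h3
  cases h3 with
  | tick t' ht hact hcl =>
    exact ⟨fun i hi L => hact i hi τ h1 h2 L, fun c hc r => hcl c hc τ h1 h2 r⟩
  | _ => exact absurd h2 (not_lt.2 h1)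

/-- From some state on that is reached before time `a`, `P` holds. -/
def Before (G : ℕ → Global S) (a : ℝ) (P : Global S → Prop) : Prop :=
  ∃ n, (G n).now < a ∧ ∀ m ≥ n, P (G m)

variable {a b : ℝ} {P Q : Global S → Prop}

theorem IsRun.before (hrun : IsRun G) {n : ℕ} (h : (G n).now < a)
    (hP : ∀ G', (G n).Le G' → P G') : Before G a P :=
  ⟨n, h, fun _ hm => hP _ (hrun.le hm)⟩

theorem Before.mono (h : Before G a P) (hab : a ≤ b) (hP : ∀ G, P G → Q G) : Before G b Q := by
  obtain ⟨n, h1, h2⟩ := h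
  exact ⟨n, h1.trans_le hab, fun m hm => hP _ (h2 m hm)⟩

theorem Before.and (h : Before G a P) (h' : Before G a Q) : Before G a fun G => P G ∧ Q G := by
  obtain ⟨n, h1, h2⟩ := h
  obtain ⟨m, h3, h4⟩ := h'
  rcases le_total n m with h5 | h5
  · exact ⟨m, h3, fun k hk => ⟨h2 k (h5.trans hk), h4 k hk⟩⟩
  · exact ⟨n, h1, fun k hk => ⟨h2 k hk, h4 k (h5.trans hk)⟩⟩

theorem IsRun.before_true (hrun : IsRun G) (ha : 0 < a) : Before G a fun _ => True :=
  ⟨0, by rw [hrun.start]; exact ha, fun _ _ => trivial⟩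

theorem IsRun.before_all (hrun : IsRun G) (ha : 0 < a) {ι : Type*} [Finite ι]
    {P : ι → Global S → Prop} (h : ∀ i, Before G a (P i)) : Before G a fun G => ∀ i, P i G := by
  have := Fintype.ofFinite ι
  classical
  have key : ∀ A : Finset ι, Before G a fun G => ∀ i ∈ A, P i G := by
    intro A
    induction A using Finset.induction_on with
    | empty => exact (hrun.before_true ha).mono le_rfl (by simp)
    | insert i A _ ih =>
      refine ((h i).and ih).mono le_rfl fun G hG => ?_
      simpa using hG
  exact (key Finset.univ).mono le_rfl fun G hG i => hG i (Finset.mem_univ i)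

theorem IsRun.before_correct (hrun : IsRun G) (ha : 0 < a) {P : Replica f → Global S → Prop}
    (h : ∀ i ∉ S.byz, Before G a (P i)) : Before G a fun G => ∀ i ∉ S.byz, P i G := by
  refine hrun.before_all ha fun i => ?_
  by_cases hi : i ∈ S.byz
  · exact (hrun.before_true ha).mono le_rfl fun _ _ h => absurd hi h
  · exact (h i hi).mono le_rfl fun _ h _ => h

/-- Enabled actions are carried out before time moves on, so such a state is reached without missing
the deadline. To show that an action was performed in time, it then suffices that it would be
enabled otherwise. -/
theorem Before.quiet (hrun : IsRun G) (h : Before G a P) :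
    ∃ n, (G n).now < a ∧ (∀ m ≥ n, P (G m)) ∧ (G n).Quiet (G n).now := by
  obtain ⟨n, h1, h2⟩ := h
  obtain ⟨m, h3, h4, h5, -⟩ := hrun.exists_quiet (le_refl (G n).now)
  have h6 : (G m).now = (G n).now := le_antisymm h4 (hrun.le h3).now
  exact ⟨m, h6 ▸ h1, fun k hk => h2 k (h3.trans hk), h6 ▸ h5⟩

theorem Before.eventually (h : Before G a P) : ∀ᶠ n in Filter.atTop, P (G n) := by
  obtain ⟨n, -, h2⟩ := h
  exact Filter.eventually_atTop.2 ⟨n, h2⟩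

theorem IsRun.eventually_now (hrun : IsRun G) (t : ℝ) : ∀ᶠ n in Filter.atTop, t < (G n).now := by
  obtain ⟨n, hn⟩ := hrun.unbounded t
  exact Filter.eventually_atTop.2 ⟨n, fun m hm => hn.trans_le (hrun.le hm).now⟩

theorem IsRun.frequently_quiet (hrun : IsRun G) :
    ∃ᶠ n in Filter.atTop, (G n).Quiet (G n).now ∧
      ∀ c ∈ S.goodClient, ∀ r, ¬ (G n).MustResend c r (G n).now := by
  refine Filter.frequently_atTop.2 fun n => ?_
  obtain ⟨m, h3, h4, h5, h6⟩ := hrun.exists_quiet (le_refl (G n).now)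
  have h7 : (G m).now = (G n).now := le_antisymm h4 (hrun.le h3).now
  exact ⟨m, h3, h7 ▸ h5, h7 ▸ h6⟩

/-- All messages between correct replicas that are sent until time `T` arrive before `T + Δ`, and
later ones within `Δ`. -/
def Delivers (G : ℕ → Global S) (T : ℝ) : Prop :=
  ∀ i ∉ S.byz, ∀ j ∉ S.byz, ∀ n, ∀ m ∈ ((G n).loc i).sent, ∀ a, (G n).now + S.Δ ≤ a → T + S.Δ ≤ a →
    Before G a fun G => m ∈ (G.loc j).rcv

/-- Up to some moment after `T` only finitely many messages have been sent, so all of them have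
arrived by a common later time, which serves as `T'`. Messages sent afterwards obey the bound `Δ`.
-/
theorem IsRun.exists_delivers (hrun : IsRun G) (hrel : Reliable G) {T : ℝ}
    (hsync : SynchronousFrom G T) : ∃ T', 0 ≤ T' ∧ Delivers G T' := by
  obtain ⟨N, hN⟩ := hrun.unbounded T
  have h1 : ∀ᶠ n in Filter.atTop, ∀ i, i ∉ S.byz → ∀ j, j ∉ S.byz → ∀ m ∈ ((G N).loc i).sent,
      m ∈ ((G n).loc j).rcv := by
    refine Filter.eventually_all.2 fun i => ?_
    refine Filter.eventually_imp_distrib_left.2 fun hi => ?_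
    refine Filter.eventually_all.2 fun j => ?_
    refine Filter.eventually_imp_distrib_left.2 fun hj => ?_
    refine (Filter.eventually_all_finite (hrun.headerInv N i).finite_sent.1).2 fun m hm => ?_
    obtain ⟨n, hn⟩ := hrel.replicas i hi j hj N m hm
    exact Filter.eventually_atTop.2 ⟨n, fun k hk => ((hrun.le hk).loc j).rcv hn⟩
  obtain ⟨M, hM⟩ := h1.exists
  refine ⟨(G M).now, hrun.now_nonneg M, fun i hi j hj n m hm a ha ha' => ?_⟩
  by_cases h2 : m ∈ ((G N).loc i).sent
  · refine hrun.before (n := M) (by linarith [S.Δ_pos]) fun G' hle => ?_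
    exact (hle.loc j).rcv (hM i hi j hj m h2)
  · obtain ⟨k, h3, h4, h5⟩ := exists_step (p := fun k => m ∈ ((G k).loc i).sent) (n := n)
      (by rw [hrun.start]; exact Set.notMem_empty m) hm
    have hk : N ≤ k + 1 := by
      by_contra hk
      exact h2 (((hrun.le (by omega : k + 1 ≤ N)).loc i).sent h5)
    obtain ⟨n', h6, h7⟩ := hsync i hi j hj k m h4 h5 (hN.le.trans (hrun.le hk).now)
    have h8 := (hrun.le (by omega : k + 1 ≤ n)).now
    exact hrun.before (n := n') (by linarith) fun G' hle => (hle.loc j).rcv h7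

theorem Delivers.eventually {T : ℝ} (hd : Delivers G T) {i j : Replica f} (hi : i ∉ S.byz)
    (hj : j ∉ S.byz) {n : ℕ} {m : Msg f Client Op Res} (hm : m ∈ ((G n).loc i).sent) :
    ∀ᶠ k in Filter.atTop, m ∈ ((G k).loc j).rcv :=
  (hd i hi j hj n m hm (max (G n).now T + S.Δ) (by gcongr; exact le_max_left _ _)
    (by gcongr; exact le_max_right _ _)).eventually

end Time

/-! ### Spreading the start of an agreement -/

section Initiation

variable {f : ℕ} {Client Op Res State : Type*} {S : System f Client Op Res State}
  {G : ℕ → Global S} {s : Slot f}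

/-- A replica whose commit timer was started or that left the initial view knows that the agreement
on the slot was started. -/
theorem IsRun.accepts (hrun : IsRun G) (n : ℕ) (i : Replica f) (s : Slot f) :
    (((G n).loc i).comT s ≠ none → ((G n).loc i).Accepts s) ∧
      (((G n).loc i).view s ≠ 0 → ((G n).loc i).Accepts s) := by
  induction n with
  | zero =>
    rw [hrun.start]
    simp [Global.start, Local.start]
  | succ n ih =>
    have hle := (hrun.le_succ n).loc i
    rcases hrun.loc_step n i with h | ⟨-, -, h⟩ | ⟨-, -, m, -, h⟩
    · rwa [h]
    · constructor
      · intro hT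
        obtain ⟨τ, hτ⟩ := Option.ne_none_iff_exists'.1 hT
        rcases (h.comT_cases hτ).2 with h1 | ⟨-, -, h1 | h1⟩ | ⟨-, h1, -, val, vcs, h2, h3⟩
        · exact hle.accepts (ih.1 (by simp [h1]))
        · exact Or.inl h1
        · exact hle.accepts (Or.inr (Or.inl h1.2))
        · exact hle.accepts (ih.2 ((hrun.verifyInv n i).viewChange_view s h1))
      · intro hv
        rcases h.view_cases s with h1 | ⟨-, -, ⟨-, τ, -, -, h1⟩ | h1⟩
        · exact hle.accepts (ih.2 (h1 ▸ hv))
        · rcases h1 with h1 | ⟨h1, h2⟩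
          · exact hle.accepts (ih.1 (by simp [h1]))
          · exact hle.accepts (ih.2 ((hrun.verifyInv n i).viewChange_view s h1))
        · exact hle.accepts (Or.inr (Or.inr (h1.mono le_rfl fun j ⟨w, c, _, h2⟩ => ⟨w, c, h2⟩)))
    · have h1 : (G (n + 1)).loc i = { (G n).loc i with rcv := insert m ((G n).loc i).rcv } := h
      have h2 : ((G (n + 1)).loc i).comT = ((G n).loc i).comT := by rw [h1]
      have h3 : ((G (n + 1)).loc i).view = ((G n).loc i).view := by rw [h1]
      rw [h2, h3]
      exact ⟨fun h => hle.accepts (ih.1 h), fun h => hle.accepts (ih.2 h)⟩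

theorem IsRun.propT_le (hrun : IsRun G) (n : ℕ) (i : Replica f) (x : Header f Client Op) (τ : ℝ)
    (hτ : ((G n).loc i).propT x = some τ) : τ ≤ (G n).now + 2 * S.Δ := by
  induction n with
  | zero =>
    rw [hrun.start] at hτ
    simp [Global.start, Local.start] at hτ
  | succ n ih =>
    have hle := hrun.le_succ n
    have hn := hle.now
    rcases hrun.loc_step n i with h | ⟨-, -, h⟩ | ⟨-, -, m, -, h⟩
    · rw [h] at hτ
      linarith [ih hτ]
    · rcases h.propT_cases (x := x) (by simp [hτ]) with h1 | h1
      · obtain ⟨τ', h2⟩ := Option.ne_none_iff_exists'.1 h1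
        have h3 := (hle.loc i).propT _ _ h2
        rw [hτ] at h3
        cases h3
        linarith [ih h2]
      · rw [hτ] at h1
        have := Option.some.inj h1.1
        linarith
    · rw [h] at hτ
      linarith [ih hτ]

/-- The faulty coordinator is not among its followers, so at most `f - 1` of these `2f` are faulty.
-/
theorem System.quorum_correct (S : System f Client Op Res State) {x : Header f Client Op} (hF : ValidQuorum x) (hco : x.slot.co ∈ S.byz) :
    AtLeast (f + 1) fun i => i ∈ x.F ∧ i ∉ S.byz := by
  refine ⟨x.F \ S.byz, ?_, by simp⟩
  have h1 : x.F ∩ S.byz ⊆ S.byz.erase x.slot.co := by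
    intro i hi
    rw [Finset.mem_inter] at hi
    exact Finset.mem_erase.2 ⟨fun e => hF.2 (e ▸ hi.1), hi.2⟩
  have h2 := Finset.card_le_card h1
  rw [Finset.card_erase_of_mem hco] at h2
  have h3 := Finset.card_sdiff_add_card_inter x.F S.byz
  have h4 := S.byz_card
  have h5 : 0 < S.byz.card := Finset.card_pos.2 ⟨_, hco⟩
  have := hF.1
  omega

/-- The replica takes part in the agreement on the slot. -/
def Local.Started (L : Local S) (s : Slot f) : Prop :=
  L.hdr s ≠ none ∨ (AtLeast (f + 1) fun i => ∃ h D, h.slot = s ∧ Msg.verify i h D ∈ L.rcv) ∨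
    L.view s ≠ 0

theorem Local.Le.started {L L' : Local S} (h : L.Le L') (hs : L.Started s) : L'.Started s := by
  rcases hs with hs | hs | hs
  · obtain ⟨x, hx⟩ := Option.ne_none_iff_exists'.1 hs
    exact Or.inl (by simp [h.hdr _ _ hx])
  · exact Or.inr (Or.inl (hs.mono le_rfl fun i ⟨x, D, h1, h2⟩ => ⟨x, D, h1, h.rcv h2⟩))
  · exact Or.inr (Or.inr (by have := h.view s; omega))

theorem IsRun.accepts_of_started (hrun : IsRun G) {n : ℕ} {i : Replica f}
    (h : ((G n).loc i).Started s) : ((G n).loc i).Accepts s := by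
  rcases h with h | h | h
  · exact Or.inl h
  · exact Or.inr (Or.inl h)
  · exact (hrun.accepts n i s).2 h

/-- A replica that has received a DepPropose and accepted all that it depends on accepts the slot. -/
theorem accepts_of_quiet {n : ℕ} {q : Replica f} (hq : q ∉ S.byz)
    (hQ : (G n).Quiet (G n).now) {x : Header f Client Op}
    (hrcv : Msg.propose x ∈ ((G n).loc q).rcv ∨ Msg.fwd x ∈ ((G n).loc q).rcv)
    (hF : ValidQuorum x) (hco : q ≠ x.slot.co) (hwait : ((G n).loc q).WaitOK x.D)
    (hgap : ∀ k, x.slot.sc = k + 1 → ((G n).loc q).Accepts ⟨x.slot.co, k⟩) :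
    ((G n).loc q).view x.slot = 0 ∧ ((G n).loc q).hdr x.slot ≠ none ∨
      ((G n).loc q).view x.slot ≠ 0 := by
  by_cases hv : ((G n).loc q).view x.slot = 0
  · left
    refine ⟨hv, fun hh => ?_⟩
    by_cases hT : ((G n).loc q).propT x = none
    · exact hQ q hq _ (Act.startProposeTimer _ x hrcv hco hv hT)
    · exact hQ q hq _ (Act.acceptPropose _ x hrcv hco hv hT hh hF hwait hgap)
  · exact Or.inr hv

/-- If a correct replica has accepted a DepPropose of a slot, soon all of them take part in
the agreement on this slot. -/
theorem IsRun.before_started (hrun : IsRun G) {T : ℝ} (hT : 0 ≤ T) (hd : Delivers G T) (n : ℕ)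
    (hs : (G n).Known s) {q : Replica f} (hq : q ∉ S.byz) {a : ℝ}
    (ha : (G n).now + 3 * S.Δ ≤ a) (haT : T + 3 * S.Δ ≤ a) :
    Before G a fun G => (G.loc q).Started s := by
  have hΔ := S.Δ_pos
  -- The induction is over the states of the run with the deadline `a` fixed. Dependencies and the
  -- predecessor of a newly known slot were known one state earlier and are accepted before the same
  -- `a`; therefore the delays do not add up along dependency chains.
  induction n generalizing s q with
  | zero =>
    obtain ⟨i, hi, h⟩ := hs
    rw [hrun.start] at h
    exact absurd rfl h
  | succ n ih =>
    have hle := hrun.le_succ n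
    have hnow := hle.now
    have ih' : ∀ {s q}, (G n).Known s → q ∉ S.byz → Before G a fun G => (G.loc q).Accepts s := by
      intro s q hs hq
      obtain ⟨m, h1, h2⟩ := ih hs hq (by linarith)
      exact ⟨m, h1, fun k hk => hrun.accepts_of_started (h2 k hk)⟩
    by_cases hs' : (G n).Known s
    · exact ih hs' hq (by linarith)
    by_cases hqs : q = s.co
    · have h1 := hrun.lt_of_known (hqs ▸ hq) hs
      have h2 := (hrun.headerInv (n + 1) s.co).mine_hdr _ h1
      obtain ⟨x, hx⟩ := Option.ne_none_iff_exists'.1 h2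
      refine hrun.before (n := n + 1) (by linarith) fun G' hle' => ?_
      have := (hle'.loc s.co).hdr _ _ hx
      subst hqs
      exact Or.inl (by simp [this])
    obtain ⟨i, hi, hx⟩ := hs
    obtain ⟨x, hx⟩ := Option.ne_none_iff_exists'.1 hx
    have hn : ((G n).loc i).hdr s = none := by
      by_contra h
      exact hs' ⟨i, hi, h⟩
    have hpos : 0 < a := by linarith
    have hact : ∃ now, Act S i now ((G n).loc i) ((G (n + 1)).loc i) := by
      rcases hrun.loc_step n i with h | ⟨-, -, h⟩ | ⟨-, -, m, -, h⟩
      · rw [h, hn] at hx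
        cases hx
      · exact ⟨_, h⟩
      · rw [h] at hx
        rw [hn] at hx
        cases hx
    obtain ⟨now, hact⟩ := hact
    have I := hrun.headerInv n i
    have I' := hrun.headerInv (n + 1) i
    obtain ⟨hxs, hF, -⟩ := I'.hdr_slot s x hx
    have hpre : ((G n).loc i).WaitOK x.D ∧ ∀ k, s.sc = k + 1 → ((G n).loc i).Accepts ⟨s.co, k⟩ := by
      rcases hact.hdr_cases hx with h1 | ⟨-, -, ⟨r, b, h3, -, h5, -⟩ | h3⟩
      · rw [hn] at h1
        cases h1
      · subst h5
        refine ⟨waitOK_conflicts r, fun k hk => Or.inl ?_⟩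
        rw [h3] at hk ⊢
        exact I.mine_hdr k (by simp only at hk; omega)
      · exact h3.2.2.2.2.2.2
    have hwait : Before G a fun G => (G.loc q).WaitOK x.D := by
      refine (hrun.before_all hpos (P := fun c G => ∀ k, x.D c = k + 1 → (G.loc q).Accepts ⟨c, k⟩)
        fun c => ?_).mono le_rfl fun _ h => h
      rcases h : x.D c with _ | k
      · exact (hrun.before_true hpos).mono le_rfl (by simp)
      · refine (ih' (hrun.known_of_accepts hi (hpre.1 c k h)) hq).mono le_rfl fun G h k' hk' => ?_
        obtain rfl : k = k' := by omega
        exact h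
    have hgap : Before G a fun G => ∀ k, s.sc = k + 1 → (G.loc q).Accepts ⟨s.co, k⟩ := by
      rcases h : s.sc with _ | k
      · exact (hrun.before_true hpos).mono le_rfl (by simp)
      · refine (ih' (hrun.known_of_accepts hi (hpre.2 k h)) hq).mono le_rfl fun G h k' hk' => ?_
        obtain rfl : k = k' := by omega
        exact h
    have hmsg : Before G a fun G => (Msg.propose x ∈ (G.loc q).rcv ∨ Msg.fwd x ∈ (G.loc q).rcv) ∨
        (G.loc q).Started s := by
      -- A faulty coordinator may have sent its DepPropose to few replicas. Within `2Δ` the follower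
      -- `i` forwards it or has collected all DepVerifys; those of the `f + 1` correct followers
      -- then reach `q` as well. One more `Δ` is needed for delivery.
      by_cases hco : s.co ∈ S.byz
      · have hne : s.co ≠ i := fun e => hi (e ▸ hco)
        obtain ⟨τ, hτ⟩ := Option.ne_none_iff_exists'.1 (I'.hdr_other s x hx hne)
        have hτ' := hrun.propT_le _ _ _ _ hτ
        obtain ⟨m, hm, h1, h2, -⟩ := hrun.exists_quiet (le_max_left (G (n + 1)).now τ)
        have h3 : (G m).now ≤ (G (n + 1)).now + 2 * S.Δ :=
          h1.trans (max_le (by linarith) hτ')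
        have hlm := (hrun.le hm).loc i
        have Im := hrun.headerInv m i
        have h4 : Msg.fwd x ∈ ((G m).loc i).sent ∨ ((G m).loc i).Collected x := by
          by_cases hv : ((G m).loc i).view x.slot = 0
          · by_contra! hc
            exact h2 i hi _ (Act.forward _ x τ (hlm.propT _ _ hτ) (le_max_right _ _) hv hc.2 hc.1)
          · exact Im.propT_leave x (by simp [hlm.propT _ _ hτ]) hv
        rcases h4 with h4 | h4
        · refine (hd i hi q hq m _ h4 a (by linarith) (by linarith)).mono le_rfl fun G h => ?_
          exact Or.inl (Or.inr h)
        · have h5 : Before G a fun G => ∀ j, j ∉ S.byz → j ∈ x.F →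
              ∃ y D, y.slot = s ∧ Msg.verify j y D ∈ (G.loc q).rcv := by
            refine hrun.before_correct hpos fun j hj => ?_
            by_cases hjF : j ∈ x.F
            · obtain ⟨D, hD⟩ := Option.ne_none_iff_exists'.1 (h4.2 j hjF)
              obtain ⟨y, h6, -, h7, -⟩ := (hrun.verifyInv m i).v_some _ _ _ hD
              have h8 : Msg.verify j y D ∈ ((G m).loc j).sent :=
                Global.Signed.sent ((hrun.genuine m i).1 _ h7) hj
              refine (hd j hj q hq m _ h8 a (by linarith) (by linarith)).mono le_rfl
                fun G h _ => ⟨y, D, ?_, h⟩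
              rw [((Im.hdr_slot _ _ h6).1), hxs]
            · exact (hrun.before_true hpos).mono le_rfl fun _ _ h => absurd h hjF
          refine h5.mono le_rfl fun G h => Or.inr (Or.inr (Or.inl ?_))
          exact (S.quorum_correct hF (hxs ▸ hco)).mono le_rfl fun j hj => h j hj.2 hj.1
      · have h1 := hrun.signedHeader hx
        unfold Global.SignedHeader at h1
        rw [hxs] at h1
        refine (hd s.co hco q hq (n + 1) _ (h1.sent hco) a (by linarith) (by linarith)).mono le_rfl
          fun G h => Or.inl (Or.inl h)
    obtain ⟨m, h1, h2, h3⟩ := ((hwait.and hgap).and hmsg).quiet hrun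
    refine hrun.before h1 fun G' hle' => (hle'.loc q).started ?_
    obtain ⟨⟨h4, h5⟩, h6⟩ := h2 m le_rfl
    rcases h6 with h6 | h6
    · subst hxs
      rcases accepts_of_quiet hq h3 h6 hF hqs h4 h5 with h | h
      · exact Or.inl h.2
      · exact Or.inr (Or.inr h)
    · exact h6

theorem IsRun.before_accepts (hrun : IsRun G) {T : ℝ} (hT : 0 ≤ T) (hd : Delivers G T) (n : ℕ)
    (hs : (G n).Known s) {q : Replica f} (hq : q ∉ S.byz) {a : ℝ}
    (ha : (G n).now + 3 * S.Δ ≤ a) (haT : T + 3 * S.Δ ≤ a) :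
    Before G a fun G => (G.loc q).Accepts s := by
  obtain ⟨m, h1, h2⟩ := hrun.before_started hT hd n hs hq ha haT
  exact ⟨m, h1, fun k hk => hrun.accepts_of_started (h2 k hk)⟩

end Initiation
-- Progress of views
section Views

variable {f : ℕ} {Client Op Res State : Type*} {S : System f Client Op Res State}
  {G : ℕ → Global S} {s : Slot f}

/-- Enough correct replicas have reached view `w`. -/
def Global.Reached (G : Global S) (s : Slot f) (w : ℕ) : Prop :=
  AtLeast (f + 1) fun i => i ∉ S.byz ∧ w ≤ (G.loc i).view s

theorem Global.Le.reached {G G' : Global S} (h : G.Le G') {w w' : ℕ} (hw : w' ≤ w)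
    (hr : G.Reached s w) : G'.Reached s w' :=
  AtLeast.mono hr le_rfl fun i hi => ⟨hi.1, hw.trans (hi.2.trans ((h.loc i).view s))⟩

theorem IsRun.reached_of_viewsReached (hrun : IsRun G) {n : ℕ} {i : Replica f} {w : ℕ}
    (h : ((G n).loc i).ViewsReached (2 * f + 1) s w) : (G n).Reached s w :=
  (AtLeast.correct S h).mono le_rfl fun _ ⟨hj, _, _, h1, h2⟩ =>
    ⟨hj, h1.trans (hrun.view_of_viewChange h2 hj).2⟩

theorem IsRun.viewsReached_of_newView (hrun : IsRun G) {n : ℕ} {i j : Replica f} {w : ℕ}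
    {val : Val f Client Op} {vcs : Replica f → Option (Cert f Client Op)}
    (h : Msg.newView w s j val vcs ∈ ((G n).loc i).rcv) (hv : ValidVcs s w vcs) :
    (G n).Reached s w := by
  have h1 : AtLeast (2 * f + 1) fun k => ∃ c, vcs k = some c :=
    ⟨_, hv.1.ge, fun k hk => Option.isSome_iff_exists.1 (by simpa using hk)⟩
  refine (AtLeast.correct S h1).mono le_rfl fun k ⟨hk, c, hc⟩ => ⟨hk, ?_⟩
  have h2 : (G n).GenuineVC w s k c := by
    rcases (hrun.genuine n i).1 _ h with h2 | h2
    · exact h2.2 k c hc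
    · exact (hrun.genuine n j).1 _ (((hrun.verifyInv n j).sent_newView _ _ _ _ _ h2).1 k c hc)
  exact ((hrun.verifyInv n k).sent_viewChange _ _ _ _ (h2.resolve_left fun h => hk h.1)).2.2

/-- The view-change timer runs once enough replicas have reached the view. -/
theorem IsRun.vcT_reached (hrun : IsRun G) (n : ℕ) {i : Replica f} {τ : ℝ}
    (h : ((G n).loc i).vcT s = some τ) : ∃ m ≤ n,
      τ = (G m).now + 3 * S.Δ ∧ (G m).Reached s (((G n).loc i).view s) := by
  induction n with
  | zero =>
    rw [hrun.start] at h
    simp [Global.start, Local.start] at h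
  | succ n ih =>
    rcases hrun.loc_step n i with h1 | ⟨-, -, h1⟩ | ⟨-, -, m, -, h1⟩
    · rw [h1] at h ⊢
      obtain ⟨m, hm, h2⟩ := ih h
      exact ⟨m, by omega, h2⟩
    · obtain ⟨h2, h3 | ⟨h3, h4⟩⟩ := h1.vcT_cases h
      · obtain ⟨m, hm, h4⟩ := ih h3
        exact ⟨m, by omega, h2 ▸ h4⟩
      · exact ⟨n, by omega, h3, h2 ▸ hrun.reached_of_viewsReached h4⟩
    · rw [h1] at h ⊢
      obtain ⟨m, hm, h2⟩ := ih h
      exact ⟨m, by omega, h2⟩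

/-- The commit timer of a later view is started by a NewView, that of the initial view once the
agreement was started. -/
theorem IsRun.comT_started (hrun : IsRun G) (n : ℕ) {i : Replica f} (hi : i ∉ S.byz) {τ : ℝ}
    (h : ((G n).loc i).comT s = some τ) : ∃ m ≤ n,
      (((G n).loc i).view s = 0 → τ = (G m).now + 9 * S.Δ ∧ (G m).Known s) ∧
      (((G n).loc i).view s ≠ 0 → τ = (G m).now + 3 * S.Δ ∧ ∃ val vcs,
        Msg.newView (((G n).loc i).view s) s (coord s (((G n).loc i).view s)) val vcs ∈
          ((G m).loc i).rcv ∧ ValidVcs s (((G n).loc i).view s) vcs) := by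
  induction n with
  | zero =>
    rw [hrun.start] at h
    simp [Global.start, Local.start] at h
  | succ n ih =>
    have hle := hrun.le_succ n
    rcases hrun.loc_step n i with h1 | ⟨-, hnow, h1⟩ | ⟨-, -, m, -, h1⟩
    · rw [h1] at h ⊢
      obtain ⟨m, hm, h2⟩ := ih h
      exact ⟨m, by omega, h2⟩
    · obtain ⟨h2, h3 | ⟨h3, h4, h5⟩ | ⟨h3, h4, -, h5⟩⟩ := h1.comT_cases h
      · obtain ⟨m, hm, h4⟩ := ih h3
        exact ⟨m, by omega, h2 ▸ h4⟩
      · have hv : ((G n).loc i).view s = 0 := by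
          rcases h4 with h4 | rfl
          · exact h4
          · exact hrun.view_fresh n hi _ le_rfl rfl
        refine ⟨n + 1, le_rfl, fun _ => ⟨by rw [hnow]; exact h3, ?_⟩, fun h => absurd (h2.trans hv) h⟩
        exact (hrun.known (n + 1) s i hi).1 (by simp [h])
      · have hv := (hrun.verifyInv n i).viewChange_view s h4
        exact ⟨n, by omega, fun h => absurd (h2.symm.trans h) hv, fun _ => ⟨h3, h2 ▸ h5⟩⟩
    · rw [h1] at h ⊢
      obtain ⟨m, hm, h2⟩ := ih h
      exact ⟨m, by omega, h2⟩

theorem reached_zero (G : Global S) : G.Reached s 0 :=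
  ((atLeast_of_correct S (p := fun i => i ∉ S.byz) fun _ h => h).mono (by omega)
    fun _ h => ⟨h, Nat.zero_le _⟩)

/-- The expiry of a timer in a view shows that this view was reached by enough replicas. -/
theorem IsRun.reached_of_timer (hrun : IsRun G) {n : ℕ} {i : Replica f} (hi : i ∉ S.byz) {τ : ℝ}
    (h : ((G n).loc i).comT s = some τ ∨ ((G n).loc i).vcT s = some τ) :
    (G n).Reached s (((G n).loc i).view s) := by
  by_cases hv : ((G n).loc i).view s = 0
  · rw [hv]
    exact reached_zero _
  rcases h with h | h
  · obtain ⟨m, hm, -, h1⟩ := hrun.comT_started n hi h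
    obtain ⟨-, val, vcs, h2, h3⟩ := h1 hv
    exact (hrun.le hm).reached le_rfl (hrun.viewsReached_of_newView h2 h3)
  · obtain ⟨m, hm, -, h1⟩ := hrun.vcT_reached n h
    exact (hrun.le hm).reached le_rfl h1

/-- Joining follows a correct replica that is already there, so the first correct one to go beyond
`w` does so by a timer. Beyond view `0`, timers start only after `2f + 1` replicas have reached the
view. -/
theorem IsRun.reached_of_lt (hrun : IsRun G) (n : ℕ) {i : Replica f} (hi : i ∉ S.byz) {w : ℕ}
    (h : w < ((G n).loc i).view s) : (G n).Reached s w := by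
  induction n generalizing i with
  | zero =>
    rw [hrun.start] at h
    simp [Global.start, Local.start] at h
  | succ n ih =>
    have hle := hrun.le_succ n
    refine hle.reached le_rfl ?_
    rcases hrun.loc_step n i with h1 | ⟨-, hnow, h1⟩ | ⟨-, -, m, -, h1⟩
    · rw [h1] at h
      exact ih hi h
    · rcases h1.view_cases s with h2 | ⟨-, -, ⟨h2, τ, -, -, h3⟩ | h2⟩
      · exact ih hi (h2 ▸ h)
      · exact (Global.Le.refl _).reached (by omega)
          (hrun.reached_of_timer hi (h3.imp id fun h => h.2))
      · obtain ⟨j, hj, w', c, h3, h4⟩ := h2.exists_correct S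
        exact ih hj (h.trans_le (h3.trans (hrun.view_of_viewChange h4 hj).2))
    · rw [h1] at h
      exact ih hi h

/-- View `w` is not left as long as no timer expires. -/
theorem IsRun.view_le_of_timers (hrun : IsRun G) {a : ℝ} {w : ℕ}
    (h : ∀ n i, (G n).now < a → i ∉ S.byz → ((G n).loc i).view s = w → ∀ τ ≤ (G n).now,
      ¬ (((G n).loc i).comT s = some τ ∨
        ((G n).loc i).step s = .viewChange ∧ ((G n).loc i).vcT s = some τ))
    (n : ℕ) (hn : (G n).now < a) {i : Replica f} (hi : i ∉ S.byz) : ((G n).loc i).view s ≤ w := by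
  induction n generalizing i with
  | zero =>
    rw [hrun.start]
    simp [Global.start, Local.start]
  | succ n ih =>
    have hn' : (G n).now < a := (hrun.le_succ n).now.trans_lt hn
    have ih := @ih hn'
    rcases hrun.loc_step n i with h1 | ⟨-, hnow, h1⟩ | ⟨-, -, m, -, h1⟩
    · rw [h1]
      exact ih hi
    · rcases h1.view_cases s with h2 | ⟨-, -, ⟨h2, τ, h4, -, h3⟩ | h2⟩
      · rw [h2]
        exact ih hi
      · have h5 : ((G n).loc i).view s ≠ w := fun e => h n i hn' hi e τ h4 h3
        have := ih hi
        omega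
      · obtain ⟨j, hj, w', c, h3, h4⟩ := h2.exists_correct S
        exact h3.trans ((hrun.view_of_viewChange h4 hj).2.trans (ih hj))
    · rw [h1]
      exact ih hi

/-- A replica that cannot act has joined the views of the others. -/
theorem IsRun.le_view_of_quiet (hrun : IsRun G) {n : ℕ} (hQ : (G n).Quiet (G n).now)
    {i : Replica f} (hi : i ∉ S.byz) {w : ℕ}
    (h : ((G n).loc i).ViewsReached (f + 1) s w) : w ≤ ((G n).loc i).view s := by
  classical
  by_contra! hlt
  -- Joining requires the highest view with `f + 1` reports. It exists because among any `f + 1`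
  -- reports one is from a correct replica, whose own view bounds it.
  have hb : ∀ w', ((G n).loc i).ViewsReached (f + 1) s w' →
      w' ≤ Finset.univ.sup fun j => ((G n).loc j).view s := fun w' h' => by
    obtain ⟨j, hj, v, c, h1, h2⟩ := AtLeast.exists_correct S h'
    exact h1.trans ((hrun.view_of_viewChange h2 hj).2.trans
      (Finset.le_sup (f := fun j => ((G n).loc j).view s) (Finset.mem_univ j)))
  have h1 := Nat.findGreatest_spec (hb w h) h
  have h2 := Nat.le_findGreatest (hb w h) h
  exact hQ i hi _ (Act.joinView _ s _ (hlt.trans_le h2) h1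
    fun w' h' => Nat.le_findGreatest (hb w' h') h')

theorem exists_selected (vcs : Replica f → Option (Cert f Client Op)) :
    ∃ val, Selected vcs val := by
  classical
  by_cases h1 : ∃ i v val P, vcs i = some (.rpc v val P)
  · let A : Finset (Replica f) := Finset.univ.filter fun i => ∃ v val P, vcs i = some (.rpc v val P)
    let g : Replica f → ℕ := fun i => match vcs i with
      | some (.rpc v _ _) => v
      | _ => 0
    have hg : ∀ i v val P, vcs i = some (.rpc v val P) → g i = v := fun i v val P hi => by
      simp only [g, hi]
    have hA : A.Nonempty := by
      obtain ⟨i, hi⟩ := h1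
      exact ⟨i, by simpa [A] using hi⟩
    obtain ⟨i, hi, hmax⟩ := A.exists_max_image g hA
    obtain ⟨v, val, P, hi⟩ : ∃ v val P, vcs i = some (.rpc v val P) := by simpa [A] using hi
    refine ⟨val, Or.inl ⟨i, v, P, hi, fun j v' val' P' hj => ?_⟩⟩
    have := hmax j (by simpa [A] using ⟨v', val', P', hj⟩)
    rwa [hg _ _ _ _ hj, hg _ _ _ _ hi] at this
  · push Not at h1
    by_cases h2 : ∃ i h g, vcs i = some (.fpc h g)
    · obtain ⟨i, h, g, hi⟩ := h2
      exact ⟨_, Or.inr (Or.inl ⟨h1, i, h, g, hi, rfl⟩)⟩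
    · push Not at h2
      refine ⟨none, Or.inr (Or.inr ⟨fun j c hj => ?_, rfl⟩)⟩
      cases c with
      | empty => rfl
      | fpc h g => exact absurd hj (h2 j h g)
      | rpc v val P => exact absurd hj (h1 j v val P)

theorem Global.Sound.validVal {G : Global S} {val : Val f Client Op} (h : G.Sound s val) :
    ValidVal s val := by
  match val, h with
  | none, _ => trivial
  | some (x, g), h => exact h.1

/-- Correct replicas send valid certificates. -/
theorem IsRun.validCert (hrun : IsRun G) {n : ℕ} {i : Replica f} (hi : i ∉ S.byz) {w : ℕ}
    {c : Cert f Client Op} (h : Msg.viewChange w s i c ∈ ((G n).loc i).sent) : ValidCert s w c := by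
  have h1 := ((hrun.coreInv n hi s).sent_viewChange w c h).2.2.1
  cases c with
  | empty => trivial
  | fpc x g =>
    have h2 := hrun.sound_of_collects hi h1
    obtain ⟨y, -, h3, -, -, h4⟩ := h1
    obtain ⟨rfl, rfl⟩ : x = y ∧ g = _ := by simpa using h3
    exact ⟨h2.1, h4.1 trivial⟩
  | rpc v val P =>
    obtain ⟨h2, h3, h4, h5⟩ := h1
    exact ⟨h2, h3, (hrun.sound_of_prepare hi h5).validVal⟩

end Views

/-! ### Decision in a view with a correct coordinator -/

section ViewChange

variable {f : ℕ} {Client Op Res State : Type*} {S : System f Client Op Res State}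
  {G : ℕ → Global S} {s : Slot f} {T : ℝ} {w : ℕ} {b : ℝ}

/-- Values that are prepared by all replicas are committed. -/
theorem IsRun.decided_of_prepared (hrun : IsRun G) (hT : 0 ≤ T) (hd : Delivers G T)
    (hb : T ≤ b) {val : Val f Client Op}
    (h : Before G b fun G => ∀ i ∉ S.byz, Msg.prepare w s i val ∈ (G.loc i).sent)
    (hv : ∀ n, (G n).now < b + 2 * S.Δ → ∀ i ∉ S.byz, ((G n).loc i).view s ≤ w) {i : Replica f}
    (hi : i ∉ S.byz) : Before G (b + 2 * S.Δ) fun G => (G.loc i).dec s ≠ none ∧ G.Chosen s val := by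
  have hΔ := S.Δ_pos
  obtain ⟨n, h1, h2⟩ := id h
  have h3 : Before G (b + S.Δ) fun G => ∀ i ∉ S.byz, ∀ j ∉ S.byz,
      Msg.prepare w s j val ∈ (G.loc i).rcv :=
    hrun.before_correct (by linarith) fun i hi => hrun.before_correct (by linarith) fun j hj =>
      hd j hj i hi n _ (h2 n le_rfl j hj) _ (by linarith) (by linarith)
  -- With all Prepares at hand, a replica still in step `rpVerified` could act; so in a state
  -- without enabled actions all have sent their Commits.
  have hnot : ∀ m, (G m).now < b + 2 * S.Δ → (G m).Quiet (G m).now →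
      (∀ i ∉ S.byz, Msg.prepare w s i val ∈ ((G m).loc i).sent) →
      (∀ i ∉ S.byz, ∀ j ∉ S.byz, Msg.prepare w s j val ∈ ((G m).loc i).rcv) → ∀ i ∉ S.byz,
      ((G m).loc i).view s = w ∧ val = ((G m).loc i).val s ∧
      (((G m).loc i).step s = .rpPrepared ∨ ((G m).loc i).step s = .rpCommitted) := by
    intro m hm hQ hs hr i hi
    have h5 := (hrun.coreInv m hi s).sent_prepare w val (hs i hi)
    have h6 := (le_antisymm h5.1 (hv m hm i hi)).symm
    obtain ⟨h7 | h7, h8⟩ := h5.2.1 h6.symm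
    · exfalso
      refine hQ i hi _ (Act.rpPrepare _ s (Finset.univ \ S.byz) h7 S.compl_card fun j hj => ?_)
      rw [h6, ← h8]
      exact hr i hi j (Finset.mem_sdiff.1 hj).2
    · exact ⟨h6, h8, h7⟩
  have h3' := h3.and (h.mono (by linarith : b ≤ b + S.Δ) fun _ => id)
  obtain ⟨m, h4, h5, h6⟩ := h3'.quiet hrun
  have h7 : ∀ i ∉ S.byz, Msg.commit w s i val ∈ ((G m).loc i).sent := fun i hi => by
    obtain ⟨h8, h9, h10⟩ := hnot m (by linarith) h6 (h5 m le_rfl).2 (h5 m le_rfl).1 i hi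
    have := (hrun.coreInv m hi s).commit h10
    rwa [h8, ← h9] at this
  have h8 : Before G (b + 2 * S.Δ) fun G => ∀ j ∉ S.byz, Msg.commit w s j val ∈ (G.loc i).rcv :=
    hrun.before_correct (by linarith) fun j hj =>
      hd j hj i hi m _ (h7 j hj) _ (by linarith) (by linarith)
  obtain ⟨k, h9, h10, h11⟩ :=
    (h8.and (h3'.mono (by linarith : b + S.Δ ≤ b + 2 * S.Δ) fun _ => id)).quiet hrun
  obtain ⟨h12, h13, h14⟩ := h10 k le_rfl
  obtain ⟨h15, h16, h17 | h17⟩ := hnot k h9 h11 h14 h13 i hi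
  · refine absurd (Act.rpCommit _ s h17 (atLeast_of_correct S fun j hj => ?_)) (h11 i hi _)
    rw [h15, ← h16]
    exact h12 j hj
  · obtain ⟨d, hd'⟩ := Option.ne_none_iff_exists'.1 ((hrun.coreInv k hi s).dec (Or.inr h17))
    refine hrun.before h9 fun G' hle => ⟨by simp [(hle.loc i).dec _ _ hd'], ?_⟩
    refine hle.chosen (Or.inr ⟨w, atLeast_of_correct S fun j hj => ?_⟩)
    exact Or.inr (((hrun.genuine k i).1 _ (h12 j hj)).sent hj)

/-- The agreement in a view with a correct coordinator that is reached when the network is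
synchronous. -/
theorem IsRun.decided_of_view (hrun : IsRun G) (hT : 0 ≤ T) (hd : Delivers G T) (hw : w ≠ 0)
    (hco : coord s w ∉ S.byz) {n₀ : ℕ} (hn₀ : (G n₀).Reached s w)
    (hmin : ∀ m, (G m).Reached s w → n₀ ≤ m) (hnow : T ≤ (G n₀).now) {i : Replica f}
    (hi : i ∉ S.byz) : ∃ n, ((G n).loc i).dec s ≠ none := by
  have hΔ := S.Δ_pos
  have hpos := hrun.now_nonneg n₀
  set t₀ := (G n₀).now with ht₀
  -- The time `t₀` is when `f + 1` correct replicas have reached view `w` for the first time; no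
  -- timer of this view starts earlier, and each runs for `3Δ`.
  have hvcT : ∀ n i, ((G n).loc i).view s = w → ∀ τ, ((G n).loc i).vcT s = some τ →
      t₀ + 3 * S.Δ ≤ τ := by
    intro n i hv τ hτ
    obtain ⟨m, -, h1, h2⟩ := hrun.vcT_reached n hτ
    rw [hv] at h2
    have := (hrun.le (hmin m h2)).now
    linarith
  have hview : ∀ n, (G n).now < t₀ + 3 * S.Δ → ∀ i ∉ S.byz, ((G n).loc i).view s ≤ w := by
    refine fun n hn i hi => hrun.view_le_of_timers (a := t₀ + 3 * S.Δ) ?_ n hn hi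
    rintro n i hn hi hv τ hτ (h1 | ⟨-, h1⟩)
    · obtain ⟨m, hm, -, h2⟩ := hrun.comT_started n hi h1
      rw [hv] at h2
      obtain ⟨h3, val, vcs, h4, h5⟩ := h2 hw
      have := (hrun.le (hmin m (hrun.viewsReached_of_newView h4 h5))).now
      linarith
    · linarith [hvcT n i hv τ h1]
  -- The ViewChanges of those `f + 1` correct replicas make all others join within `Δ`.
  have hA : Before G (t₀ + S.Δ) fun H => ∀ i ∉ S.byz, w ≤ (H.loc i).view s := by
    refine hrun.before_correct (by linarith) fun q hq => ?_
    have h1 : Before G (t₀ + S.Δ) fun H => ∀ j ∉ S.byz, w ≤ ((G n₀).loc j).view s →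
        ∃ w' c, w ≤ w' ∧ Msg.viewChange w' s j c ∈ (H.loc q).rcv := by
      refine hrun.before_correct (by linarith) fun j hj => ?_
      by_cases hv : w ≤ ((G n₀).loc j).view s
      · obtain ⟨c, hc⟩ := (hrun.coreInv n₀ hj s).viewChange (by omega)
        exact (hd j hj q hq n₀ _ hc _ (by linarith) (by linarith)).mono le_rfl
          fun G h _ => ⟨_, c, hv, h⟩
      · exact (hrun.before_true (by linarith)).mono le_rfl fun _ _ h => absurd h hv
    obtain ⟨m, h2, h3, h4⟩ := h1.quiet hrun
    refine hrun.before h2 fun G' hle => (hrun.le_view_of_quiet h4 hq ?_).trans ((hle.loc q).view s)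
    exact hn₀.mono le_rfl fun j hj => h3 m le_rfl j hj.1 hj.2
  obtain ⟨nA, hA1, hA2⟩ := id hA
  -- After another `Δ` the coordinator holds the ViewChanges of all correct replicas. It either
  -- sends a NewView now or has already followed its own.
  have hB : Before G (t₀ + 2 * S.Δ) fun G => ∃ val vcs,
      Msg.newView w s (coord s w) val vcs ∈ (G.loc (coord s w)).sent := by
    have h1 : Before G (t₀ + 2 * S.Δ) fun G => ∀ j ∉ S.byz, ∃ c,
        Msg.viewChange w s j c ∈ (G.loc (coord s w)).rcv := by
      refine hrun.before_correct (by linarith) fun j hj => ?_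
      have h2 : ((G nA).loc j).view s = w :=
        le_antisymm (hview nA (by linarith) j hj) (hA2 nA le_rfl j hj)
      obtain ⟨c, hc⟩ := (hrun.coreInv nA hj s).viewChange (by omega)
      rw [h2] at hc
      exact (hd j hj _ hco nA _ hc _ (by linarith) (by linarith)).mono le_rfl fun G h => ⟨c, h⟩
    obtain ⟨m, h2, h3, h4⟩ :=
      (h1.and (hA.mono (by linarith : t₀ + S.Δ ≤ t₀ + 2 * S.Δ) fun _ => id)).quiet hrun
    obtain ⟨h5, h6⟩ := h3 m le_rfl
    have h7 : ((G m).loc (coord s w)).view s = w :=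
      le_antisymm (hview m (by linarith) _ hco) (h6 _ hco)
    suffices h : ∃ val vcs, Msg.newView w s (coord s w) val vcs ∈ ((G m).loc (coord s w)).sent by
      obtain ⟨val, vcs, h⟩ := h
      exact hrun.before h2 fun G' hle => ⟨val, vcs, (hle.loc _).sent h⟩
    rcases (hrun.coreInv m hco s).late (by omega) with h8 | h8
    · by_contra! hno
      classical
      have : Nonempty (Cert f Client Op) := ⟨.empty⟩
      choose! c hc using h5
      obtain ⟨Q, hQ, hQc⟩ := Finset.exists_subset_card_eq S.compl_card
      obtain ⟨val, hval⟩ := exists_selected fun j => if j ∈ Q then some (c j) else none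
      have hQb : ∀ j ∈ Q, j ∉ S.byz := fun j hj => (Finset.mem_sdiff.1 (hQ hj)).2
      refine h4 _ hco _ (Act.newView _ s val (fun j => if j ∈ Q then some (c j) else none) h8
        (by rw [h7]) ?_ ⟨?_, ?_⟩ hval (by rw [h7]; exact hno))
      · intro j c' hj
        split at hj
        · next hjQ =>
          cases hj
          rw [h7]
          exact hc j (hQb j hjQ)
        · cases hj
      · rw [← hQc]
        congr 1
        ext j
        by_cases hj : j ∈ Q <;> simp [hj]
      · intro j c' hj
        beta_reduce at hj
        split at hj
        · next hjQ =>
          cases hj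
          rw [h7]
          exact hrun.validCert (hQb j hjQ) (hrun.viewChange_sent (hc j (hQb j hjQ)) (hQb j hjQ))
        · cases hj
    · have h9 := (hrun.coreInv m hco s).slow h8
      rw [h7] at h9
      obtain ⟨vcs, h10, -⟩ := ((hrun.coreInv m hco s).sent_prepare _ _ h9).2.2.2 hw
      exact ⟨_, vcs, ((hrun.genuine m _).1 _ h10).resolve_left fun h => hco h.1⟩
  classical
  obtain ⟨nB, hB1, hB2⟩ := hB
  have hex : ∃ n, ∃ val vcs, Msg.newView w s (coord s w) val vcs ∈ ((G n).loc (coord s w)).sent :=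
    ⟨nB, hB2 nB le_rfl⟩
  -- The first moment of the NewView matters, because the commit timers of this view cannot start
  -- before it.
  obtain ⟨n₁, ⟨val, vcs, hn₁⟩, hmin₁⟩ : ∃ n, (∃ val vcs,
      Msg.newView w s (coord s w) val vcs ∈ ((G n).loc (coord s w)).sent) ∧
      ∀ m, (∃ val vcs, Msg.newView w s (coord s w) val vcs ∈ ((G m).loc (coord s w)).sent) → n ≤ m :=
    ⟨Nat.find hex, Nat.find_spec hex, fun m hm => Nat.find_min' hex hm⟩
  obtain ⟨hvcs₁, hvcs, hsel⟩ := (hrun.verifyInv n₁ _).sent_newView _ _ _ _ _ hn₁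
  have h01 : n₀ ≤ n₁ := hmin n₁
    (hrun.viewsReached_of_newView ((hrun.headerInv n₁ _).sent_rcv hn₁) hvcs)
  have ht₁ : t₀ ≤ (G n₁).now := (hrun.le h01).now
  have ht₁' : (G n₁).now < t₀ + 2 * S.Δ :=
    (hrun.le (hmin₁ nB (hB2 nB le_rfl))).now.trans_lt hB1
  set t₁ := (G n₁).now
  have hC : Before G (t₁ + S.Δ) fun G => ∀ i ∉ S.byz, Msg.prepare w s i val ∈ (G.loc i).sent := by
    refine hrun.before_correct (by linarith) fun i hi => ?_
    obtain ⟨m, h1, h2, h3⟩ := ((hd _ hco i hi n₁ _ hn₁ (t₁ + S.Δ) le_rfl (by linarith)).and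
      (hA.mono (by linarith : t₀ + S.Δ ≤ t₁ + S.Δ) fun _ => id)).quiet hrun
    obtain ⟨h4, h5⟩ := h2 m le_rfl
    have h7 : ((G m).loc i).view s = w := le_antisymm (hview m (by linarith) _ hi) (h5 _ hi)
    refine hrun.before h1 fun G' hle => (hle.loc i).sent ?_
    rcases (hrun.coreInv m hi s).late (by omega) with h8 | h8
    · exact absurd (Act.acceptNewView _ s val vcs h8 (by rwa [h7]) (by rwa [h7]) hsel) (h3 i hi _)
    · have h9 := (hrun.coreInv m hi s).slow h8
      rw [h7] at h9
      obtain ⟨vcs', h10, -⟩ := ((hrun.coreInv m hi s).sent_prepare _ _ h9).2.2.2 hw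
      have h11 := ((hrun.genuine m _).1 _ h10).resolve_left fun h => hco h.1
      have h12 := ((hrun.genuine m _).1 _ h4).resolve_left fun h => hco h.1
      rwa [((hrun.verifyInv m _).newView_unique _ _ _ _ _ _ h11 h12).1] at h9
  obtain ⟨nC, hC1, hC2⟩ := id hC
  -- Commit timers expire no earlier than `t₁ + 3Δ`. View-change timers can expire only from `t₀ +
  -- 3Δ` on, and by then every correct replica has prepared and left step `viewChange`.
  have hv₂ : ∀ n, (G n).now < t₁ + S.Δ + 2 * S.Δ → ∀ i ∉ S.byz, ((G n).loc i).view s ≤ w := by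
    refine fun n hn i hi => hrun.view_le_of_timers (a := t₁ + S.Δ + 2 * S.Δ) ?_ n hn hi
    intro n i hn hi hv τ hτ h
    rcases h with h1 | ⟨h0, h1⟩
    · obtain ⟨m, hm, -, h2⟩ := hrun.comT_started n hi h1
      rw [hv] at h2
      obtain ⟨h3, val', vcs', h4, h5⟩ := h2 hw
      have h6 := ((hrun.genuine m _).1 _ h4).resolve_left fun h => hco h.1
      have h7 := (hrun.le (hmin₁ m ⟨_, _, h6⟩)).now
      linarith
    · have h2 := hvcT n i hv τ h1
      have h3 : nC ≤ n := by
        by_contra! h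
        linarith [(hrun.le h.le).now]
      have h4 := (((hrun.coreInv n hi s).sent_prepare w val (hC2 n h3 i hi)).2.1 hv.symm).1
      rw [h0] at h4
      rcases h4 with h4 | h4 | h4 <;> cases h4
  obtain ⟨n, -, h⟩ := hrun.decided_of_prepared hT hd (by linarith) hC hv₂ hi
  exact ⟨n, (h n le_rfl).1⟩

end ViewChange
-- Existence and persistence of timers
section Timers

variable {f : ℕ} {Client Op Res State : Type*} {S : System f Client Op Res State}
  {G : ℕ → Global S} {s : Slot f} {n : ℕ} {i : Replica f}

theorem IsRun.comT_of_viewChange (hrun : IsRun G) (n : ℕ) (hi : i ∉ S.byz)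
    (h : ((G n).loc i).step s = .viewChange) : ((G n).loc i).comT s = none := by
  induction n with
  | zero =>
    rw [hrun.start]
    rfl
  | succ n ih =>
    rcases hrun.loc_step n i with h1 | ⟨-, -, h1⟩ | ⟨-, -, m, -, h1⟩
    · rw [h1] at h ⊢
      exact ih h
    · by_contra hT
      obtain ⟨τ, hτ⟩ := Option.ne_none_iff_exists'.1 hT
      obtain ⟨h2, h3⟩ := h1.comT_cases hτ
      have h4 := (h1.timers h2).2.2.1 h
      have h5 := (hrun.verifyInv n i).viewChange_view s h4
      rcases h3 with h3 | ⟨-, h3 | rfl, -⟩ | ⟨-, -, h3, -⟩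
      · rw [ih h4] at h3
        cases h3
      · exact h5 h3
      · exact h5 (hrun.view_fresh n hi _ le_rfl rfl)
      · exact h3 h
    · rw [h1] at h ⊢
      exact ih h

theorem IsRun.not_fresh (hrun : IsRun G) (hi : i ∉ S.byz) (h : (G n).Known s) :
    s ≠ ⟨i, ((G n).loc i).mine.length⟩ := by
  rintro rfl
  exact lt_irrefl _ (hrun.lt_of_known hi h)

theorem IsRun.comT_of_step (hrun : IsRun G) (n : ℕ) (hi : i ∉ S.byz)
    (hv : ((G n).loc i).view s ≠ 0) (h : ((G n).loc i).step s ≠ .viewChange) :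
    ((G n).loc i).comT s ≠ none := by
  induction n with
  | zero =>
    rw [hrun.start] at hv
    exact absurd rfl hv
  | succ n ih =>
    rcases hrun.loc_step n i with h1 | ⟨-, -, h1⟩ | ⟨-, -, m, -, h1⟩
    · rw [h1] at h hv ⊢
      exact ih hv h
    · have key : ((G (n + 1)).loc i).view s = ((G n).loc i).view s →
          ((G n).loc i).step s ≠ .viewChange → ((G (n + 1)).loc i).comT s ≠ none := by
        intro h2 h3
        obtain ⟨τ, hτ⟩ := Option.ne_none_iff_exists'.1 (ih (h2 ▸ hv) h3)
        have h4 := hrun.not_fresh hi ((hrun.known n s i hi).2 (h2 ▸ hv))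
        rw [(h1.timers h2).2.2.2 h4 h3 τ hτ]
        simp
      rcases h1.core_cases s with h2 | h2 | h2 | h2 | h2 | h2 | h2 | h2 | h2
      · exact key h2.2.2.2 (h2.1 ▸ h)
      · exfalso
        rw [h2.2.2.2.1] at hv
        rcases h2.2.2.2.2.2.2 with rfl | h3
        · exact hv (hrun.view_fresh n hi _ le_rfl rfl)
        · exact hv h3.1
      · exact absurd h2.2.2.1 hv
      · exact key h2.2.2.2.2.1 (by simp [h2.2.1])
      · exact absurd h2.2.2.1 hv
      · exact key h2.2.2.2.1 (by simp [h2.2.1])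
      · exact key h2.2.2.2.2.1 (by simp [h2.2.1])
      · exact absurd h2.1 h
      · simp [h2.2.2.2.2.1]
    · rw [h1] at h hv ⊢
      exact ih hv h

theorem IsRun.comT_of_hdr (hrun : IsRun G) (n : ℕ) (hi : i ∉ S.byz)
    (h : ((G n).loc i).hdr s ≠ none) (hv : ((G n).loc i).view s = 0) :
    ((G n).loc i).comT s ≠ none := by
  induction n with
  | zero =>
    rw [hrun.start] at h
    exact absurd rfl h
  | succ n ih =>
    have hle := (hrun.le_succ n).loc i
    rcases hrun.loc_step n i with h1 | ⟨-, -, h1⟩ | ⟨-, -, m, -, h1⟩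
    · rw [h1] at h hv ⊢
      exact ih h hv
    · rcases h1.comT_of_hdr h with h2 | h2
      · have h3 : ((G n).loc i).view s = 0 := Nat.le_zero.1 (hv ▸ hle.view s)
        obtain ⟨τ, hτ⟩ := Option.ne_none_iff_exists'.1 (ih h2 h3)
        rw [(h1.timers (hv.trans h3.symm)).2.2.2 (hrun.not_fresh hi ⟨i, hi, h2⟩)
          (fun h4 => (hrun.verifyInv n i).viewChange_view s h4 h3) τ hτ]
        simp
      · exact h2
    · rw [h1] at h hv ⊢
      exact ih h hv

theorem IsRun.queryT_of_viewChange (hrun : IsRun G) (n : ℕ)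
    (h : ((G n).loc i).step s = .viewChange) : ((G n).loc i).queryT s ≠ none := by
  induction n with
  | zero =>
    rw [hrun.start] at h
    cases h
  | succ n ih =>
    rcases hrun.loc_step n i with h1 | ⟨-, -, h1⟩ | ⟨-, -, m, -, h1⟩
    · rw [h1] at h ⊢
      exact ih h
    · rcases h1.core_cases s with h2 | h2 | h2 | h2 | h2 | h2 | h2 | h2 | h2
      · obtain ⟨τ, hτ⟩ := Option.ne_none_iff_exists'.1 (ih (h2.1 ▸ h))
        rw [(h1.timers h2.2.2.2).2.1 τ hτ]
        simp
      case inr.inr.inr.inr.inr.inr.inr.inl => exact h2.2.2.2.2.2.2.2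
      all_goals
        rw [h2.1] at h
        cases h
    · rw [h1] at h ⊢
      exact ih h

/-- Timers and the state of the view change persist as long as the view does. -/
theorem IsRun.timers (hrun : IsRun G) (hi : i ∉ S.byz) {m : ℕ} (hnm : n ≤ m)
    (hv : ((G m).loc i).view s = ((G n).loc i).view s) {τ : ℝ} :
    (((G n).loc i).comT s = some τ → ((G m).loc i).comT s = some τ) ∧
    (((G n).loc i).vcT s = some τ → ((G m).loc i).vcT s = some τ) ∧
    (((G n).loc i).queryT s = some τ → ((G m).loc i).queryT s = some τ) := by
  induction m, hnm using Nat.le_induction with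
  | base => exact ⟨id, id, id⟩
  | succ m hm ih =>
    have h1 := ((hrun.le hm).loc i).view s
    have h2 := ((hrun.le_succ m).loc i).view s
    have h3 : ((G (m + 1)).loc i).view s = ((G m).loc i).view s := by omega
    obtain ⟨i1, i2, i3⟩ := ih (by omega)
    rcases hrun.loc_step m i with h | ⟨-, -, h⟩ | ⟨-, -, x, -, h⟩
    · rw [h]
      exact ⟨i1, i2, i3⟩
    · obtain ⟨h4, h5, -, h6⟩ := h.timers h3
      refine ⟨fun h7 => h6 ?_ ?_ τ (i1 h7), fun h7 => h4 τ (i2 h7), fun h7 => h5 τ (i3 h7)⟩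
      · exact hrun.not_fresh hi ((hrun.known m s i hi).1 (by simp [i1 h7]))
      · intro h8
        have := hrun.comT_of_viewChange m hi h8
        rw [i1 h7] at this
        cases this
    · rw [h]
      exact ⟨i1, i2, i3⟩

theorem IsRun.comT_of_started (hrun : IsRun G) (hi : i ∉ S.byz) (hQ : (G n).Quiet (G n).now)
    (h : ((G n).loc i).Started s) (hv : ((G n).loc i).view s = 0) :
    ((G n).loc i).comT s ≠ none := by
  rcases h with h | h | h
  · exact hrun.comT_of_hdr n hi h hv
  · exact fun hT => hQ i hi _ (Act.startCommitTimer _ s hv hT h)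
  · exact absurd hv h

end Timers

/-! ### Termination of the agreement on a slot -/

section Termination

variable {f : ℕ} {Client Op Res State : Type*} {S : System f Client Op Res State}
  {G : ℕ → Global S} {s : Slot f} {n : ℕ} {i : Replica f} {T : ℝ}

open Filter

theorem exists_eventually_eq {u : ℕ → ℕ} (hu : Monotone u) {b : ℕ} (hb : ∀ n, u n ≤ b) :
    ∃ v, ∀ᶠ n in atTop, u n = v := by
  classical
  have h1 := Nat.findGreatest_spec (P := fun v => ∃ n, u n = v) (hb 0) ⟨0, rfl⟩
  obtain ⟨n, hn⟩ := h1
  refine ⟨u n, eventually_atTop.2 ⟨n, fun m hm => le_antisymm ?_ (hu hm)⟩⟩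
  rw [hn]
  exact Nat.le_findGreatest (P := fun v => ∃ n, u n = v) (hb m) ⟨m, rfl⟩

theorem exists_coord (S : System f Client Op Res State) (s : Slot f) (V : ℕ) :
    ∃ w > V, coord s w ∉ S.byz := by
  obtain ⟨c, hc, -⟩ := (atLeast_of_correct S (p := fun i => i ∉ S.byz) fun _ h => h).inter S
    (atLeast_of_correct S (p := fun i => i ∉ S.byz) fun _ h => h)
  -- This is `c - s.co` modulo the number of replicas, moved beyond `V` by full rotations. The
  -- summand `3f + 1` keeps the subtraction from being truncated, and the final `1` accounts for the
  -- shifted numbering of views.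
  refine ⟨V * (3 * f + 1) + (c.val + (3 * f + 1) - s.co.val) + 1, ?_, ?_⟩
  · have : V * 1 ≤ V * (3 * f + 1) := Nat.mul_le_mul_left V (by omega)
    omega
  · have h1 : coord s (V * (3 * f + 1) + (c.val + (3 * f + 1) - s.co.val) + 1) = c := by
      have h2 := c.isLt
      have h3 := s.co.isLt
      unfold coord
      apply Fin.ext
      simp only
      have h4 : s.co.val + (V * (3 * f + 1) + (c.val + (3 * f + 1) - s.co.val) + 1 - 1) =
          c.val + (3 * f + 1) * (V + 1) := by
        have : (3 * f + 1) * (V + 1) = V * (3 * f + 1) + (3 * f + 1) := by ring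
        omega
      rw [h4, Nat.add_mul_mod_self_left, Nat.mod_eq_of_lt h2]
    rwa [h1]

theorem IsRun.eventually_quiet (hrun : IsRun G) {p : ℕ → Prop} (h : ∀ᶠ n in atTop, p n) :
    ∃ n, p n ∧ (G n).Quiet (G n).now := by
  obtain ⟨n, h1, h2⟩ := (hrun.frequently_quiet.and_eventually h).exists
  exact ⟨n, h2, h1.1⟩

theorem eventually_correct {p : Replica f → ℕ → Prop}
    (h : ∀ i ∉ S.byz, ∀ᶠ n in atTop, p i n) : ∀ᶠ n in atTop, ∀ i ∉ S.byz, p i n := by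
  refine eventually_all.2 fun i => ?_
  exact eventually_imp_distrib_left.2 fun hi => h i hi

/-- A replica that stays in a view without decision has no running timer: it is in the middle of a
view change and has queried the others. -/
theorem IsRun.stuck (hrun : IsRun G) (hi : i ∉ S.byz) {v : ℕ}
    (hv : ∀ᶠ n in atTop, ((G n).loc i).view s = v) (hdec : ∀ n, ((G n).loc i).dec s = none)
    (hs : ∀ᶠ n in atTop, ((G n).loc i).Started s) :
    v ≠ 0 ∧ (∀ᶠ n in atTop, ((G n).loc i).step s = .viewChange ∧ ((G n).loc i).vcT s = none) ∧
      ∃ n, Msg.queryExec s i ∈ ((G n).loc i).sent := by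
  obtain ⟨N, hN⟩ := eventually_atTop.1 hv
  -- A timer in the final view would expire sooner or later, and the replica would then leave this
  -- view.
  have hcom : ∀ n ≥ N, ((G n).loc i).comT s = none := by
    intro n hn
    by_contra hT
    obtain ⟨τ, hτ⟩ := Option.ne_none_iff_exists'.1 hT
    obtain ⟨m, ⟨h1, h2⟩, h3⟩ :=
      hrun.eventually_quiet ((hrun.eventually_now τ).and (eventually_ge_atTop n))
    have h4 := (hrun.timers hi h2 (by rw [hN n hn, hN m (hn.trans h2)])).1 hτ
    exact h3 i hi _ (Act.commitTimeout _ s τ h4 h1.le (hdec m))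
  -- In the initial view, taking part in the agreement entails a commit timer.
  have hv0 : v ≠ 0 := by
    rintro rfl
    obtain ⟨m, ⟨h1, h2⟩, h3⟩ := hrun.eventually_quiet (hs.and (eventually_ge_atTop N))
    exact hrun.comT_of_started hi h3 h1 (hN m h2) (hcom m h2)
  have hstep : ∀ n ≥ N, ((G n).loc i).step s = .viewChange := by
    intro n hn
    by_contra h
    exact hrun.comT_of_step n hi (by rwa [hN n hn]) h (hcom n hn)
  have hvc : ∀ n ≥ N, ((G n).loc i).vcT s = none := by
    intro n hn
    by_contra hT
    obtain ⟨τ, hτ⟩ := Option.ne_none_iff_exists'.1 hT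
    obtain ⟨m, ⟨h1, h2⟩, h3⟩ :=
      hrun.eventually_quiet ((hrun.eventually_now τ).and (eventually_ge_atTop n))
    have h4 := (hrun.timers hi h2 (by rw [hN n hn, hN m (hn.trans h2)])).2.1 hτ
    exact h3 i hi _ (Act.viewTimeout _ s τ (hstep m (hn.trans h2)) h4 h1.le (hdec m))
  refine ⟨hv0, eventually_atTop.2 ⟨N, fun n hn => ⟨hstep n hn, hvc n hn⟩⟩, ?_⟩
  obtain ⟨τ, hτ⟩ := Option.ne_none_iff_exists'.1 (hrun.queryT_of_viewChange N (hstep N le_rfl))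
  obtain ⟨m, ⟨h1, h2⟩, h3⟩ :=
    hrun.eventually_quiet ((hrun.eventually_now τ).and (eventually_ge_atTop N))
  have h4 := (hrun.timers hi h2 (by rw [hN N le_rfl, hN m h2])).2.2 hτ
  by_contra! hno
  exact h3 i hi _ (Act.query _ s τ (hstep m h2) (hvc m h2) h4 h1.le (hdec m) (hno m))

/-- An undecided replica obtains a result that is known to `f + 1` correct replicas. -/
theorem IsRun.decided_of_query (hrun : IsRun G) (hd : Delivers G T) (hi : i ∉ S.byz)
    (hq : ∃ n, Msg.queryExec s i ∈ ((G n).loc i).sent)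
    (h : AtLeast (f + 1) fun j => j ∉ S.byz ∧ ∃ n, ((G n).loc j).dec s ≠ none) :
    ∃ n, ((G n).loc i).dec s ≠ none := by
  obtain ⟨n₀, hn₀⟩ := hq
  obtain ⟨j₀, -, hj₀, m₀, hm₀⟩ := h.exists_correct S
  obtain ⟨d, hd₀⟩ := Option.ne_none_iff_exists'.1 hm₀
  have h1 : ∀ᶠ n in atTop, ∀ j ∉ S.byz, (∃ n, ((G n).loc j).dec s ≠ none) →
      Msg.exec s j d ∈ ((G n).loc i).rcv := by
    refine eventually_correct (S := S) fun j hj => ?_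
    refine eventually_imp_distrib_left.2 fun ⟨m, hm⟩ => ?_
    obtain ⟨d', hd'⟩ := Option.ne_none_iff_exists'.1 hm
    obtain rfl := hrun.dec_unique hj hj₀ hd' hd₀
    obtain ⟨k, ⟨h2, h3⟩, h4⟩ :=
      hrun.eventually_quiet ((hd.eventually hi hj hn₀).and (eventually_ge_atTop m))
    have h5 : Msg.exec s j d' ∈ ((G k).loc j).sent := by
      by_contra h5
      exact h4 j hj _ (Act.answer _ s i d' h2 (((hrun.le h3).loc j).dec _ _ hd') h5)
    exact hd.eventually hj hi h5
  obtain ⟨k, h2, h3⟩ := hrun.eventually_quiet h1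
  by_contra! hno
  exact h3 i hi _ (Act.execCommit _ s d (hno k) (h.mono le_rfl fun j hj => h2 j hj.1 hj.2))

/-- If the agreement on a slot was started, every correct replica obtains a result. -/
theorem IsRun.decided (hrun : IsRun G) (hT : 0 ≤ T) (hd : Delivers G T) (hs : (G n).Known s)
    (hi : i ∉ S.byz) : ∃ m, ((G m).loc i).dec s ≠ none := by
  classical
  by_contra! hno
  -- If all views are reached, a view with a correct coordinator above all views present at a time
  -- after `T` is first reached under synchrony. Otherwise the views are bounded and become
  -- constant.
  by_cases hall : ∀ w, ∃ n, (G n).Reached s w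
  · obtain ⟨N, hN⟩ := hrun.unbounded T
    obtain ⟨w, hw, hco⟩ := exists_coord S s (Finset.univ.sup fun j => ((G N).loc j).view s)
    have hle : N ≤ Nat.find (hall w) := by
      by_contra! hlt
      obtain ⟨j, hj, -, h1⟩ := AtLeast.exists_correct S (Nat.find_spec (hall w))
      have h2 := ((hrun.le hlt.le).loc j).view s
      have h3 := Finset.le_sup (f := fun j => ((G N).loc j).view s) (Finset.mem_univ j)
      omega
    obtain ⟨m, hm⟩ := hrun.decided_of_view hT hd (by omega) hco (Nat.find_spec (hall w))
      (fun m hm => Nat.find_min' _ hm) (hN.le.trans (hrun.le hle).now) hi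
    exact hm (hno m)
  push Not at hall
  obtain ⟨w, hw⟩ := hall
  have hv : ∀ j, ∃ v, j ∉ S.byz → ∀ᶠ n in atTop, ((G n).loc j).view s = v := by
    intro j
    by_cases hj : j ∈ S.byz
    · exact ⟨0, fun h => absurd hj h⟩
    · obtain ⟨v, h⟩ := exists_eventually_eq (u := fun n => ((G n).loc j).view s)
        (fun n m hnm => ((hrun.le hnm).loc j).view s) (b := w) fun n => by
          by_contra! h
          exact hw n (hrun.reached_of_lt n hj h)
      exact ⟨v, fun _ => h⟩
  choose v hv using hv
  have hst : ∀ j ∉ S.byz, ∀ᶠ n in atTop, ((G n).loc j).Started s := fun j hj =>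
    (hrun.before_started hT hd n hs hj (le_max_left _ (T + 3 * S.Δ)) (le_max_right _ _)).eventually
  have hstuck := fun j (hj : j ∉ S.byz) hdec => hrun.stuck hj (hv j hj) hdec (hst j hj)
  by_cases hmany : AtLeast (f + 1) fun j => j ∉ S.byz ∧ ∃ n, ((G n).loc j).dec s ≠ none
  · obtain ⟨m, hm⟩ := hrun.decided_of_query hd hi (hstuck i hi hno).2.2 hmany
    exact hm (hno m)
  -- Fewer than `f + 1` of the at least `2f + 1` correct replicas ever decide, so `f + 1` of them
  -- remain undecided.
  set U : Finset (Replica f) :=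
    Finset.univ.filter fun j => j ∉ S.byz ∧ ∀ n, ((G n).loc j).dec s = none with hU
  have hcard : f + 1 ≤ U.card := by
    have h1 : ((Finset.univ \ S.byz) \ U).card < f + 1 := by
      by_contra! h
      refine hmany ⟨_, h, fun j hj => ?_⟩
      simp only [hU, Finset.mem_sdiff, Finset.mem_univ, true_and, Finset.mem_filter, not_and] at hj
      exact ⟨hj.1, by simpa using hj.2 hj.1⟩
    have h2 := Finset.le_card_sdiff U (Finset.univ \ S.byz)
    have h3 := S.compl_card
    omega
  have hmem : ∀ j, j ∈ U ↔ j ∉ S.byz ∧ ∀ n, ((G n).loc j).dec s = none := by simp [hU]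
  -- The `f + 1` undecided replicas all end in views at least that of `j₀`, so their ViewChanges
  -- draw every correct replica at least that far. Then `j₀` sees `2f + 1` replicas at its view and
  -- could start the view-change timer, which a stuck replica does not have.
  obtain ⟨j₀, hj₀, hmin⟩ := U.exists_min_image v ⟨i, (hmem i).2 ⟨hi, hno⟩⟩
  obtain ⟨hb₀, hdec₀⟩ := (hmem j₀).1 hj₀
  obtain ⟨hne, hstep, -⟩ := hstuck j₀ hb₀ hdec₀
  have hsend : ∀ j ∉ S.byz, v j₀ ≤ v j → ∃ n c, Msg.viewChange (v j) s j c ∈ ((G n).loc j).sent := by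
    intro j hj hle
    obtain ⟨m, hm⟩ := (hv j hj).exists
    obtain ⟨c, hc⟩ := (hrun.coreInv m hj s).viewChange (by omega)
    exact ⟨m, c, hm ▸ hc⟩
  have hrcv : ∀ q ∉ S.byz, ∀ᶠ n in atTop, ∀ j ∉ S.byz, v j₀ ≤ v j →
      ∃ c, Msg.viewChange (v j) s j c ∈ ((G n).loc q).rcv := by
    intro q hq
    refine eventually_correct (S := S) fun j hj => ?_
    refine eventually_imp_distrib_left.2 fun hle => ?_
    obtain ⟨m, c, hc⟩ := hsend j hj hle
    exact (hd.eventually hj hq hc).mono fun _ h => ⟨c, h⟩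
  have hge : ∀ q ∉ S.byz, v j₀ ≤ v q := by
    intro q hq
    obtain ⟨m, ⟨h1, h2⟩, h3⟩ := hrun.eventually_quiet ((hrcv q hq).and (hv q hq))
    rw [← h2]
    refine hrun.le_view_of_quiet h3 hq ⟨U, hcard, fun j hj => ?_⟩
    obtain ⟨c, hc⟩ := h1 j ((hmem j).1 hj).1 (hmin j hj)
    exact ⟨_, c, hmin j hj, hc⟩
  obtain ⟨m, ⟨⟨h1, h2⟩, h3, h4⟩, h5⟩ :=
    hrun.eventually_quiet (((hrcv j₀ hb₀).and (hv j₀ hb₀)).and hstep)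
  refine h5 j₀ hb₀ _ (Act.startViewTimer _ s h3 (hdec₀ m) h4 ?_)
  rw [h2]
  refine atLeast_of_correct S fun j hj => ?_
  obtain ⟨c, hc⟩ := h1 j hj (hge j hj)
  exact ⟨_, c, hge j hj, hc⟩

end Termination
-- Proposals under synchrony and repeated proposals
section Proposals

variable {f : ℕ} {Client Op Res State : Type*} {S : System f Client Op Res State}
  {G : ℕ → Global S} {s : Slot f} {n : ℕ} {i : Replica f} {T : ℝ}

/-- The progress of a replica that cannot act and has collected all DepVerifys in the initial
view. -/
theorem IsRun.step_of_collected (hrun : IsRun G) (hi : i ∉ S.byz) (hQ : (G n).Quiet (G n).now)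
    {x : Header f Client Op} (hv : ((G n).loc i).view x.slot = 0)
    (hp : ((G n).loc i).pr x.slot = true) (hc : ((G n).loc i).Collected x) :
    ((G n).loc i).val x.slot = some (x, ((G n).loc i).vec x) ∧
    (FpCond x (((G n).loc i).vec x) ∧ (((G n).loc i).step x.slot = .fpVerified ∨
        ((G n).loc i).step x.slot = .fpCommitted) ∨
      ¬ FpCond x (((G n).loc i).vec x) ∧ (((G n).loc i).step x.slot).Slow) := by
  have C := hrun.coreInv n hi x.slot
  have hcol : ∀ c, (c ↔ FpCond x (((G n).loc i).vec x)) →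
      ((G n).loc i).Collects x.slot (some (x, ((G n).loc i).vec x)) c :=
    fun c h => ⟨x, rfl, rfl, hc, hp, h⟩
  have hfast : ((G n).loc i).step x.slot = .fpVerified ∨ ((G n).loc i).step x.slot = .fpCommitted →
      ((G n).loc i).val x.slot = some (x, ((G n).loc i).vec x) ∧
        FpCond x (((G n).loc i).vec x) := fun h => by
    have h1 := (C.sent_depCommit _ (C.fast h)).1.unique (hcol _ Iff.rfl)
    exact ⟨h1.1, h1.2.1 trivial⟩
  have hslow : (((G n).loc i).step x.slot).Slow →
      ((G n).loc i).val x.slot = some (x, ((G n).loc i).vec x) ∧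
        ¬ FpCond x (((G n).loc i).vec x) := fun h => by
    have h0 := C.slow h
    rw [hv] at h0
    have h1 := ((C.sent_prepare _ _ h0).2.2.1 rfl).unique (hcol _ Iff.rfl)
    exact ⟨h1.1, fun h => h1.2.2 h⟩
  have key : (((G n).loc i).step x.slot = .fpVerified ∨ ((G n).loc i).step x.slot = .fpCommitted) ∨
      (((G n).loc i).step x.slot).Slow := by
    rcases hs : ((G n).loc i).step x.slot with _ | _ | _ | _ | _ | _ | _ | _
    · obtain ⟨y, h1, h2⟩ := (hrun.headerInv n i).pr_hdr _ hp
      rw [hc.1] at h1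
      cases h1
      exact absurd (Act.acceptRequest _ x hc.1 h2 hv hs) (hQ i hi _)
    · by_cases h : FpCond x (((G n).loc i).vec x)
      · exact absurd (Act.fpVerify _ x hv hs hc h) (hQ i hi _)
      · exact absurd (Act.rpVerify _ x hv hs hc h) (hQ i hi _)
    · exact Or.inl (Or.inl rfl)
    · exact Or.inl (Or.inr rfl)
    · exact Or.inr (Or.inl rfl)
    · exact Or.inr (Or.inr (Or.inl rfl))
    · exact Or.inr (Or.inr (Or.inr rfl))
    · exact absurd hv ((hrun.verifyInv n i).viewChange_view _ hs)
  rcases key with h | h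
  · exact ⟨(hfast h).1, Or.inl ⟨(hfast h).2, h⟩⟩
  · exact ⟨(hslow h).1, Or.inr ⟨(hslow h).2, h⟩⟩

/-- A request that is proposed by a correct coordinator with a correct fast-path quorum when the
network is synchronous is committed. -/
theorem IsRun.decided_of_propose (hrun : IsRun G) (hT : 0 ≤ T) (hd : Delivers G T)
    {x : Header f Client Op} (hco : x.slot.co ∉ S.byz)
    (hx : Msg.propose x ∈ ((G n).loc x.slot.co).sent) (hmin : ∀ m, (G m).Known x.slot → n ≤ m)
    (hF : ∀ i ∈ x.F, i ∉ S.byz) (hnow : T ≤ (G n).now) :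
    ∃ m D, ((G m).loc x.slot.co).dec x.slot = some (some x.req, D) := by
  have hΔ := S.Δ_pos
  have hpos := hrun.now_nonneg n
  set t := (G n).now with ht
  obtain ⟨-, hxh, hxp, -⟩ := (hrun.headerInv n _).sent_propose x hx
  obtain ⟨-, hvq, hwait⟩ := (hrun.headerInv n _).hdr_slot _ _ hxh
  -- Nobody knows the slot before time `t`, so commit timers start at `t` at the earliest, and the
  -- initial view lasts until `t + 9Δ`.
  have hview : ∀ m, (G m).now < t + 9 * S.Δ → ∀ i ∉ S.byz, ((G m).loc i).view x.slot ≤ 0 := by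
    refine fun m hm i hi => hrun.view_le_of_timers (a := t + 9 * S.Δ) ?_ m hm hi
    rintro m i hm hi hv τ hτ (h1 | ⟨h1, -⟩)
    · obtain ⟨k, hk, h2, -⟩ := hrun.comT_started m hi h1
      obtain ⟨h3, h4⟩ := h2 hv
      have := (hrun.le (hmin k h4)).now
      linarith
    · exact (hrun.verifyInv m i).viewChange_view _ h1 hv
  have hview0 : ∀ m, (G m).now < t + 9 * S.Δ → ∀ i ∉ S.byz, ((G m).loc i).view x.slot = 0 :=
    fun m hm i hi => Nat.le_zero.1 (hview m hm i hi)
  -- The proposal arrives within `Δ`; its dependencies and the preceding slot, known at time `t`,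
  -- are accepted within `3Δ`.
  have hA : Before G (t + 3 * S.Δ) fun G => ∀ i ∉ S.byz,
      (G.loc i).hdr x.slot = some x ∧ (G.loc i).pr x.slot = true := by
    refine hrun.before_correct (by linarith) fun i hi => ?_
    by_cases hic : i = x.slot.co
    · subst hic
      exact hrun.before (n := n) (by linarith) fun G' hle =>
        ⟨(hle.loc _).hdr _ _ hxh, (hle.loc _).pr _ hxp⟩
    have h1 : Before G (t + 3 * S.Δ) fun G => (G.loc i).WaitOK x.D := by
      refine (hrun.before_all (by linarith)
        (P := fun c G => ∀ k, x.D c = k + 1 → (G.loc i).Accepts ⟨c, k⟩)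
        fun c => ?_).mono le_rfl fun _ h => h
      rcases h : x.D c with _ | k
      · exact (hrun.before_true (by linarith)).mono le_rfl (by simp)
      · refine (hrun.before_accepts hT hd n (hrun.known_of_accepts hco (hwait c k h)) hi
          (by linarith) (by linarith)).mono le_rfl fun G h k' hk' => ?_
        obtain rfl : k = k' := by omega
        exact h
    have h2 : Before G (t + 3 * S.Δ) fun G => ∀ k, x.slot.sc = k + 1 →
        (G.loc i).Accepts ⟨x.slot.co, k⟩ := by
      rcases h : x.slot.sc with _ | k
      · exact (hrun.before_true (by linarith)).mono le_rfl (by simp)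
      · have h3 : ((G n).loc x.slot.co).hdr ⟨x.slot.co, k + 1⟩ ≠ none := by
          rw [← h, hxh]
          simp
        refine (hrun.before_accepts hT hd n (hrun.known_of_accepts hco
          ((hrun.headerInv n _).hdr_gap _ k h3)) hi
          (by linarith) (by linarith)).mono le_rfl fun G h k' hk' => ?_
        obtain rfl : k = k' := by omega
        exact h
    obtain ⟨m, h3, h4, h5⟩ := ((hd _ hco i hi n _ hx (t + 3 * S.Δ) (by linarith)
      (by linarith)).and (h1.and h2)).quiet hrun
    obtain ⟨h6, h7, h8⟩ := h4 m le_rfl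
    have hv := hview0 m (by linarith) i hi
    have h9 : ((G m).loc i).hdr x.slot = some x := by
      rcases accepts_of_quiet hi h5 (Or.inl h6) hvq hic h7 h8 with ⟨-, h9⟩ | h9
      · obtain ⟨y, hy⟩ := Option.ne_none_iff_exists'.1 h9
        rw [hy, hrun.hdr_eq hco hy hxh]
      · exact absurd hv h9
    refine hrun.before h3 fun G' hle => ⟨(hle.loc i).hdr _ _ h9, (hle.loc i).pr _ ?_⟩
    exact (hrun.coreInv m hi x.slot).pr hv fun h10 =>
      h5 i hi _ (Act.acceptRequest _ x h9 h6 hv h10)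
  obtain ⟨mA, hA1, hA2⟩ := id hA
  classical
  have hD : ∀ q, ∃ D, q ∈ x.F → Msg.verify q x D ∈ ((G mA).loc q).sent := by
    intro q
    by_cases hq : q ∈ x.F
    · obtain ⟨h1, h2⟩ := hA2 mA le_rfl q (hF q hq)
      obtain ⟨D, h3⟩ := (hrun.verifyInv mA q).verify_of_pr _ _ h1 h2 hq
      exact ⟨D, fun _ => h3⟩
    · exact ⟨0, fun h => absurd h hq⟩
  choose D hD using hD
  -- Dependencies of the DepVerifys may have become known as late as `t + 3Δ`; accepting them costs
  -- another `3Δ`.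
  have hB : Before G (t + 6 * S.Δ) fun G => ∀ i ∉ S.byz, (G.loc i).Collected x := by
    refine hrun.before_correct (by linarith) fun i hi => ?_
    have h1 : Before G (t + 6 * S.Δ) fun G => ∀ q, q ∉ S.byz → q ∈ x.F →
        Msg.verify q x (D q) ∈ (G.loc i).rcv ∧ (G.loc i).WaitOK (D q) := by
      refine hrun.before_correct (by linarith) fun q hq => ?_
      by_cases hqF : q ∈ x.F
      · have h2 := (hd q hq i hi mA _ (hD q hqF) (t + 6 * S.Δ) (by linarith) (by linarith))
        have h3 := ((hrun.verifyInv mA q).sent_verify _ _ _ (hD q hqF)).2.2.2.2.2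
        have h4 : Before G (t + 6 * S.Δ) fun G => (G.loc i).WaitOK (D q) := by
          refine (hrun.before_all (by linarith)
            (P := fun c G => ∀ k, D q c = k + 1 → (G.loc i).Accepts ⟨c, k⟩)
            fun c => ?_).mono le_rfl fun _ h => h
          rcases h : D q c with _ | k
          · exact (hrun.before_true (by linarith)).mono le_rfl (by simp)
          · refine (hrun.before_accepts hT hd mA (hrun.known_of_accepts hq (h3 c k h)) hi
              (by linarith) (by linarith)).mono le_rfl fun G h k' hk' => ?_
            obtain rfl : k = k' := by omega
            exact h
        exact (h2.and h4).mono le_rfl fun _ h _ => h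
      · exact (hrun.before_true (by linarith)).mono le_rfl fun _ _ h => absurd h hqF
    obtain ⟨m, h3, h4, h5⟩ :=
      (h1.and (hA.mono (by linarith : t + 3 * S.Δ ≤ t + 6 * S.Δ) fun _ => id)).quiet hrun
    obtain ⟨h6, h7⟩ := h4 m le_rfl
    have h8 : ((G m).loc i).Collected x := by
      refine ⟨(h7 i hi).1, fun q hq hv => ?_⟩
      obtain ⟨h9, h10⟩ := h6 q (hF q hq) hq
      exact h5 i hi _ (Act.acceptVerify _ x q (D q) h9 (h7 i hi).1 hq
        (hview0 m (by linarith) i hi) hv h10)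
    exact hrun.before h3 fun G' hle => ((hle.loc i).collected h8).1
  set g : Replica f → Deps f := fun q => if q ∈ x.F then D q else 0 with hg
  -- All followers are correct and send one DepVerify each, so all replicas collect the same vector
  -- and take the same path.
  have hvec : ∀ m ≥ mA, ∀ i, ((G m).loc i).Collected x → ((G m).loc i).vec x = g := by
    intro m hm i hc
    funext q
    simp only [Local.vec, hg]
    split
    · next hq =>
      obtain ⟨E, hE⟩ := Option.ne_none_iff_exists'.1 (hc.2 q hq)
      obtain ⟨y, h1, -, h2, -⟩ := (hrun.verifyInv m i).v_some _ _ _ hE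
      rw [hc.1] at h1
      cases h1
      have h3 : Msg.verify q x E ∈ ((G m).loc q).sent :=
        Global.Signed.sent ((hrun.genuine m i).1 _ h2) (hF q hq)
      rw [hE]
      exact (hrun.verifyInv m q).verify_unique _ _ _ h3 (((hrun.le hm).loc q).sent (hD q hq))
    · rfl
  have hall : Before G (t + 6 * S.Δ) fun G => ∀ i ∉ S.byz,
      (G.loc i).Collected x ∧ (G.loc i).pr x.slot = true ∧ (G.loc i).vec x = g := by
    obtain ⟨mB, h1, h2⟩ := hB
    refine ⟨max mA mB, ?_, fun m hm i hi => ?_⟩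
    · rcases max_choice mA mB with h | h <;> rw [h] <;> linarith
    · have h3 := h2 m ((le_max_right _ _).trans hm) i hi
      have h4 := (le_max_left _ _).trans hm
      exact ⟨h3, (hA2 m h4 i hi).2, hvec m h4 i h3⟩
  have hst : ∀ m, (G m).now < t + 9 * S.Δ → (G m).Quiet (G m).now → (∀ i ∉ S.byz,
      ((G m).loc i).Collected x ∧ ((G m).loc i).pr x.slot = true ∧ ((G m).loc i).vec x = g) →
      ∀ i ∉ S.byz, ((G m).loc i).val x.slot = some (x, g) ∧
        (FpCond x g ∧ (((G m).loc i).step x.slot = .fpVerified ∨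
            ((G m).loc i).step x.slot = .fpCommitted) ∨
          ¬ FpCond x g ∧ (((G m).loc i).step x.slot).Slow) := by
    intro m hm hQ h i hi
    obtain ⟨h1, h2, h3⟩ := h i hi
    have h4 := hrun.step_of_collected hi hQ (hview0 m hm i hi) h2 h1
    rwa [h3] at h4
  suffices h : ∃ m, ((G m).loc x.slot.co).dec x.slot ≠ none ∧
      (G m).Chosen x.slot (some (x, g)) by
    obtain ⟨m, h1, h2⟩ := h
    obtain ⟨d, h3⟩ := Option.ne_none_iff_exists'.1 h1
    obtain ⟨val, rfl, h4⟩ := hrun.chosen_of_dec m hco _ _ h3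
    rw [hrun.chosen_unique h4 h2] at h3
    exact ⟨m, _, h3⟩
  obtain ⟨k, hk1, hk2, hk3⟩ := hall.quiet hrun
  have hk4 := hst k (by linarith) hk3 (hk2 k le_rfl)
  -- The fast path needs one more message delay, the reconciliation path two; both end before `t +
  -- 9Δ`.
  by_cases hc : FpCond x g
  · have h1 : ∀ i ∉ S.byz, Msg.depCommit x.slot i (some (x, g)) ∈ ((G k).loc i).sent := by
      intro i hi
      obtain ⟨h1, ⟨-, h2⟩ | ⟨h2, -⟩⟩ := hk4 i hi
      · rw [← h1]
        exact (hrun.coreInv k hi _).fast h2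
      · exact absurd hc h2
    have h2 : Before G (t + 7 * S.Δ) fun G => ∀ i ∉ S.byz,
        Msg.depCommit x.slot i (some (x, g)) ∈ (G.loc x.slot.co).rcv :=
      hrun.before_correct (by linarith) fun i hi =>
        hd i hi _ hco k _ (h1 i hi) _ (by linarith) (by linarith)
    obtain ⟨m, h3, h4, h5⟩ :=
      (h2.and (hall.mono (by linarith : t + 6 * S.Δ ≤ t + 7 * S.Δ) fun _ => id)).quiet hrun
    obtain ⟨h6, h7⟩ := h4 m le_rfl
    refine ⟨m, ?_, Or.inl (atLeast_of_correct S fun i hi => (hrun.genuine m _).1 _ (h6 i hi))⟩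
    obtain ⟨h8, ⟨-, h9 | h9⟩ | ⟨h9, -⟩⟩ := hst m (by linarith) h5 h7 _ hco
    · refine absurd (Act.fpCommit _ x.slot h9 (atLeast_of_correct S fun i hi => ?_)) (h5 _ hco _)
      rw [h8]
      exact h6 i hi
    · exact (hrun.coreInv m hco _).dec (Or.inl h9)
    · exact absurd hc h9
  · have h1 : ∀ i ∉ S.byz, Msg.prepare 0 x.slot i (some (x, g)) ∈ ((G k).loc i).sent := by
      intro i hi
      obtain ⟨h1, ⟨h2, -⟩ | ⟨-, h2⟩⟩ := hk4 i hi
      · exact absurd h2 hc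
      · have h3 := (hrun.coreInv k hi _).slow h2
        rwa [h1, hview0 k (by linarith) i hi] at h3
    obtain ⟨m, -, h2⟩ := hrun.decided_of_prepared hT hd (b := t + 6 * S.Δ) (by linarith)
      (hrun.before hk1 fun G' hle i hi => (hle.loc i).sent (h1 i hi))
      (fun m hm i hi => hview m (by linarith) i hi) hco
    exact ⟨m, h2 m le_rfl⟩

/-- Each proposal of `r` occupies a slot that gets decided. As long as the result is not `r`, it is
the no-op and the next attempt becomes due. -/
theorem IsRun.eventually_mem_mine (hrun : IsRun G) (hT : 0 ≤ T) (hd : Delivers G T) (hi : i ∉ S.byz)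
    {r : Req Client Op} (hr : Msg.request r ∈ ((G n).loc i).rcv)
    (hno : ∀ k m D, ((G m).loc i).dec ⟨i, k⟩ ≠ some (some r, D)) (a : ℕ) :
    ∃ m, (r, a) ∈ ((G m).loc i).mine := by
  induction a with
  | zero =>
    obtain ⟨m, h1, h2⟩ := hrun.eventually_quiet (Filter.eventually_ge_atTop n)
    refine ⟨m, ?_⟩
    by_contra hno
    exact h2 i hi _ (Act.propose _ r 0 _ _ hno
      (Or.inl ⟨rfl, ((hrun.le h1).loc i).rcv hr⟩) rfl rfl)
  | succ a ih =>
    obtain ⟨m, hm⟩ := ih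
    obtain ⟨k, hk, hk'⟩ := List.getElem_of_mem hm
    have hk2 : ((G m).loc i).mine[k]? = some (r, a) := by rw [List.getElem?_eq_getElem hk, hk']
    have h1 := (hrun.headerInv m i).mine_hdr k hk
    obtain ⟨m', h2⟩ := hrun.decided hT hd ⟨i, hi, h1⟩ hi
    obtain ⟨l, ⟨h3, h4⟩, h5⟩ := hrun.eventually_quiet
      ((Filter.eventually_ge_atTop m).and (Filter.eventually_ge_atTop m'))
    obtain ⟨d, h6⟩ := Option.ne_none_iff_exists'.1 h2
    have h7 := ((hrun.le h4).loc i).dec _ _ h6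
    have h8 : ((G l).loc i).mine[k]? = some (r, a) := by
      obtain ⟨t, ht⟩ := ((hrun.le h3).loc i).mine
      rw [← ht, List.getElem?_append_left hk, hk2]
    -- A decided request needs a header signed by the coordinator, and a correct coordinator has
    -- signed only the one with `r` for this slot.
    have h9 : ∃ D, d = (none, D) := by
      obtain ⟨val, rfl, h9⟩ := hrun.sound_of_dec hi h7
      match val, h9 with
      | none, _ => exact ⟨_, rfl⟩
      | some (x, g), h9 =>
        exfalso
        have h10 := h9.2.1.1
        unfold Global.SignedHeader at h10
        rw [h9.1.1] at h10
        obtain ⟨-, -, -, b, h11, -⟩ := (hrun.headerInv l i).sent_propose x (h10.sent hi)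
        rw [h9.1.1] at h11
        simp only [h8, Option.some.injEq, Prod.mk.injEq] at h11
        refine hno k l (outcome (some (x, g))).2 (h7.trans ?_)
        rw [h11.1]
        rfl
    obtain ⟨D, rfl⟩ := h9
    refine ⟨l, ?_⟩
    by_contra hno
    exact h5 i hi _ (Act.propose _ r (a + 1) _ _ hno
      (Or.inr ⟨a, k, rfl, h8, D, h7⟩) rfl rfl)

/-- A request that is received by a correct replica is committed in some slot. -/
theorem IsRun.request_decided (hrun : IsRun G) (hT : 0 ≤ T) (hd : Delivers G T) (hi : i ∉ S.byz)
    {r : Req Client Op} (hr : Msg.request r ∈ ((G n).loc i).rcv) :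
    ∃ k m D, ((G m).loc i).dec ⟨i, k⟩ = some (some r, D) := by
  by_contra! hno
  obtain ⟨N, hN⟩ := hrun.unbounded T
  -- Attempts numbered from `A` on have not been made in state `N`, so they take place after
  -- synchronization; one of them uses a quorum of correct followers.
  have hbound : ∃ A, ∀ a, (r, a) ∈ ((G N).loc i).mine → a < A := by
    refine ⟨(((G N).loc i).mine.map Prod.snd).sum + 1, fun a ha => Nat.lt_succ_of_le ?_⟩
    exact List.le_sum_of_mem (List.mem_map.2 ⟨_, ha, rfl⟩)
  obtain ⟨A, hA⟩ := hbound
  obtain ⟨a, ha, hF⟩ := S.exists_correct_quorum i hi A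
  obtain ⟨m, hm⟩ := hrun.eventually_mem_mine hT hd hi hr hno a
  obtain ⟨l, -, h1, h2⟩ := exists_step (p := fun m => (r, a) ∈ ((G m).loc i).mine)
    (by rw [hrun.start]; exact List.not_mem_nil) hm
  have hlN : N ≤ l + 1 := by
    by_contra! h
    have h3 := ((hrun.le h.le).loc i).mine.subset h2
    exact absurd (hA a h3) (by omega)
  rcases hrun.loc_step l i with h | ⟨-, -, h⟩ | ⟨-, -, x, -, h⟩
  · rw [h] at h2
    exact h1 h2
  · rcases h.mine_cases with h3 | ⟨r', a', -, h3, -, h4⟩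
    · exact h1 (h3 ▸ h2)
    · rw [h3, List.mem_append, List.mem_singleton] at h2
      cases h2.resolve_left h1
      have h5 := (hrun.headerInv (l + 1) i).hdr_own _ _ h4 rfl
      -- A known slot of a correct coordinator is among its proposals, and this one is new, so its
      -- first appearance is in state `l + 1`.
      have hmin : ∀ m, (G m).Known ⟨i, ((G l).loc i).mine.length⟩ → l + 1 ≤ m := by
        intro m hm
        by_contra! hlt
        have h7 := hrun.lt_of_known hi hm
        have h8 := ((hrun.le (Nat.le_of_lt_succ hlt)).loc i).mine.length_le
        simp only at h7
        omega
      obtain ⟨m', D, h6⟩ := hrun.decided_of_propose (x := ⟨⟨i, _⟩, r, _, S.quorum i a⟩) hT hd hi h5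
        hmin hF (hN.le.trans (hrun.le hlN).now)
      exact hno _ _ _ h6
  · rw [h] at h2
    exact h1 h2

end Proposals
-- Existence of executable components
section Components

variable {f : ℕ} {Client Op Res State : Type*} {S : System f Client Op Res State} {L : Local S}

theorem Slot.exists_list {A : Set (Slot f)} (hA : A.Finite) :
    ∃ l : List (Slot f), (∀ x, x ∈ l ↔ x ∈ A) ∧ l.Pairwise Slot.Before := by
  classical
  let e : Slot f → ℕ ×ₗ Fin (3 * f + 1) := fun s => toLex (s.sc, s.co)
  let e' : ℕ ×ₗ Fin (3 * f + 1) → Slot f := fun p => ⟨(ofLex p).2, (ofLex p).1⟩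
  refine ⟨((hA.toFinset.image e).sort (· ≤ ·)).map e', fun x => ?_, ?_⟩
  · simp only [List.mem_map, Finset.mem_sort, Finset.mem_image, Set.Finite.mem_toFinset]
    constructor
    · rintro ⟨-, ⟨y, hy, rfl⟩, rfl⟩
      exact hy
    · exact fun hx => ⟨e x, ⟨x, hx, rfl⟩, rfl⟩
  · rw [List.pairwise_map]
    refine (Finset.sortedLT_sort _).pairwise.imp fun {a b} h => ?_
    rw [Prod.Lex.lt_iff] at h
    exact h

/-- The reachable slots lie in finite windows. A reachable slot with the fewest slots reachable from
it works: whatever it reaches has the same reachable set and so reaches it back. -/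
theorem Local.Ready.exists_firstComponent {W : Slot f → Prop} {a : Slot f} (h : L.Ready W a) :
    ∃ l, L.FirstComponent W a l := by
  have hfin : ∀ b, L.Reach W a b → {x | L.Reach W b x}.Finite := by
    intro b hb
    have h1 : (⋃ c : Replica f, (fun n => (⟨c, n⟩ : Slot f)) '' Set.Iio (L.root c + S.k)).Finite :=
      Set.finite_iUnion fun c => (Set.finite_Iio _).image _
    refine h1.subset fun x hx => ?_
    exact Set.mem_iUnion.2 ⟨x.co, x.sc, (h.reach x (hb.trans hx)).2, rfl⟩
  have hne : {b | L.Reach W a b}.Nonempty := ⟨a, .refl⟩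
  obtain ⟨b, hb, hmin⟩ := Set.exists_min_image _ (fun b => {x | L.Reach W b x}.ncard)
    (hfin a .refl) hne
  obtain ⟨l, hl, hl'⟩ := Slot.exists_list (hfin b hb)
  refine ⟨l, b, hb, fun x hx => ?_, hl, hl'⟩
  have h1 : {y | L.Reach W x y} ⊆ {y | L.Reach W b y} := fun y hy => hx.trans hy
  have h2 := Set.eq_of_subset_of_ncard_le h1 (hmin x (hb.trans hx)) (hfin b hb)
  have h3 : b ∈ {y | L.Reach W b y} := .refl
  rw [← h2] at h3
  exact h3

/-- Either something can be executed regularly, or this is the very situation in which unblocking is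
allowed. -/
theorem not_unblockable_of_quiet {me : Replica f} {now : ℝ} (hf : L.done.Finite)
    (hQ : ∀ L', ¬ Act S me now L L') (a : Slot f) : ¬ L.Unblockable a := by
  intro h
  by_cases hreg : ∃ b, L.Executable b
  · obtain ⟨b, hb⟩ := hreg
    obtain ⟨l, hl⟩ := hb.ready.exists_firstComponent
    exact hQ _ (Act.execRegular L b l hb hl)
  · push Not at hreg
    obtain ⟨l, hl⟩ := (h.ready hf).exists_firstComponent
    exact hQ _ (Act.execUnblock L a l hreg h hl)

end Components

/-! ### Liveness of execution -/

section Execution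

variable {f : ℕ} {Client Op Res State : Type*} {S : System f Client Op Res State}
  {G : ℕ → Global S} {s : Slot f} {n : ℕ} {i : Replica f} {T : ℝ}

open Filter

/-- A slot is accepted only after its predecessor, so known slots of a coordinator have no gaps.
This turns implicit dependencies into known ones. -/
theorem IsRun.known_of_le (hrun : IsRun G) {c : Replica f} {k m : ℕ} (h : k ≤ m)
    (hm : (G n).Known ⟨c, m⟩) : (G n).Known ⟨c, k⟩ := by
  induction m, h using Nat.le_induction with
  | base => exact hm
  | succ m _ ih =>
    obtain ⟨j, hj, hx⟩ := hm
    exact ih (hrun.known_of_accepts hj ((hrun.headerInv n j).hdr_gap c m hx))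

theorem IsRun.known_of_covers (hrun : IsRun G) (hi : i ∉ S.byz) {d : Decision f Client Op}
    (h : ((G n).loc i).dec s = some d) {y : Slot f} (hy : Covers d.2 y) : (G n).Known y := by
  obtain ⟨val, rfl, h1⟩ := hrun.sound_of_dec hi h
  match val, h1 with
  | none, _ => exact absurd hy (Nat.not_lt_zero _)
  | some (x, g), h1 =>
    obtain ⟨m, h2, h3⟩ := h1.2.2 y hy
    exact hrun.known_of_le h2 h3

/-- Every slot for which the agreement was started is executed by all correct replicas. -/
theorem IsRun.executed (hrun : IsRun G) (hT : 0 ≤ T) (hd : Delivers G T) (hs : (G n).Known s)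
    (hi : i ∉ S.byz) : ∃ m, s ∈ ((G m).loc i).done := by
  by_contra! hno
  -- With `E` the slots that are ever executed, `A` consists of the final windows. They and the set
  -- `B` of dependencies of their slots are finite, so one state has all executions and decisions
  -- that concern them.
  set E : Set (Slot f) := {x | ∃ m, x ∈ ((G m).loc i).done} with hE
  set A : Set (Slot f) := {x | x.sc < rootOf E x.co + S.k} with hA
  have hAfin : A.Finite := by
    have h1 : (⋃ c : Replica f, (fun n => (⟨c, n⟩ : Slot f)) '' Set.Iio (rootOf E c + S.k)).Finite :=
      Set.finite_iUnion fun c => (Set.finite_Iio _).image _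
    exact h1.subset fun x hx => Set.mem_iUnion.2 ⟨x.co, x.sc, hx, rfl⟩
  set B : Set (Slot f) := ⋃ x ∈ A, {y | ∃ d, decisions G x = some d ∧ Covers d.2 y} with hB
  have hBfin : B.Finite := by
    refine hAfin.biUnion fun x _ => ?_
    rcases hx : decisions G x with _ | d
    · simp
    · have h1 : (⋃ c : Replica f, (fun n => (⟨c, n⟩ : Slot f)) '' Set.Iio (d.2 c)).Finite :=
        Set.finite_iUnion fun c => (Set.finite_Iio _).image _
      refine h1.subset fun y hy => ?_
      obtain ⟨d', h2, h3⟩ := hy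
      cases h2
      exact Set.mem_iUnion.2 ⟨y.co, y.sc, h3, rfl⟩
  have h1 : ∀ᶠ n in atTop, ∀ x ∈ A ∪ B, x ∈ E → x ∈ ((G n).loc i).done := by
    refine (eventually_all_finite (hAfin.union hBfin)).2 fun x _ => ?_
    refine eventually_imp_distrib_left.2 fun ⟨m, hm⟩ => ?_
    exact eventually_atTop.2 ⟨m, fun k hk => ((hrun.le hk).loc i).done hm⟩
  have h2 : ∀ᶠ n in atTop, ∀ x ∈ A, (∃ m, (G m).Known x) → ((G n).loc i).dec x ≠ none := by
    refine (eventually_all_finite hAfin).2 fun x _ => ?_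
    refine eventually_imp_distrib_left.2 fun ⟨m, hm⟩ => ?_
    obtain ⟨k, hk⟩ := hrun.decided hT hd hm hi
    obtain ⟨d, hd'⟩ := Option.ne_none_iff_exists'.1 hk
    exact eventually_atTop.2 ⟨k, fun l hl => by simp [((hrun.le hl).loc i).dec _ _ hd']⟩
  obtain ⟨m, ⟨h3, h4⟩, h5⟩ := hrun.eventually_quiet (h1.and h2)
  have hf := (hrun.exec m i).1
  -- For a coordinator with a slot that is never executed, the current root is already final. The
  -- restriction is needed because otherwise `rootOf E c` is the default `0`.
  have hroot : ∀ c, (∃ k, (⟨c, k⟩ : Slot f) ∉ E) →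
      (⟨c, rootOf E c⟩ : Slot f) ∉ E ∧ ((G m).loc i).root c = rootOf E c := by
    intro c hc
    have h6 : (⟨c, rootOf E c⟩ : Slot f) ∉ E := Nat.sInf_mem (s := {k | (⟨c, k⟩ : Slot f) ∉ E}) hc
    refine ⟨h6, le_antisymm (rootOf_le (s := ⟨c, _⟩) fun h => h6 ⟨m, h⟩) ?_⟩
    by_contra! hlt
    refine rootOf_notMem hf c (h3 _ (Or.inl ?_) (mem_of_lt_rootOf (s := ⟨c, _⟩) hlt))
    exact lt_of_lt_of_le hlt (Nat.le_add_right _ _)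
  have hsE : s ∉ E := fun ⟨m, hm⟩ => hno m hm
  obtain ⟨ha1, ha2⟩ := hroot s.co ⟨s.sc, hsE⟩
  -- The final root of the coordinator of `s` could be unblocked, as everything reachable from it
  -- within the windows is known and hence decided.
  refine not_unblockable_of_quiet hf (h5 i hi) ⟨s.co, rootOf E s.co⟩ ⟨ha2.symm, fun b hb => ?_⟩
  have key : b ∈ A ∧ ∃ m, (G m).Known b := by
    induction hb with
    | refl =>
      exact ⟨Nat.lt_add_of_pos_right S.k_pos, n, hrun.known_of_le (rootOf_le hsE) hs⟩
    | tail _ h ih =>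
      obtain ⟨h7, h8, d, h9, h10⟩ := h
      refine ⟨?_, m, hrun.known_of_covers hi h9 h10⟩
      -- A dependency of a slot in `A` that is not executed by now never will be, so its window is a
      -- final one and it lies in `A` again.
      have h11 : _ ∉ E := fun hc => h7 (h3 _ (Or.inr (Set.mem_biUnion ih.1
        ⟨d, hrun.decisions_eq hi h9, h10⟩)) hc)
      have h12 := (hroot _ ⟨_, h11⟩).2
      unfold Local.InWindow at h8
      rwa [h12] at h8
  exact h4 b key.1 key.2

end Execution
-- Results of clients
section Clients

variable {f : ℕ} {Client Op Res State : Type*} {S : System f Client Op Res State}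
  {G : ℕ → Global S} {n : ℕ} {c : Client} {r : Req Client Op} {T : ℝ}

open Filter

theorem Global.Le.hasResult {G G' : Global S} (h : G.Le G') (hc : c ∈ S.goodClient) {u : Res}
    (hr : (G.cl c).HasResult r u) : (G'.cl c).HasResult r u :=
  AtLeast.mono hr le_rfl fun _ hi => h.replies c hc hi

/-- A client issues requests one after the other. -/
theorem IsRun.client_step (hrun : IsRun G) (n : ℕ) (c : Client) :
    ((G (n + 1)).cl c).issued = ((G n).cl c).issued ∧
      ((G (n + 1)).cl c).deadline = ((G n).cl c).deadline ∨
    ∃ r, ((G (n + 1)).cl c).issued = r :: ((G n).cl c).issued ∧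
      ∀ r' ∈ ((G n).cl c).issued, r'.t < r.t ∧ ∃ u, ((G n).cl c).HasResult r' u := by
  have h := hrun.next n
  generalize G (n + 1) = G' at h
  cases h with
  | issue r j hc h =>
    by_cases e : c = r.client
    · subst e
      exact Or.inr ⟨r, by simp, h⟩
    · simp [e]
  | resend c' r hc h =>
    by_cases e : c = c'
    · subst e
      simp
    · simp [e]
  | reply c' i t u hc h =>
    by_cases e : c = c'
    · subst e
      simp
    · simp [e]
  | _ => exact Or.inl ⟨rfl, rfl⟩

theorem IsRun.issued (hrun : IsRun G) (n : ℕ) (hc : c ∈ S.goodClient) :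
    ((G n).cl c).issued.Pairwise (fun a b => b.t < a.t) ∧
      ∀ r ∈ ((G n).cl c).issued.tail, ∃ u, ((G n).cl c).HasResult r u := by
  induction n with
  | zero =>
    rw [hrun.start]
    simp [Global.start]
  | succ n ih =>
    have hle := hrun.le_succ n
    rcases hrun.client_step n c with ⟨h, -⟩ | ⟨r, h1, h2⟩
    · rw [h]
      refine ⟨ih.1, fun r hr => ?_⟩
      obtain ⟨u, hu⟩ := ih.2 r hr
      exact ⟨u, hle.hasResult hc hu⟩
    · rw [h1]
      refine ⟨List.pairwise_cons.2 ⟨fun r' hr' => (h2 r' hr').1, ih.1⟩, fun r' hr' => ?_⟩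
      obtain ⟨u, hu⟩ := (h2 r' hr').2
      exact ⟨u, hle.hasResult hc hu⟩

/-- Decided requests of correct clients were issued. -/
theorem IsRun.issued_of_decisions (hrun : IsRun G) {s : Slot f} {E : Deps f}
    (h : decisions G s = some (some r, E)) (hc : r.client ∈ S.goodClient) :
    ∃ m, r ∈ ((G m).cl r.client).issued := by
  obtain ⟨m, i, hi, h1⟩ := exists_of_decisions h
  obtain ⟨val, h2, h3⟩ := hrun.sound_of_dec hi h1
  match val, h2, h3 with
  | some (x, g), h2, h3 =>
    obtain rfl : r = x.req := by
      have := congrArg Prod.fst h2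
      exact Option.some.inj this
    exact ⟨m, h3.2.1.2.1.resolve_left fun h => h hc⟩

/-- A slot of a correct coordinator is decided only after its proposal. -/
theorem IsRun.known_of_dec (hrun : IsRun G) {s : Slot f} {i : Replica f} (hi : i ∉ S.byz)
    (hs : s.co ∉ S.byz) {D : Deps f} (h : ((G n).loc i).dec s = some (some r, D)) :
    (G n).Known s := by
  obtain ⟨val, h2, h3⟩ := hrun.sound_of_dec hi h
  match val, h2, h3 with
  | some (x, g), _, h3 =>
    have h4 := h3.2.1.1
    unfold Global.SignedHeader at h4
    rw [h3.1.1] at h4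
    have h5 := ((hrun.headerInv n _).sent_propose x (h4.sent hs)).2.1
    rw [h3.1.1] at h5
    exact ⟨s.co, hs, by simp [h5]⟩

/-- Every request of a correct client eventually has a result. -/
theorem IsRun.exists_result (hrun : IsRun G) (hrel : Reliable G) (hsync : SynchronousFrom G T)
    (hc : r.client ∈ S.goodClient) (hr : r ∈ ((G n).cl r.client).issued) :
    ∃ n' u, ((G n').cl r.client).HasResult r u := by
  by_contra! hno
  obtain ⟨T', hT, hd⟩ := hrun.exists_delivers hrel hsync
  have hiss : ∀ m ≥ n, r ∈ ((G m).cl r.client).issued := fun m hm =>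
    (hrun.le hm).issued _ hc _ hr
  -- The client issues nothing further while `r` has no result; so `r` stays its latest request and
  -- keeps its deadline.
  have hhead : ∀ m ≥ n, ∃ l, ((G m).cl r.client).issued = r :: l := by
    intro m hm
    have h1 := hiss m hm
    have h2 := (hrun.issued m hc).2
    rcases hl : ((G m).cl r.client).issued with _ | ⟨r', l⟩
    · rw [hl] at h1
      cases h1
    · rw [hl] at h1 h2
      rcases List.mem_cons.1 h1 with rfl | h1
      · exact ⟨l, rfl⟩
      · obtain ⟨u, hu⟩ := h2 r h1
        exact absurd hu (hno m u)
  have hdl : ∀ m ≥ n, ((G m).cl r.client).deadline = ((G n).cl r.client).deadline := by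
    intro m hm
    induction m, hm using Nat.le_induction with
    | base => rfl
    | succ m hm ih =>
      rcases hrun.client_step m r.client with ⟨-, h⟩ | ⟨r', -, h⟩
      · rw [h, ih]
      · obtain ⟨u, hu⟩ := (h r (hiss m hm)).2
        exact absurd hu (hno m u)
  obtain ⟨m, ⟨-, hm⟩, hm1, hm2⟩ := (hrun.frequently_quiet.and_eventually
    ((hrun.eventually_now ((G n).cl r.client).deadline).and (eventually_ge_atTop n))).exists
  have hsend : ∀ j, (r, j) ∈ ((G m).cl r.client).sends := by
    by_contra! h
    obtain ⟨l, hl⟩ := hhead m hm2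
    refine hm _ hc r ⟨by rw [hl]; rfl, hno m, ?_, h⟩
    rw [hdl m hm2]
    exact hm1.le
  obtain ⟨j, hj, -⟩ := (atLeast_of_correct S (p := fun i => i ∉ S.byz) fun _ h => h).inter S
    (atLeast_of_correct S (p := fun i => i ∉ S.byz) fun _ h => h)
  obtain ⟨m₁, h1⟩ := hrel.requests _ hc j hj m r (hsend j)
  obtain ⟨k, m₂, D, h2⟩ := hrun.request_decided hT hd hj h1
  have hD := hrun.decisions_eq hj h2
  have hreply : ∀ i ∉ S.byz, ∃ m u, Msg.reply i r.client r.t u ∈ ((G m).loc i).sent := by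
    intro i hi
    obtain ⟨m₃, h3⟩ := hrun.executed hT hd (hrun.known_of_dec hj hj h2) hi
    have I := hrun.execInv m₃ i
    have h4 := I.done _ h3 r D hD
    obtain ⟨t, ht⟩ := WithBot.ne_bot_iff_exists.1 (ne_bot_of_le_ne_bot WithBot.coe_ne_bot h4)
    replace ht := ht.symm
    -- Executing or skipping the slot of `r` leaves a last timestamp of at least `r.t`. It belongs
    -- to a decided request that the client issued, and `r` is the latest one; so the timestamp is
    -- `r.t` itself, and it was answered.
    obtain ⟨⟨u, hu⟩, s', r', E, h5, h6, rfl⟩ := I.last _ _ ht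
    obtain ⟨m₄, h7⟩ := hrun.issued_of_decisions h5 (h6 ▸ hc)
    rw [h6] at h7
    have h8 := (hrun.le (le_max_left m₄ n)).issued _ hc _ h7
    obtain ⟨l, hl⟩ := hhead _ (le_max_right m₄ n)
    have h9 := (hrun.issued (max m₄ n) hc).1
    rw [hl] at h8 h9
    have h10 : r'.t ≤ r.t := by
      rcases List.mem_cons.1 h8 with rfl | h8
      · exact le_rfl
      · exact ((List.pairwise_cons.1 h9).1 _ h8).le
    rw [ht] at h4
    have h11 : r.t ≤ r'.t := WithBot.coe_le_coe.1 h4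
    rw [le_antisymm h10 h11] at hu
    exact ⟨m₃, u, hu⟩
  obtain ⟨m₅, u, h5⟩ := hreply j hj
  -- All correct replicas reply with the same `u`, and there are at least `2f + 1` of them.
  have hall : ∀ᶠ n in atTop, ∀ i ∉ S.byz, (i, r.t, u) ∈ ((G n).cl r.client).replies := by
    refine eventually_correct (S := S) fun i hi => ?_
    obtain ⟨m₆, u', h6⟩ := hreply i hi
    obtain rfl := hrun.reply_unique h5 h6
    obtain ⟨m₇, h7⟩ := hrel.replies i hi _ hc m₆ _ _ h6
    exact eventually_atTop.2 ⟨m₇, fun k hk => (hrun.le hk).replies _ hc h7⟩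
  obtain ⟨N, hN⟩ := hall.exists
  exact hno N u ((atLeast_of_correct S hN).mono (by omega) fun _ h => h)

end Clients
end Isos

theorem mainTheorem4 {f : ℕ} {Client Op Res State : Type*}
    (S : Isos.System f Client Op Res State)
    (G : ℕ → Isos.Global S) (hrun : Isos.IsRun G) (hrel : Isos.Reliable G)
    (T : ℝ) (hsync : Isos.SynchronousFrom G T)
    (n : ℕ) (r : Isos.Req Client Op) (hc : r.client ∈ S.goodClient)
    (hr : r ∈ ((G n).cl r.client).issued) :
    ∃ n' u, ((G n').cl r.client).HasResult r u :=
  hrun.exists_result hrel hsync hc hr
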